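/- Let $p$ be a prime and let $F$ be $\mathbb{C}$, $\mathbb{R}$, or a finite field $\mathbb{F}_q$ with $p\nmid q$. All objects are bigraded and graded commutative (signs according to the first degree). **Coefficients.** Let $\mathbb{M}_p=\mathbb{M}_p^F$ be the mod $p$ motivic homology ring of $F$: $\mathbb{M}_p^{\mathbb{C}}=\mathbb{F}_p[y]$ with $|y|=(0,-1)$; $\mathbb{M}_2^{\mathbb{R}}=\mathbb{F}_2[a,y]$ with $|a|=(-1,-1)$, $|y|=(0,-1)$; $\mathbb{M}_p^{\mathbb{R}}=\mathbb{F}_p[y]$ with $|y|=(0,-2)$ for $p$ odd; $\mathbb{M}_p^{\mathbb{F}_q}=\mathbb{F}_p[a,y]/(a^2)$ with $|a|=(-1,-e)$, $|y|=(0,-e)$, where $e$ is the order of $q$ modulo $p$. Put $b=a$ if $F=\mathbb{R}$ and $p=2$, or if $F=\mathbb{F}_q$ and $q^e\not\equiv1 \pmod{p^2}$; put $b=0$ otherwise. **The Hopf algebroid $\mathcal{E}(1)_p^\vee$.** Let $\mathcal{E}(1)_p^\vee=\mathbb{M}_p[\bar\tau_0,\bar\tau_1]/(\bar\tau_0^2=r\bar\tau_1,\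 \bar\tau_1^2=0)$ with $r=b$ if $p=2$ and $r=0$ if $p$ is odd, where $|\bar\tau_i|=(2p^i-1,p^i-1)$, the elements $\bar\tau_0,\bar\tau_1$ are primitive, $\eta_L$ is the inclusion, and $\eta_R(a)=a$, $\eta_R(y)=y+b\bar\tau_0$. Comodules are bigraded left comodules; isomorphisms preserve the bigrading. The dual algebra $\mathcal{E}(1)_p$, which contains the duals $Q_0,Q_1$ of $\bar\tau_0,\bar\tau_1$, acts on comodules from the right, and right $\mathcal{E}(1)_p$-modules are regarded as left $\mathcal{E}(1)_p^\vee$-comodules. **The Brown–Gitler comodule $B_0(k)$.** Let $(\mathcal{A}/\!/\mathcal{E}(0))^\vee=\mathbb{M}_p[\bar\xi_1,\bar\xi_2,\dots,\bar\tau_1,\bar\tau_2,\dots]/I$, where $I$ is generated by $\bar\tau_i^2$ for $p$ odd and by $\bar\tau_i^2-y\bar\xi_{i+1}-b\bar\tau_{i+1}$ for $p=2$, with $|\bar\xi_i|=(2p^i-2,p^i-1)$, $|\bar\tau_i|=(2p^i-1,p^i-1)$. It is free over $\mathbb{M}_p$ on the monomials in which each $\bar\tau_i$ has exponent at most $1$.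 Its $\mathcal{E}(1)_p^\vee$-coaction is multiplicative, with $\alpha(\bar\xi_i)=1\otimes\bar\xi_i$ and $\alpha(\bar\tau_i)=1\otimes\bar\tau_i+\bar\tau_0\otimes\bar\xi_i+\bar\tau_1\otimes\bar\xi_{i-1}^{\,p}$ ($\bar\xi_0=1$). Give $\bar\xi_i$ and $\bar\tau_i$ weight $p^i$ and extend additively to monomials. For $k\ge0$ let $B_0(k)$ be the subcomodule spanned over $\mathbb{M}_p$ by those basis monomials that have weight at most $k$. **The lightning flash module $L_p(m)$.** Put $L_p(0)=\mathbb{M}_p$. For $m\ge1$ let $L_p(m)$ be the right $\mathcal{E}(1)_p$-module with generators $x_1,\dots,x_m$, $|x_i|=i\,(2p-2,p-1)+(1,0)$, and relations $x_{i+1}Q_1=x_iQ_0$ for $1\le i\le m-1$ and $x_1Q_0Q_1=0$. **Proposition.** For every $k\ge0$ there is an isomorphism of $\mathcal{E}(1)_p^\vee$-comodules $$B_0(k)\;\cong\;L_p(\nu_p(k!))\oplus W_k,$$ where $\nu_p$ is the $p$-adic valuation and $W_k$ is a finite direct sum of suspensions $\Sigma^{s,t}\mathcal{E}(1)_p^\vee$.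 -/

import Mathlib

open Polynomial

/-- The base fields: the complex numbers, the real numbers, the finite field with `q` elements. -/
inductive BaseField where
  | complex : BaseField
  | real : BaseField
  | finite (q : ℕ) : BaseField

/-- `q` is a prime power and the characteristic of the base field is different from `p`. -/
def BaseField.Admissible (F : BaseField) (p : ℕ) : Prop :=
  match F with
  | .complex => True
  | .real => True
  | .finite q => IsPrimePow q ∧ ¬ p ∣ q

/- Conventions. Everything is bigraded and graded commutative: moving two elements of odd topological
degree past each other costs a sign. The coefficient ring is generated by one odd element `a`
(`oddGen`: this is `ρ`, `u` or `γ`) and one even element `y` (`evenGen`: this is `τ`, `θ` or `ζ`). -/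

namespace Mot

noncomputable section

/-- The relation that the odd generator satisfies: `a = 0` over `ℂ`, and over `ℝ` for odd `p`; no
relation over `ℝ` for `p = 2`; and `a ^ 2 = 0` over finite fields. -/
def oddRel (F : BaseField) (p : ℕ) : (ZMod p)[X] :=
  match F with
  | .complex => X
  | .real => if p = 2 then 0 else X
  | .finite _ => X ^ 2

/-- The subring of the coefficients generated by the odd generator. -/
def OddPart (F : BaseField) (p : ℕ) : Type := (ZMod p)[X] ⧸ Ideal.span {oddRel F p}

instance (F : BaseField) (p : ℕ) : CommRing (OddPart F p) :=
  inferInstanceAs (CommRing ((ZMod p)[X] ⧸ Ideal.span {oddRel F p}))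

/-- The mod `p` motivic homology ring of a point, `𝕄_p`: over `ℂ` it is `𝔽_p[τ]`, over `ℝ` it is
`𝔽_2[ρ, τ]` or `𝔽_p[θ]`, over a finite field it is `𝔽_p[a, ζ] / (a ^ 2)`. It is commutative
as an ordinary ring, since the only odd generator has square zero when `p` is odd. -/
def Coeff (F : BaseField) (p : ℕ) : Type := (OddPart F p)[X]

instance (F : BaseField) (p : ℕ) : CommRing (Coeff F p) :=
  inferInstanceAs (CommRing (OddPart F p)[X])

/-- The even generator has bidegree `(0, -e)` and the odd one `(-1, -e)`, where `e` is this number. Over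
a finite field it is the least `i > 0` with `q ^ i ≡ 1` modulo `p`. -/
def evenWeight (F : BaseField) (p : ℕ) : ℕ :=
  match F with
  | .complex => 1
  | .real => if p = 2 then 1 else 2
  | .finite q => orderOf (q : ZMod p)

/-- The cases with a nontrivial Bockstein, that is, with `η_R(y) = y + a τ₀`: the real numbers for `p = 2`
and finite fields with `q ^ e ≢ 1` modulo `p ^ 2` (for `p = 2` this says `q ≡ 3` modulo `4`). -/
def Twisted (F : BaseField) (p : ℕ) : Prop :=
  match F with
  | .complex => False
  | .real => p = 2
  | .finite q => ¬ (q ^ evenWeight F p ≡ 1 [MOD p ^ 2])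

variable (F : BaseField) (p : ℕ)

def toOddPart : (ZMod p)[X] →+* OddPart F p := Ideal.Quotient.mk (Ideal.span {oddRel F p})

def toCoeff : OddPart F p →+* Coeff F p := Polynomial.C

def oddGen : Coeff F p := toCoeff F p (toOddPart F p X)

def evenGen : Coeff F p := (X : (OddPart F p)[X])

open Classical in
/-- The element `b` with `η_R(y) = y + b τ₀`: the odd generator in the twisted cases, else `0`. -/
def bock : Coeff F p := if Twisted F p then oddGen F p else 0

/-- The element `r` with `τ₀ ^ 2 = r τ₁` in the dual of `E(1)`: it is `ρ` for `p = 2` in the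
twisted cases and `0` otherwise. -/
def sqCoeff : Coeff F p := if p = 2 then bock F p else 0

theorem signOdd_aux : ∀ f ∈ Ideal.span {oddRel F p},
    ((toOddPart F p).comp
      (aeval (-X : (ZMod p)[X])).toRingHom) f = 0 := by
  intro f hf
  obtain ⟨g, rfl⟩ := Ideal.mem_span_singleton.1 hf
  rw [map_mul]
  have h : ((toOddPart F p).comp
      (aeval (-X : (ZMod p)[X])).toRingHom) (oddRel F p) = 0 := by
    rw [RingHom.comp_apply]
    refine Ideal.Quotient.eq_zero_iff_mem.2 ?_
    refine Ideal.mem_span_singleton.2 ?_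
    unfold oddRel
    split
    · simp
    · split_ifs <;> simp
    · simp
  rw [h, zero_mul]

/-- The sign involution on the subring generated by `a`, with `a ↦ -a`. -/
def signOdd : OddPart F p →+* OddPart F p :=
  Ideal.Quotient.lift _ _ (signOdd_aux F p)

/-- The sign involution `m ↦ (-1) ^ |m| m`, which sends `a` to `-a` and `y` to `y`. -/
def sign : Coeff F p →+* Coeff F p :=
  (mapRingHom (signOdd F p) : (OddPart F p)[X] →+* (OddPart F p)[X])

variable {F p}

@[simp] theorem sign_evenGen : sign F p (evenGen F p) = evenGen F p :=
  Polynomial.map_X _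

theorem sign_toCoeff (c : OddPart F p) : sign F p (toCoeff F p c) = toCoeff F p (signOdd F p c) :=
  Polynomial.map_C _

theorem signOdd_X : signOdd F p (toOddPart F p X) = - toOddPart F p X := by
  change ((toOddPart F p).comp (aeval (-X : (ZMod p)[X])).toRingHom) X = _
  simp

@[simp] theorem sign_oddGen : sign F p (oddGen F p) = - oddGen F p := by
  rw [oddGen, sign_toCoeff, signOdd_X, map_neg]

theorem oddPart_induction {P : OddPart F p → Prop} (hC : ∀ c : ℤ, P c)
    (hodd : P (toOddPart F p X)) (hadd : ∀ x y, P x → P y → P (x + y))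
    (hmul : ∀ x y, P x → P y → P (x * y)) (x : OddPart F p) : P x := by
  obtain ⟨f, rfl⟩ : ∃ f, toOddPart F p f = x := Ideal.Quotient.mk_surjective x
  induction f using Polynomial.induction_on with
  | C a =>
    obtain ⟨n, rfl⟩ := ZMod.intCast_surjective a
    simpa using hC n
  | add f g hf hg => rw [map_add]; exact hadd _ _ hf hg
  | monomial n a h =>
    rw [pow_succ, ← mul_assoc, map_mul]
    exact hmul _ _ h hodd

theorem coeff_induction {P : Coeff F p → Prop} (hC : ∀ c : ℤ, P c)
    (hodd : P (oddGen F p)) (heven : P (evenGen F p)) (hadd : ∀ x y, P x → P y → P (x + y))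
    (hmul : ∀ x y, P x → P y → P (x * y)) (x : Coeff F p) : P x := by
  have h0 : ∀ c : OddPart F p, P (toCoeff F p c) := fun c => by
    induction c using oddPart_induction with
    | hC c => simpa using hC c
    | hodd => exact hodd
    | hadd x y hx hy => rw [map_add]; exact hadd _ _ hx hy
    | hmul x y hx hy => rw [map_mul]; exact hmul _ _ hx hy
  refine Polynomial.induction_on (motive := P) x h0 hadd fun n a h => ?_
  have := hmul _ _ h heven
  rwa [← (show _ * X = _ from (by rw [pow_succ, mul_assoc]) : C a * X ^ n * X = C a * X ^ (n + 1))]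

@[simp] theorem sign_sign (m : Coeff F p) : sign F p (sign F p m) = m := by
  induction m using coeff_induction with
  | hC c => simp
  | hodd => simp
  | heven => simp
  | hadd x y hx hy => simp [hx, hy]
  | hmul x y hx hy => simp [hx, hy]

theorem two_eq_zero (h : p = 2) : (2 : Coeff F p) = 0 := by
  subst h
  have h : (2 : Coeff F 2) = toCoeff F 2 (toOddPart F 2 (C (2 : ZMod 2))) := by
    rw [map_ofNat, map_ofNat, map_ofNat]
  rw [h, show (2 : ZMod 2) = 0 from rfl, map_zero, map_zero, map_zero]

theorem neg_eq (h : p = 2) (m : Coeff F p) : -m = m := by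
  have : m + m = 0 := by rw [← two_mul, two_eq_zero h, zero_mul]
  exact neg_eq_of_add_eq_zero_left this

theorem sign_eq (h : p = 2) (m : Coeff F p) : sign F p m = m := by
  induction m using coeff_induction with
  | hC c => simp
  | hodd => simp [neg_eq h]
  | heven => simp
  | hadd x y hx hy => simp [hx, hy]
  | hmul x y hx hy => simp [hx, hy]

@[simp] theorem sqCoeff_mul_sign (m : Coeff F p) :
    sqCoeff F p * sign F p m = sqCoeff F p * m := by
  by_cases h : p = 2
  · rw [sign_eq h]
  · simp [sqCoeff, h]

@[simp] theorem sign_sqCoeff : sign F p (sqCoeff F p) = sqCoeff F p := by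
  by_cases h : p = 2
  · rw [sign_eq h]
  · simp [sqCoeff, h]

theorem neg_sqCoeff : - sqCoeff F p = sqCoeff F p := by
  by_cases h : p = 2
  · rw [neg_eq h]
  · simp [sqCoeff, h]

@[simp] theorem sign_bock : sign F p (bock F p) = - bock F p := by
  unfold bock; split_ifs <;> simp

theorem bock_sq (h : p ≠ 2) : bock F p * bock F p = 0 := by
  unfold bock
  split_ifs with ht
  · unfold oddGen
    rw [← map_mul, ← map_mul]
    refine (congrArg _ ?_).trans (map_zero (toCoeff F p))
    refine Ideal.Quotient.eq_zero_iff_mem.2 (Ideal.mem_span_singleton.2 ?_)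
    unfold Twisted at ht
    unfold oddRel
    split at ht
    · exact ht.elim
    · exact (h ht).elim
    · simp [pow_two]
  · simp

@[simp] theorem bock_mul_sign (m : Coeff F p) : bock F p * sign F p m = bock F p * m := by
  by_cases h : p = 2
  · rw [sign_eq h]
  have h2 := bock_sq (F := F) h
  induction m using coeff_induction with
  | hC c => simp
  | hodd =>
    rw [sign_oddGen]
    unfold bock at *
    split_ifs with ht
    · rw [if_pos ht] at h2; simp [h2]
    · simp
  | heven => simp
  | hadd x y hx hy => simp only [map_add, mul_add, hx, hy]
  | hmul x y hx hy =>
    rw [map_mul]; linear_combination (sign F p y) * hx + x * hy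


variable (F p)

/-- The bidegree of the odd generator. -/
def oddDeg : ℤ × ℤ := (-1, -(evenWeight F p : ℤ))

/-- The bidegree of the even generator. -/
def evenDeg : ℤ × ℤ := (0, -(evenWeight F p : ℤ))

/-- The bidegree of `τ_i`. -/
def tauDeg (i : ℕ) : ℤ × ℤ := (2 * (p : ℤ) ^ i - 1, (p : ℤ) ^ i - 1)

/-- The bidegree of `ξ_i`. -/
def xiDeg (i : ℕ) : ℤ × ℤ := (2 * (p : ℤ) ^ i - 2, (p : ℤ) ^ i - 1)

/-- The homogeneous coefficients of bidegree `d`. -/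
def Coeff.gr (d : ℤ × ℤ) : AddSubgroup (Coeff F p) :=
  AddSubgroup.closure {m | ∃ i j : ℕ, i • oddDeg F p + j • evenDeg F p = d ∧
    m = oddGen F p ^ i * evenGen F p ^ j}

variable {F p}

variable (F p)

/-- The dual `E(1)^∨ = 𝕄_p[τ₀, τ₁] / (τ₀ ^ 2 = r τ₁, τ₁ ^ 2 = 0)`. It is free over `𝕄_p` on
`1, τ₀, τ₁, τ₀ τ₁`, and an element is stored by its coefficients on the right, which multiply through the
right unit: `e = η_R(c) + τ₀ η_R(c₀) + τ₁ η_R(c₁) + τ₀ τ₁ η_R(c₀₁)`. Multiplication is graded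
commutative. -/
@[ext] structure DualE where
  c : Coeff F p
  c₀ : Coeff F p
  c₁ : Coeff F p
  c₀₁ : Coeff F p

variable {F p}

namespace DualE

instance : Zero (DualE F p) := ⟨⟨0, 0, 0, 0⟩⟩
instance : One (DualE F p) := ⟨⟨1, 0, 0, 0⟩⟩
instance : Add (DualE F p) := ⟨fun e f => ⟨e.c + f.c, e.c₀ + f.c₀, e.c₁ + f.c₁, e.c₀₁ + f.c₀₁⟩⟩
instance : Neg (DualE F p) := ⟨fun e => ⟨-e.c, -e.c₀, -e.c₁, -e.c₀₁⟩⟩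
instance : Mul (DualE F p) := ⟨fun e f =>
  { c := e.c * f.c
    c₀ := sign F p e.c * f.c₀ + e.c₀ * f.c
    c₁ := sign F p e.c * f.c₁ + e.c₁ * f.c + sqCoeff F p * (sign F p e.c₀ * f.c₀)
    c₀₁ := e.c * f.c₀₁ + e.c₀₁ * f.c + sign F p e.c₀ * f.c₁ - sign F p e.c₁ * f.c₀ }⟩
/-- The coefficients act on `DualE` through the right unit. -/
instance : SMul (Coeff F p) (DualE F p) :=
  ⟨fun m e => ⟨e.c * m, e.c₀ * m, e.c₁ * m, e.c₀₁ * m⟩⟩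

@[simp] theorem zero_c : (0 : DualE F p).c = 0 := rfl
@[simp] theorem zero_c₀ : (0 : DualE F p).c₀ = 0 := rfl
@[simp] theorem zero_c₁ : (0 : DualE F p).c₁ = 0 := rfl
@[simp] theorem zero_c₀₁ : (0 : DualE F p).c₀₁ = 0 := rfl
@[simp] theorem one_c : (1 : DualE F p).c = 1 := rfl
@[simp] theorem one_c₀ : (1 : DualE F p).c₀ = 0 := rfl
@[simp] theorem one_c₁ : (1 : DualE F p).c₁ = 0 := rfl
@[simp] theorem one_c₀₁ : (1 : DualE F p).c₀₁ = 0 := rfl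
@[simp] theorem add_c (e f : DualE F p) : (e + f).c = e.c + f.c := rfl
@[simp] theorem add_c₀ (e f : DualE F p) : (e + f).c₀ = e.c₀ + f.c₀ := rfl
@[simp] theorem add_c₁ (e f : DualE F p) : (e + f).c₁ = e.c₁ + f.c₁ := rfl
@[simp] theorem add_c₀₁ (e f : DualE F p) : (e + f).c₀₁ = e.c₀₁ + f.c₀₁ := rfl
@[simp] theorem neg_c (e : DualE F p) : (-e).c = -e.c := rfl
@[simp] theorem neg_c₀ (e : DualE F p) : (-e).c₀ = -e.c₀ := rfl
@[simp] theorem neg_c₁ (e : DualE F p) : (-e).c₁ = -e.c₁ := rfl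
@[simp] theorem neg_c₀₁ (e : DualE F p) : (-e).c₀₁ = -e.c₀₁ := rfl
@[simp] theorem mul_c (e f : DualE F p) : (e * f).c = e.c * f.c := rfl
@[simp] theorem mul_c₀ (e f : DualE F p) :
    (e * f).c₀ = sign F p e.c * f.c₀ + e.c₀ * f.c := rfl
@[simp] theorem mul_c₁ (e f : DualE F p) :
    (e * f).c₁ = sign F p e.c * f.c₁ + e.c₁ * f.c + sqCoeff F p * (sign F p e.c₀ * f.c₀) := rfl
@[simp] theorem mul_c₀₁ (e f : DualE F p) :
    (e * f).c₀₁ = e.c * f.c₀₁ + e.c₀₁ * f.c + sign F p e.c₀ * f.c₁ - sign F p e.c₁ * f.c₀ := rfl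
@[simp] theorem smul_c (m : Coeff F p) (e : DualE F p) : (m • e).c = e.c * m := rfl
@[simp] theorem smul_c₀ (m : Coeff F p) (e : DualE F p) : (m • e).c₀ = e.c₀ * m := rfl
@[simp] theorem smul_c₁ (m : Coeff F p) (e : DualE F p) : (m • e).c₁ = e.c₁ * m := rfl
@[simp] theorem smul_c₀₁ (m : Coeff F p) (e : DualE F p) : (m • e).c₀₁ = e.c₀₁ * m := rfl

instance : Ring (DualE F p) where
  add_assoc a b c := by ext1 <;> simp [add_assoc]
  zero_add a := by ext1 <;> simp
  add_zero a := by ext1 <;> simp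
  add_comm a b := by ext1 <;> simp [add_comm]
  neg_add_cancel a := by ext1 <;> simp
  nsmul := nsmulRec
  zsmul := zsmulRec
  left_distrib a b c := by ext1 <;> simp <;> ring
  right_distrib a b c := by ext1 <;> simp <;> ring
  zero_mul a := by ext1 <;> simp
  mul_zero a := by ext1 <;> simp
  one_mul a := by ext1 <;> simp
  mul_one a := by ext1 <;> simp
  mul_assoc a b c := by
    have h := fun m : Coeff F p => sqCoeff_mul_sign m
    have hn : ∀ m : Coeff F p, -(sqCoeff F p * m) = sqCoeff F p * m := fun m => by
      rw [← neg_mul, neg_sqCoeff]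
    ext1
    · simp [mul_assoc]
    · simp; ring
    · simp
      linear_combination (-(sign F p b.c₀ * c.c₀)) * h a.c
    · simp
      linear_combination (-(sign F p b.c₀ * c.c₀)) * h a.c₀ + hn (a.c₀ * sign F p b.c₀ * c.c₀)

@[simp] theorem sub_c (e f : DualE F p) : (e - f).c = e.c - f.c := by
  simp [sub_eq_add_neg]
@[simp] theorem sub_c₀ (e f : DualE F p) : (e - f).c₀ = e.c₀ - f.c₀ := by
  simp [sub_eq_add_neg]
@[simp] theorem sub_c₁ (e f : DualE F p) : (e - f).c₁ = e.c₁ - f.c₁ := by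
  simp [sub_eq_add_neg]
@[simp] theorem sub_c₀₁ (e f : DualE F p) : (e - f).c₀₁ = e.c₀₁ - f.c₀₁ := by
  simp [sub_eq_add_neg]

instance : Module (Coeff F p) (DualE F p) where
  one_smul e := by ext1 <;> simp
  mul_smul m n e := by ext1 <;> simp <;> ring
  smul_zero m := by ext1 <;> simp
  smul_add m e f := by ext1 <;> simp <;> ring
  add_smul m n e := by ext1 <;> simp <;> ring
  zero_smul e := by ext1 <;> simp

instance : SMulCommClass (Coeff F p) (DualE F p) (DualE F p) where
  smul_comm m e f := by ext1 <;> simp <;> ring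

/-- The right unit. -/
def etaR : Coeff F p →+* DualE F p where
  toFun m := ⟨m, 0, 0, 0⟩
  map_one' := rfl
  map_zero' := rfl
  map_mul' m n := by ext1 <;> simp
  map_add' m n := by ext1 <;> simp

theorem smul_eq_mul_etaR (m : Coeff F p) (e : DualE F p) : m • e = e * etaR m := by
  ext1 <;> simp [etaR]

variable (F p) in
/-- The element `τ₀`. -/
def t₀ : DualE F p := ⟨0, 1, 0, 0⟩

variable (F p) in
/-- The element `τ₁`. -/
def t₁ : DualE F p := ⟨0, 0, 1, 0⟩

theorem t₀_mul_t₀ : t₀ F p * t₀ F p = etaR (sqCoeff F p) * t₁ F p := by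
  ext1 <;> simp [etaR, t₀, t₁]

theorem t₁_mul_t₁ : t₁ F p * t₁ F p = 0 := by
  ext1 <;> simp [t₁]

theorem t₁_mul_t₀ : t₁ F p * t₀ F p = - (t₀ F p * t₁ F p) := by
  ext1 <;> simp [t₀, t₁]

theorem eq_sum (e : DualE F p) : e = etaR e.c + t₀ F p * etaR e.c₀ + t₁ F p * etaR e.c₁ +
    t₀ F p * t₁ F p * etaR e.c₀₁ := by
  ext1 <;> simp [etaR, t₀, t₁]

theorem commute_etaL_aux (a : OddPart F p) : Commute (etaR (toCoeff F p a))
    (etaR (evenGen F p) - etaR (bock F p) * t₀ F p) := by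
  have h := bock_mul_sign (toCoeff F p a)
  rw [Commute, SemiconjBy]
  ext1
  · simp [etaR, t₀]; ring
  · simp [etaR, t₀]; linear_combination h
  · simp [etaR, t₀]
  · simp [etaR, t₀]

/-- The left unit: it agrees with the right unit on `a`, and `η_L(y) = η_R(y) - b τ₀`, that is,
`η_R(y) = η_L(y) + b τ₀`. -/
def etaL : Coeff F p →+* DualE F p :=
  (eval₂RingHom' (etaR.comp (toCoeff F p)) (etaR (evenGen F p) - etaR (bock F p) * t₀ F p)
    commute_etaL_aux : (OddPart F p)[X] →+* DualE F p)

@[simp] theorem etaL_evenGen :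
    etaL (evenGen F p) = etaR (evenGen F p) - etaR (bock F p) * t₀ F p :=
  Polynomial.eval₂_X _ _

@[simp] theorem etaL_toCoeff (c : OddPart F p) :
    etaL (toCoeff F p c) = etaR (toCoeff F p c) :=
  Polynomial.eval₂_C _ _

@[simp] theorem etaL_oddGen : etaL (oddGen F p) = etaR (oddGen F p) := etaL_toCoeff _


theorem etaL_evenGen' : etaL (evenGen F p) = ⟨evenGen F p, bock F p, 0, 0⟩ := by
  rw [etaL_evenGen]; ext1 <;> simp [etaR, t₀]

/-- The counit, with `τ₀, τ₁ ↦ 0`. -/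
def counit : DualE F p →ₗ[Coeff F p] Coeff F p where
  toFun e := e.c
  map_add' _ _ := rfl
  map_smul' m e := by simp [mul_comm]

@[simp] theorem counit_apply (e : DualE F p) : counit e = e.c := rfl

@[simp] theorem etaL_c (m : Coeff F p) : (etaL m).c = m := by
  induction m using coeff_induction with
  | hC c => rw [map_intCast, ← map_intCast etaR]; rfl
  | hodd => simp [etaR]
  | heven => rw [etaL_evenGen']
  | hadd x y hx hy => simp [hx, hy]
  | hmul x y hx hy => simp [hx, hy]

/-- Part of the coproduct: `ψ(e) = 1 ⊗ e + τ₀ ⊗ q₀(e) + τ₁ ⊗ q₁(e) + τ₀ τ₁ ⊗ q₀₁(e)`, where `ψ` is the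
multiplicative map for which `τ₀` and `τ₁` are primitive and the right coefficients are put on the
right factor. -/
def q₀ : DualE F p →ₗ[Coeff F p] DualE F p where
  toFun e := ⟨e.c₀, 0, e.c₀₁, 0⟩
  map_add' _ _ := by ext1 <;> simp
  map_smul' m e := by ext1 <;> simp

/-- See `q₀`. -/
def q₁ : DualE F p →ₗ[Coeff F p] DualE F p where
  toFun e := ⟨e.c₁, -e.c₀₁, 0, 0⟩
  map_add' _ _ := by ext1 <;> simp [add_comm]
  map_smul' m e := by ext1 <;> simp

/-- See `q₀`. -/
def q₀₁ : DualE F p →ₗ[Coeff F p] DualE F p where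
  toFun e := ⟨e.c₀₁, 0, 0, 0⟩
  map_add' _ _ := by ext1 <;> simp
  map_smul' m e := by ext1 <;> simp

@[simp] theorem q₀_apply (e : DualE F p) : q₀ e = ⟨e.c₀, 0, e.c₀₁, 0⟩ := rfl
@[simp] theorem q₁_apply (e : DualE F p) : q₁ e = ⟨e.c₁, -e.c₀₁, 0, 0⟩ := rfl
@[simp] theorem q₀₁_apply (e : DualE F p) : q₀₁ e = ⟨e.c₀₁, 0, 0, 0⟩ := rfl

/-- The homogeneous elements of bidegree `d`. -/
def gr (d : ℤ × ℤ) : AddSubgroup (DualE F p) where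
  carrier := {e | e.c ∈ Coeff.gr F p d ∧ e.c₀ ∈ Coeff.gr F p (d - tauDeg p 0) ∧
    e.c₁ ∈ Coeff.gr F p (d - tauDeg p 1) ∧
    e.c₀₁ ∈ Coeff.gr F p (d - (tauDeg p 0 + tauDeg p 1))}
  zero_mem' := ⟨zero_mem _, zero_mem _, zero_mem _, zero_mem _⟩
  add_mem' h h' := ⟨add_mem h.1 h'.1, add_mem h.2.1 h'.2.1, add_mem h.2.2.1 h'.2.2.1,
    add_mem h.2.2.2 h'.2.2.2⟩
  neg_mem' h := ⟨neg_mem h.1, neg_mem h.2.1, neg_mem h.2.2.1, neg_mem h.2.2.2⟩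

end DualE

open DualE

variable (F p)

/-- The tensor product `E(1)^∨ ⊗ V` over `𝕄_p`, where `𝕄_p` acts on `E(1)^∨` by the right unit. As an
`𝕄_p`-module it carries the action through the left unit of `E(1)^∨`. -/
def LeftTensor (V : Type) [AddCommGroup V] [Module (Coeff F p) V] : Type :=
  TensorProduct (Coeff F p) (DualE F p) V

namespace LeftTensor

variable (V W : Type) [AddCommGroup V] [Module (Coeff F p) V]
  [AddCommGroup W] [Module (Coeff F p) W]

instance : AddCommGroup (LeftTensor F p V) :=
  inferInstanceAs (AddCommGroup (TensorProduct (Coeff F p) (DualE F p) V))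

instance : Module (DualE F p) (LeftTensor F p V) :=
  inferInstanceAs (Module (DualE F p) (TensorProduct (Coeff F p) (DualE F p) V))

instance : Module (Coeff F p) (LeftTensor F p V) :=
  Module.compHom _ (etaL (F := F) (p := p))

variable {F p V W}

def tmul (e : DualE F p) (v : V) : LeftTensor F p V := TensorProduct.tmul (Coeff F p) e v

theorem smul_def (m : Coeff F p) (z : LeftTensor F p V) : m • z = etaL m • z := rfl

theorem tmul_add (e : DualE F p) (v w : V) : tmul e (v + w) = tmul e v + tmul e w :=
  TensorProduct.tmul_add _ _ _

theorem add_tmul (e f : DualE F p) (v : V) : tmul (e + f) v = tmul e v + tmul f v :=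
  TensorProduct.add_tmul _ _ _

theorem smul_tmul (x e : DualE F p) (v : V) : x • tmul e v = tmul (x * e) v := rfl

theorem tmul_smul (e : DualE F p) (m : Coeff F p) (v : V) :
    tmul e (m • v) = tmul (e * etaR m) v := by
  rw [← smul_eq_mul_etaR]
  exact (TensorProduct.smul_tmul _ _ _).symm

@[simp] theorem tmul_zero (e : DualE F p) : tmul e (0 : V) = 0 := TensorProduct.tmul_zero _ _

@[simp] theorem tmul_neg (e : DualE F p) (v : V) : tmul e (-v) = -tmul e v :=
  TensorProduct.tmul_neg _ _

@[simp] theorem neg_tmul (e : DualE F p) (v : V) : tmul (-e) v = -tmul e v :=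
  TensorProduct.neg_tmul _ _

@[simp] theorem zero_tmul (v : V) : tmul (0 : DualE F p) v = 0 := TensorProduct.zero_tmul _ _

@[elab_as_elim]
theorem induction_on {P : LeftTensor F p V → Prop} (z : LeftTensor F p V) (h0 : P 0)
    (ht : ∀ e v, P (tmul e v)) (ha : ∀ x y, P x → P y → P (x + y)) : P z :=
  TensorProduct.induction_on z h0 ht ha

theorem hom_ext {A : Type} [AddCommGroup A] {f g : LeftTensor F p V →+ A}
    (h : ∀ e v, f (tmul e v) = g (tmul e v)) (z : LeftTensor F p V) : f z = g z := by
  induction z using LeftTensor.induction_on with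
  | h0 => simp
  | ha y z hy hz => simp [hy, hz]
  | ht e v => exact h e v

/-- The map `1 ⊗ f`. -/
def map (f : V →ₗ[Coeff F p] W) : LeftTensor F p V →ₗ[Coeff F p] LeftTensor F p W where
  toFun := LinearMap.lTensor (DualE F p) f
  map_add' := map_add _
  map_smul' m z :=
    hom_ext (f := (LinearMap.lTensor (DualE F p) f).toAddMonoidHom.comp
        (DistribSMul.toAddMonoidHom (LeftTensor F p V) m))
      (g := (DistribSMul.toAddMonoidHom (LeftTensor F p W) m).comp
        (LinearMap.lTensor (DualE F p) f).toAddMonoidHom) (fun _ _ => rfl) z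

@[simp] theorem map_tmul (f : V →ₗ[Coeff F p] W) (e : DualE F p) (v : V) :
    map f (tmul e v) = tmul e (f v) := rfl

/-- The map `θ ⊗ 1 : E(1)^∨ ⊗ V → V` for a functional `θ` that is linear over the right coefficients. -/
def eval (θ : DualE F p →ₗ[Coeff F p] Coeff F p) : LeftTensor F p V →+ V :=
  ((TensorProduct.lid (Coeff F p) V).toLinearMap ∘ₗ LinearMap.rTensor V θ).toAddMonoidHom

@[simp] theorem eval_tmul (θ : DualE F p →ₗ[Coeff F p] Coeff F p) (e : DualE F p) (v : V) :
    eval θ (tmul e v) = θ e • v := rfl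

/-- The map `q ⊗ 1`. -/
def rmap (q : DualE F p →ₗ[Coeff F p] DualE F p) : LeftTensor F p V →+ LeftTensor F p V :=
  (LinearMap.rTensor V q).toAddMonoidHom

@[simp] theorem rmap_tmul (q : DualE F p →ₗ[Coeff F p] DualE F p) (e : DualE F p) (v : V) :
    rmap q (tmul e v) = tmul (q e) v := rfl

/-- The map `ψ ⊗ 1 : E(1)^∨ ⊗ V → E(1)^∨ ⊗ (E(1)^∨ ⊗ V)`. -/
def comul : LeftTensor F p V →+ LeftTensor F p (LeftTensor F p V) where
  toFun z := tmul 1 z + tmul (t₀ F p) (rmap q₀ z) + tmul (t₁ F p) (rmap q₁ z) +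
    tmul (t₀ F p * t₁ F p) (rmap q₀₁ z)
  map_zero' := by simp
  map_add' y z := by simp only [map_add, tmul_add]; abel

theorem comul_apply (z : LeftTensor F p V) : comul z =
    tmul 1 z + tmul (t₀ F p) (rmap q₀ z) + tmul (t₁ F p) (rmap q₁ z) +
      tmul (t₀ F p * t₁ F p) (rmap q₀₁ z) := rfl

end LeftTensor

open LeftTensor

/-- A bigraded left comodule over the Hopf algebroid `(𝕄_p, E(1)^∨)`: an `𝕄_p`-module with a family
`gr` of homogeneous parts and a left linear, counital and coassociative coaction. -/
structure Comodule where
  carrier : Type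
  [addCommGroup : AddCommGroup carrier]
  [module : Module (Coeff F p) carrier]
  gr : ℤ × ℤ → AddSubgroup carrier
  coact : carrier →ₗ[Coeff F p] LeftTensor F p carrier
  counit_coact : ∀ x, LeftTensor.eval DualE.counit (coact x) = x
  coassoc : ∀ x, LeftTensor.map coact (coact x) = LeftTensor.comul (coact x)

attribute [instance] Comodule.addCommGroup Comodule.module

/-- `E(1)^∨` with the coefficients acting through the left unit. -/
def DualELeft : Type := DualE F p

instance : AddCommGroup (DualELeft F p) := inferInstanceAs (AddCommGroup (DualE F p))

variable {F p}

namespace DualELeft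

def of : DualE F p ≃+ DualELeft F p := AddEquiv.refl _

instance : Module (Coeff F p) (DualELeft F p) where
  smul m e := of (etaL m * of.symm e)
  one_smul e := by change of (etaL 1 * of.symm e) = e; simp
  mul_smul m n e := by
    change of (etaL (m * n) * of.symm e) = of (etaL m * of.symm (of (etaL n * of.symm e)))
    simp [mul_assoc]
  smul_zero m := by change of (etaL m * of.symm 0) = 0; simp
  smul_add m e f := by
    change of (etaL m * of.symm (e + f)) = of (etaL m * of.symm e) + of (etaL m * of.symm f)
    simp [mul_add]
  add_smul m n e := by
    change of (etaL (m + n) * of.symm e) = of (etaL m * of.symm e) + of (etaL n * of.symm e)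
    simp [add_mul]
  zero_smul e := by change of (etaL 0 * of.symm e) = 0; simp

theorem smul_of (m : Coeff F p) (e : DualE F p) : m • of e = of (etaL m * e) := rfl

/-- The coproduct of `E(1)^∨`. -/
def comulAux (e : DualE F p) : LeftTensor F p (DualELeft F p) :=
  tmul 1 (of e) + tmul (t₀ F p) (of (q₀ e)) + tmul (t₁ F p) (of (q₁ e)) +
    tmul (t₀ F p * t₁ F p) (of (q₀₁ e))

theorem comulAux_add (e f : DualE F p) : comulAux (e + f) = comulAux e + comulAux f := by
  simp only [comulAux, map_add, tmul_add]; abel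

theorem comulAux_etaR_mul (m : Coeff F p) (hm : etaL m = etaR m)
    (hs : etaL (sign F p m) = etaR (sign F p m)) (e : DualE F p) :
    comulAux (etaR m * e) = etaR m • comulAux e := by
  have e0 : etaR m * 1 = 1 * etaR m := by simp
  have e1 : etaR m * t₀ F p = t₀ F p * etaR (sign F p m) := by
    ext1 <;> simp [etaR, t₀]
  have e2 : etaR m * t₁ F p = t₁ F p * etaR (sign F p m) := by
    ext1 <;> simp [etaR, t₁]
  have e3 : etaR m * (t₀ F p * t₁ F p) = (t₀ F p * t₁ F p) * etaR m := by
    ext1 <;> simp [etaR, t₀, t₁]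
  simp only [comulAux, smul_add, smul_tmul]
  rw [e0, e1, e2, e3]
  simp only [← tmul_smul, smul_of, hm, hs]
  have f0 : q₀ (etaR m * e) = etaR (sign F p m) * q₀ e := by ext1 <;> simp [etaR]
  have f1 : q₁ (etaR m * e) = etaR (sign F p m) * q₁ e := by ext1 <;> simp [etaR]
  have f2 : q₀₁ (etaR m * e) = etaR m * q₀₁ e := by ext1 <;> simp [etaR]
  rw [f0, f1, f2]

theorem etaL_bock : etaL (bock F p) = etaR (bock F p) := by
  unfold bock; split_ifs <;> simp

theorem etaL_sqCoeff : etaL (sqCoeff F p) = etaR (sqCoeff F p) := by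
  unfold sqCoeff; split_ifs <;> simp [etaL_bock]

theorem comulAux_evenGen_mul (e : DualE F p) :
    comulAux (etaL (evenGen F p) * e) = etaL (evenGen F p) • comulAux e := by
  have e0 : etaL (evenGen F p) * 1 = 1 * etaR (evenGen F p) + t₀ F p * etaR (bock F p) := by
    rw [etaL_evenGen']; ext1 <;> simp [etaR, t₀]
  have e1 : etaL (evenGen F p) * t₀ F p = t₀ F p * etaR (evenGen F p) +
      t₁ F p * etaR (sqCoeff F p * bock F p) := by
    rw [etaL_evenGen']; ext1 <;> simp [etaR, t₀, t₁]
    rw [← neg_mul, neg_sqCoeff]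
  have e2 : etaL (evenGen F p) * t₁ F p = t₁ F p * etaR (evenGen F p) +
      (t₀ F p * t₁ F p) * etaR (- bock F p) := by
    rw [etaL_evenGen']; ext1 <;> simp [etaR, t₀, t₁]
  have e3 : etaL (evenGen F p) * (t₀ F p * t₁ F p) = (t₀ F p * t₁ F p) * etaR (evenGen F p) := by
    rw [etaL_evenGen']; ext1 <;> simp [etaR, t₀, t₁]
  simp only [comulAux, smul_add, smul_tmul]
  rw [e0, e1, e2, e3]
  simp only [add_tmul, ← tmul_smul]
  have f0 : of (q₀ (etaL (evenGen F p) * e)) =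
      evenGen F p • of (q₀ e) + bock F p • of e := by
    simp only [smul_of, etaL_bock, ← map_add]
    congr 1
    rw [etaL_evenGen']; ext1 <;> simp [etaR] <;> ring
  have f1 : of (q₁ (etaL (evenGen F p) * e)) =
      evenGen F p • of (q₁ e) + (sqCoeff F p * bock F p) • of (q₀ e) := by
    simp only [smul_of, etaL_bock, etaL_sqCoeff, map_mul, ← map_add]
    congr 1
    rw [etaL_evenGen']; ext1 <;> simp [etaR] <;> ring_nf
    linear_combination (bock F p * e.c₀) * neg_sqCoeff (F := F) (p := p)
  have f2 : of (q₀₁ (etaL (evenGen F p) * e)) =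
      evenGen F p • of (q₀₁ e) + (-bock F p) • of (q₁ e) := by
    simp only [smul_of, etaL_bock, map_neg, ← map_add]
    congr 1
    rw [etaL_evenGen']; ext1 <;> simp [etaR]
  rw [f0, f1, f2, ← smul_of]
  simp only [tmul_add]
  abel

theorem comulAux_smul (m : Coeff F p) : ∀ e : DualE F p,
    comulAux (etaL m * e) = etaL m • comulAux e := by
  induction m using coeff_induction with
  | hC c =>
    intro e
    rw [map_intCast, ← map_intCast etaR]
    exact comulAux_etaR_mul _ (by simp) (by simp) e
  | hodd =>
    intro e
    rw [etaL_oddGen]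
    exact comulAux_etaR_mul _ (by simp) (by simp) e
  | heven => exact comulAux_evenGen_mul
  | hadd x y hx hy => intro e; rw [map_add, add_mul, comulAux_add, hx, hy, add_smul]
  | hmul x y hx hy => intro e; rw [map_mul, mul_assoc, hx, hy, mul_smul]

end DualELeft


theorem comul_smul {V : Type} [AddCommGroup V] [Module (Coeff F p) V]
    (m : Coeff F p) (z : LeftTensor F p V) : comul (m • z) = m • comul z := by
  refine LeftTensor.hom_ext
    (f := comul.comp (DistribSMul.toAddMonoidHom (LeftTensor F p V) m))
    (g := (DistribSMul.toAddMonoidHom (LeftTensor F p (LeftTensor F p V)) m).comp comul) (fun e v => ?_) z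
  let f : DualELeft F p →ₗ[Coeff F p] LeftTensor F p V :=
    { toFun := fun e => tmul (DualELeft.of.symm e) v
      map_add' := fun _ _ => add_tmul _ _ _
      map_smul' := fun _ _ => rfl }
  have hf : ∀ e, comul (tmul e v) = LeftTensor.map f (DualELeft.comulAux e) := fun e => by
    simp only [comul_apply, DualELeft.comulAux, map_add, map_tmul, rmap_tmul]; rfl
  change comul (tmul (etaL m * e) v) = m • comul (tmul e v)
  rw [hf, hf, DualELeft.comulAux_smul, ← LeftTensor.smul_def, map_smul]

namespace LeftTensor

variable {V W : Type} [AddCommGroup V] [Module (Coeff F p) V]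
  [AddCommGroup W] [Module (Coeff F p) W]

theorem comul_map (f : V →ₗ[Coeff F p] W) (z : LeftTensor F p V) :
    comul (map f z) = map (map f) (comul z) := by
  refine hom_ext (f := comul.comp (map f).toAddMonoidHom)
    (g := (map (map f)).toAddMonoidHom.comp comul) (fun e v => ?_) z
  simp [comul_apply]

theorem map_map {U : Type} [AddCommGroup U] [Module (Coeff F p) U]
    (g : W →ₗ[Coeff F p] U) (f : V →ₗ[Coeff F p] W) (z : LeftTensor F p V) :
    map g (map f z) = map (g ∘ₗ f) z :=
  hom_ext (f := (map g).toAddMonoidHom.comp (map f).toAddMonoidHom)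
    (g := (map (g ∘ₗ f)).toAddMonoidHom) (fun _ _ => rfl) z

theorem eval_map (θ : DualE F p →ₗ[Coeff F p] Coeff F p)
    (f : V →ₗ[Coeff F p] W) (z : LeftTensor F p V) : eval θ (map f z) = f (eval θ z) :=
  hom_ext (f := (eval θ).comp (map f).toAddMonoidHom)
    (g := f.toAddMonoidHom.comp (eval θ)) (fun _ _ => (map_smul f _ _).symm) z

end LeftTensor

namespace DualE

theorem q₀_one : q₀ (1 : DualE F p) = 0 := rfl
theorem q₁_one : q₁ (1 : DualE F p) = 0 := by ext1 <;> simp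
theorem q₀₁_one : q₀₁ (1 : DualE F p) = 0 := rfl
theorem q₀_t₀ : q₀ (t₀ F p) = 1 := rfl
theorem q₁_t₀ : q₁ (t₀ F p) = 0 := by ext1 <;> simp [t₀]
theorem q₀₁_t₀ : q₀₁ (t₀ F p) = 0 := rfl
theorem q₀_t₁ : q₀ (t₁ F p) = 0 := rfl
theorem q₁_t₁ : q₁ (t₁ F p) = 1 := by ext1 <;> simp [t₁]
theorem q₀₁_t₁ : q₀₁ (t₁ F p) = 0 := rfl
theorem q₀_t₀₁ : q₀ (t₀ F p * t₁ F p) = t₁ F p := by ext1 <;> simp [t₀, t₁]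
theorem q₁_t₀₁ : q₁ (t₀ F p * t₁ F p) = - t₀ F p := by ext1 <;> simp [t₀, t₁]
theorem q₀₁_t₀₁ : q₀₁ (t₀ F p * t₁ F p) = 1 := by ext1 <;> simp [t₀, t₁]
theorem q₀_q₀ (e : DualE F p) : q₀ (q₀ e) = 0 := rfl
theorem q₁_q₀ (e : DualE F p) : q₁ (q₀ e) = q₀₁ e := by ext1 <;> simp
theorem q₀₁_q₀ (e : DualE F p) : q₀₁ (q₀ e) = 0 := rfl
theorem q₀_q₁ (e : DualE F p) : q₀ (q₁ e) = - q₀₁ e := by ext1 <;> simp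
theorem q₁_q₁ (e : DualE F p) : q₁ (q₁ e) = 0 := by ext1 <;> simp
theorem q₀₁_q₁ (e : DualE F p) : q₀₁ (q₁ e) = 0 := rfl
theorem q₀_q₀₁ (e : DualE F p) : q₀ (q₀₁ e) = 0 := rfl
theorem q₁_q₀₁ (e : DualE F p) : q₁ (q₀₁ e) = 0 := by ext1 <;> simp
theorem q₀₁_q₀₁ (e : DualE F p) : q₀₁ (q₀₁ e) = 0 := rfl

end DualE

variable (F p) in
/-- `E(1)^∨` as a left comodule over itself. -/
def cofree : Comodule F p where
  carrier := DualELeft F p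
  gr := fun d => (DualE.gr d).map DualELeft.of.toAddMonoidHom
  coact :=
    { toFun := fun e => DualELeft.comulAux (DualELeft.of.symm e)
      map_add' := fun _ _ => DualELeft.comulAux_add _ _
      map_smul' := fun m e => DualELeft.comulAux_smul m (DualELeft.of.symm e) }
  counit_coact e := by
    change LeftTensor.eval DualE.counit (DualELeft.comulAux (DualELeft.of.symm e)) = e
    simp [DualELeft.comulAux, t₀, t₁]
  coassoc e := by
    change LeftTensor.map _ (DualELeft.comulAux (DualELeft.of.symm e)) =
      comul (DualELeft.comulAux (DualELeft.of.symm e))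
    obtain ⟨e, rfl⟩ := DualELeft.of.surjective e
    simp only [comul_apply, DualELeft.comulAux, map_add, map_tmul, rmap_tmul,
      LinearMap.coe_mk, AddHom.coe_mk, tmul_add, AddEquiv.symm_apply_apply]
    simp only [q₀_one, q₁_one, q₀₁_one, q₀_t₀, q₁_t₀, q₀₁_t₀, q₀_t₁, q₁_t₁, q₀₁_t₁, q₀_t₀₁,
      q₁_t₀₁, q₀₁_t₀₁, q₀_q₀, q₁_q₀, q₀₁_q₀, q₀_q₁, q₁_q₁, q₀₁_q₁, q₀_q₀₁, q₁_q₀₁, q₀₁_q₀₁,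
      map_zero, LeftTensor.tmul_zero, LeftTensor.zero_tmul, map_neg, tmul_neg, neg_tmul]
    abel


theorem DualELeft.eval_comulAux (θ : DualE F p →ₗ[Coeff F p] Coeff F p) (e : DualE F p) :
    LeftTensor.eval θ (DualELeft.comulAux e) = DualELeft.of (etaL (θ 1) * e +
      etaL (θ (t₀ F p)) * q₀ e + etaL (θ (t₁ F p)) * q₁ e +
      etaL (θ (t₀ F p * t₁ F p)) * q₀₁ e) := by
  simp only [DualELeft.comulAux, map_add, eval_tmul, DualELeft.smul_of]

variable (F p) in
/-- The algebra `E(1)` of `𝕄_p`-linear functionals on `E(1)^∨`, with its convolution product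
(`θ φ` is `φ` after the right action `e ↦ (θ ⊗ 1) ψ(e)` of `θ` on `E(1)^∨`). It contains the Milnor
primitives `Q₀, Q₁`, dual to `τ₀, τ₁`, and acts on the right of every left comodule. -/
def SteenrodE : Type := DualE F p →ₗ[Coeff F p] Coeff F p

namespace SteenrodE

instance : AddCommGroup (SteenrodE F p) :=
  inferInstanceAs (AddCommGroup (DualE F p →ₗ[Coeff F p] Coeff F p))

def toHom : SteenrodE F p ≃+ (DualE F p →ₗ[Coeff F p] Coeff F p) := AddEquiv.refl _

@[ext] theorem ext {θ φ : SteenrodE F p} (h : ∀ e, θ.toHom e = φ.toHom e) : θ = φ :=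
  toHom.injective (LinearMap.ext h)

/-- The right action of `E(1)` on `E(1)^∨`. -/
def rightAct (θ : SteenrodE F p) : DualE F p →ₗ[Coeff F p] DualE F p where
  toFun e := DualELeft.of.symm (LeftTensor.eval θ.toHom (DualELeft.comulAux e))
  map_add' e f := by simp only [DualELeft.comulAux_add, map_add]
  map_smul' m e := by
    change DualELeft.of.symm (LeftTensor.eval θ.toHom (DualELeft.comulAux (m • e))) =
      m • DualELeft.of.symm (LeftTensor.eval θ.toHom (DualELeft.comulAux e))
    simp only [DualELeft.eval_comulAux, AddEquiv.symm_apply_apply, smul_add, map_smul,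
      mul_smul_comm]

theorem rightAct_apply (θ : SteenrodE F p) (e : DualE F p) :
    θ.rightAct e = etaL (θ.toHom 1) * e +
      etaL (θ.toHom (t₀ F p)) * q₀ e + etaL (θ.toHom (t₁ F p)) * q₁ e +
      etaL (θ.toHom (t₀ F p * t₁ F p)) * q₀₁ e := by
  change DualELeft.of.symm (LeftTensor.eval θ.toHom (DualELeft.comulAux e)) = _
  rw [DualELeft.eval_comulAux, AddEquiv.symm_apply_apply]

instance : One (SteenrodE F p) := ⟨toHom.symm DualE.counit⟩

instance : Mul (SteenrodE F p) := ⟨fun θ φ => toHom.symm (φ.toHom ∘ₗ θ.rightAct)⟩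

theorem toHom_one : (1 : SteenrodE F p).toHom = DualE.counit := rfl

theorem toHom_mul (θ φ : SteenrodE F p) (e : DualE F p) :
    (θ * φ).toHom e = φ.toHom (θ.rightAct e) := rfl

end SteenrodE

/-- The right action `x ↦ (θ ⊗ 1) α(x)` of `E(1)` on a left comodule with coaction `α`. -/
def Comodule.act (N : Comodule F p) (θ : SteenrodE F p) : N.carrier →+ N.carrier :=
  (LeftTensor.eval θ.toHom).comp N.coact.toAddMonoidHom

theorem Comodule.act_apply (N : Comodule F p) (θ : SteenrodE F p) (x : N.carrier) :
    N.act θ x = LeftTensor.eval θ.toHom (N.coact x) := rfl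

theorem Comodule.act_one (N : Comodule F p) (x : N.carrier) : N.act 1 x = x :=
  N.counit_coact x

theorem Comodule.act_mul (N : Comodule F p) (θ φ : SteenrodE F p) (x : N.carrier) :
    N.act (θ * φ) x = N.act φ (N.act θ x) := by
  have h1 : N.coact (N.act θ x) =
      LeftTensor.eval θ.toHom (LeftTensor.comul (N.coact x)) := by
    rw [← N.coassoc, LeftTensor.eval_map, N.act_apply]
  rw [N.act_apply φ, h1, N.act_apply]
  refine LeftTensor.hom_ext (f := LeftTensor.eval (θ * φ).toHom)
    (g := (LeftTensor.eval φ.toHom).comp ((LeftTensor.eval θ.toHom).comp LeftTensor.comul))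
    (fun e v => ?_) (N.coact x)
  simp only [AddMonoidHom.comp_apply, LeftTensor.comul_apply, LeftTensor.rmap_tmul, map_add,
    LeftTensor.eval_tmul, LeftTensor.smul_def, LeftTensor.smul_tmul, SteenrodE.toHom_mul,
    SteenrodE.rightAct_apply, add_smul]

namespace SteenrodE

theorem rightAct_one (e : DualE F p) : (1 : SteenrodE F p).rightAct e = e :=
  (cofree F p).act_one (DualELeft.of e)

theorem rightAct_mul (θ φ : SteenrodE F p) (e : DualE F p) :
    (θ * φ).rightAct e = φ.rightAct (θ.rightAct e) :=
  (cofree F p).act_mul θ φ (DualELeft.of e)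

theorem toHom_eq_sum (θ : SteenrodE F p) (e : DualE F p) :
    θ.toHom e = e.c * θ.toHom 1 + e.c₀ * θ.toHom (t₀ F p) + e.c₁ * θ.toHom (t₁ F p) +
      e.c₀₁ * θ.toHom (t₀ F p * t₁ F p) := by
  have h : e = e.c • (1 : DualE F p) + e.c₀ • t₀ F p + e.c₁ • t₁ F p +
      e.c₀₁ • (t₀ F p * t₁ F p) := by
    simp only [smul_eq_mul_etaR, one_mul]; exact eq_sum e
  conv_lhs => rw [h]
  simp only [map_add, map_smul, smul_eq_mul]

instance : Ring (SteenrodE F p) where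
  __ := (inferInstance : AddCommGroup (SteenrodE F p))
  one_mul θ := by
    ext e
    rw [toHom_mul, rightAct_one]
  mul_one θ := by
    ext e
    rw [toHom_mul, toHom_one, rightAct_apply]
    conv_rhs => rw [toHom_eq_sum]
    simp [mul_comm]
  mul_assoc θ φ ψ := by
    ext e
    rw [toHom_mul, toHom_mul, toHom_mul, rightAct_mul]
  left_distrib θ φ ψ := by ext e; rfl
  right_distrib θ φ ψ := by
    ext e
    simp only [toHom_mul, rightAct_apply, map_add, LinearMap.add_apply, add_mul]
    abel
  zero_mul θ := by
    ext e
    rw [toHom_mul, rightAct_apply]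
    simp
  mul_zero θ := by ext e; rfl

end SteenrodE


namespace SteenrodE

open MulOpposite

/-- The inclusion of the coefficients into `E(1)`, so that right `E(1)`-modules are
`𝕄_p`-modules. -/
def scalar : Coeff F p →+* (SteenrodE F p)ᵐᵒᵖ where
  toFun m := op (toHom.symm (m • DualE.counit))
  map_one' := by rw [one_smul]; rfl
  map_zero' := by rw [zero_smul]; rfl
  map_add' m n := by rw [add_smul]; rfl
  map_mul' m n := by
    apply unop_injective
    ext e
    rw [unop_mul, toHom_mul, rightAct_apply]
    simp [t₀, t₁, mul_assoc]

variable (F p) in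
/-- The Milnor primitive `Q₀`, dual to `τ₀`. -/
def Q₀ : SteenrodE F p := toHom.symm
  { toFun := fun e => e.c₀
    map_add' := fun _ _ => rfl
    map_smul' := fun _ _ => mul_comm _ _ }

variable (F p) in
/-- The Milnor primitive `Q₁`, dual to `τ₁`. -/
def Q₁ : SteenrodE F p := toHom.symm
  { toFun := fun e => e.c₁
    map_add' := fun _ _ => rfl
    map_smul' := fun _ _ => mul_comm _ _ }

@[simp] theorem toHom_Q₀ (e : DualE F p) : (Q₀ F p).toHom e = e.c₀ := rfl
@[simp] theorem toHom_Q₁ (e : DualE F p) : (Q₁ F p).toHom e = e.c₁ := rfl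
@[simp] theorem toHom_scalar (m : Coeff F p) (e : DualE F p) :
    (unop (scalar m)).toHom e = m * e.c := rfl

theorem rightAct_scalar (m : Coeff F p) (e : DualE F p) :
    (unop (scalar m)).rightAct e = etaL m * e := by
  rw [rightAct_apply]; simp [t₀, t₁]

theorem rightAct_Q₀ (e : DualE F p) : (Q₀ F p).rightAct e = q₀ e := by
  rw [rightAct_apply]; simp [t₀, t₁]

theorem rightAct_Q₁ (e : DualE F p) : (Q₁ F p).rightAct e = q₁ e := by
  rw [rightAct_apply]; simp [t₀, t₁]

@[simp] theorem toHom_Q₀_mul_Q₁ (e : DualE F p) : (Q₀ F p * Q₁ F p).toHom e = e.c₀₁ := by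
  rw [toHom_mul, rightAct_Q₀]; simp

theorem rightAct_Q₀_mul_Q₁ (e : DualE F p) : (Q₀ F p * Q₁ F p).rightAct e = q₀₁ e := by
  rw [rightAct_mul, rightAct_Q₀, rightAct_Q₁, q₁_q₀]

theorem Q₀_mul_Q₀ : Q₀ F p * Q₀ F p = 0 := by
  ext e; rw [toHom_mul, rightAct_Q₀]; rfl

theorem Q₁_mul_Q₁ : Q₁ F p * Q₁ F p = 0 := by
  ext e; rw [toHom_mul, rightAct_Q₁]; rfl

theorem Q₁_mul_Q₀ : Q₁ F p * Q₀ F p = - (Q₀ F p * Q₁ F p) := by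
  ext e; rw [toHom_mul, rightAct_Q₁, map_neg, LinearMap.neg_apply, toHom_Q₀_mul_Q₁]; rfl

theorem Q₀_mul_Q₀_mul_Q₁ : Q₀ F p * (Q₀ F p * Q₁ F p) = 0 := by
  rw [← mul_assoc, Q₀_mul_Q₀, zero_mul]

theorem Q₁_mul_Q₀_mul_Q₁ : Q₁ F p * (Q₀ F p * Q₁ F p) = 0 := by
  rw [← mul_assoc, Q₁_mul_Q₀, neg_mul, mul_assoc, Q₁_mul_Q₁, mul_zero, neg_zero]

theorem scalar_mul (m : Coeff F p) (θ : SteenrodE F p) : unop (scalar m) * θ =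
    unop (scalar (θ.toHom (etaL m))) +
    Q₀ F p * unop (scalar (θ.toHom (etaL m * t₀ F p))) +
    Q₁ F p * unop (scalar (θ.toHom (etaL m * t₁ F p))) +
    Q₀ F p * Q₁ F p * unop (scalar (θ.toHom (etaL m * (t₀ F p * t₁ F p)))) := by
  ext e
  have h : etaL m * e = e.c • etaL m + e.c₀ • (etaL m * t₀ F p) + e.c₁ • (etaL m * t₁ F p) +
      e.c₀₁ • (etaL m * (t₀ F p * t₁ F p)) := by
    conv_lhs => rw [eq_sum e]
    simp only [smul_eq_mul_etaR, mul_add, mul_assoc]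
  rw [toHom_mul, rightAct_scalar, h]
  simp only [map_add, map_smul, smul_eq_mul, LinearMap.add_apply, toHom_mul, toHom_scalar,
    rightAct_Q₀, rightAct_Q₁, rightAct_mul, q₁_q₀]
  simp [mul_comm]

end SteenrodE

open SteenrodE MulOpposite

theorem LeftTensor.eq_sum {V : Type} [AddCommGroup V] [Module (Coeff F p) V]
    (z : LeftTensor F p V) : z = tmul 1 (LeftTensor.eval DualE.counit z) +
      tmul (t₀ F p) (LeftTensor.eval (Q₀ F p).toHom z) +
      tmul (t₁ F p) (LeftTensor.eval (Q₁ F p).toHom z) +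
      tmul (t₀ F p * t₁ F p) (LeftTensor.eval (Q₀ F p * Q₁ F p).toHom z) := by
  induction z using LeftTensor.induction_on with
  | h0 => simp
  | ha y z hy hz =>
    conv_lhs => rw [hy, hz]
    simp only [map_add, tmul_add]; abel
  | ht e v =>
    conv_lhs => rw [DualE.eq_sum e]
    simp only [add_tmul, eval_tmul, tmul_smul, counit_apply, toHom_Q₀, toHom_Q₁,
      toHom_Q₀_mul_Q₁, one_mul]

section RightModule

variable {V : Type} [AddCommGroup V] [Module (Coeff F p) V] [Module (SteenrodE F p)ᵐᵒᵖ V]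

/-- The coaction that corresponds to a right `E(1)`-action, in terms of the dual bases
`1, τ₀, τ₁, τ₀ τ₁` and `1, Q₀, Q₁, Q₀ Q₁`. -/
def coactOfRight (x : V) : LeftTensor F p V :=
  tmul 1 x + tmul (t₀ F p) (op (Q₀ F p) • x) + tmul (t₁ F p) (op (Q₁ F p) • x) +
    tmul (t₀ F p * t₁ F p) (op (Q₀ F p * Q₁ F p) • x)

theorem coactOfRight_add (x y : V) :
    coactOfRight (F := F) (p := p) (x + y) = coactOfRight x + coactOfRight y := by
  simp only [coactOfRight, smul_add, tmul_add]; abel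

theorem op_smul_scalar (hV : ∀ (m : Coeff F p) (x : V), m • x = scalar m • x)
    (m : Coeff F p) (θ : SteenrodE F p) (x : V) : op θ • m • x =
      θ.toHom (etaL m) • x + θ.toHom (etaL m * t₀ F p) • op (Q₀ F p) • x +
      θ.toHom (etaL m * t₁ F p) • op (Q₁ F p) • x +
      θ.toHom (etaL m * (t₀ F p * t₁ F p)) • op (Q₀ F p * Q₁ F p) • x := by
  have h := congrArg (fun φ => op φ • x) (scalar_mul m θ)
  simp only [op_add, op_mul, op_unop, add_smul, mul_smul, ← hV] at h
  simpa only [op_mul, mul_smul] using h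

theorem coactOfRight_smul (hV : ∀ (m : Coeff F p) (x : V), m • x = scalar m • x)
    (m : Coeff F p) (x : V) :
    coactOfRight (F := F) (p := p) (m • x) = m • coactOfRight x := by
  have e : ∀ f : DualE F p, ∀ v : V, tmul f v = tmul 1 (f.c • v) + tmul (t₀ F p) (f.c₀ • v) +
      tmul (t₁ F p) (f.c₁ • v) + tmul (t₀ F p * t₁ F p) (f.c₀₁ • v) := fun f v => by
    have := LeftTensor.eq_sum (tmul f v)
    simpa only [eval_tmul, counit_apply, toHom_Q₀, toHom_Q₁, toHom_Q₀_mul_Q₁] using this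
  simp only [coactOfRight, LeftTensor.smul_def, smul_add, LeftTensor.smul_tmul, mul_one]
  rw [op_smul_scalar hV, op_smul_scalar hV, op_smul_scalar hV, e (etaL m) x,
    e (etaL m * t₀ F p), e (etaL m * t₁ F p), e (etaL m * (t₀ F p * t₁ F p))]
  simp only [tmul_add, toHom_Q₀, toHom_Q₁, toHom_Q₀_mul_Q₁, etaL_c]
  simp only [mul_c, etaL_c, t₀, t₁]
  simp
  abel

/-- A right `E(1)`-module as a left `E(1)^∨`-comodule. The `𝕄_p`-module structure has to be the
one that is induced from `E(1)`. -/
def Comodule.ofRightModule (hV : ∀ (m : Coeff F p) (x : V), m • x = scalar m • x)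
    (gr : ℤ × ℤ → AddSubgroup V) : Comodule F p where
  carrier := V
  gr := gr
  coact :=
    { toFun := coactOfRight
      map_add' := coactOfRight_add
      map_smul' := coactOfRight_smul hV }
  counit_coact x := by
    change LeftTensor.eval DualE.counit (coactOfRight x) = x
    simp [coactOfRight, t₀, t₁]
  coassoc x := by
    change LeftTensor.map _ (coactOfRight x) = comul (coactOfRight x)
    simp only [coactOfRight, map_add, map_tmul, comul_apply, rmap_tmul,
      LinearMap.coe_mk, AddHom.coe_mk, smul_smul, ← op_mul, mul_assoc, Q₀_mul_Q₀, Q₁_mul_Q₁, Q₁_mul_Q₀, Q₀_mul_Q₀_mul_Q₁,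
      Q₁_mul_Q₀_mul_Q₁, mul_zero, mul_neg, neg_zero, op_zero, op_neg, zero_smul, neg_smul,
      LeftTensor.tmul_zero, tmul_neg, tmul_add,
      q₀_one, q₁_one, q₀₁_one, q₀_t₀, q₁_t₀, q₀₁_t₀, q₀_t₁, q₁_t₁, q₀₁_t₁, q₀_t₀₁,
      q₁_t₀₁, q₀₁_t₀₁, LeftTensor.zero_tmul, neg_tmul]
    abel

end RightModule

namespace Comodule

section restrict

variable (N : Comodule F p) (S : Submodule (Coeff F p) N.carrier)

theorem map_subtype_injective :
    Function.Injective (LeftTensor.map (F := F) (p := p) S.subtype) := by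
  rw [injective_iff_map_eq_zero]
  intro z hz
  have h : ∀ θ : DualE F p →ₗ[Coeff F p] Coeff F p, LeftTensor.eval θ z = 0 := fun θ => by
    apply Subtype.val_injective
    have := LeftTensor.eval_map θ S.subtype z
    rw [hz, map_zero] at this
    exact this.symm
  rw [LeftTensor.eq_sum z, h, h, h, h]
  simp

variable {N S}

/-- The restricted coaction; `map_restrictCoact` shows that the inclusion is compatible with it. -/
def restrictCoact (hS : ∀ θ : SteenrodE F p, ∀ x ∈ S, N.act θ x ∈ S) (x : S) :
    LeftTensor F p S :=
  tmul 1 ⟨N.act 1 x, hS _ x x.2⟩ + tmul (t₀ F p) ⟨N.act (Q₀ F p) x, hS _ x x.2⟩ +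
    tmul (t₁ F p) ⟨N.act (Q₁ F p) x, hS _ x x.2⟩ +
    tmul (t₀ F p * t₁ F p) ⟨N.act (Q₀ F p * Q₁ F p) x, hS _ x x.2⟩

theorem map_restrictCoact (hS : ∀ θ : SteenrodE F p, ∀ x ∈ S, N.act θ x ∈ S) (x : S) :
    LeftTensor.map S.subtype (restrictCoact hS x) = N.coact x := by
  conv_rhs => rw [LeftTensor.eq_sum (N.coact x)]
  simp only [restrictCoact, map_add, map_tmul]
  rfl

variable (N S) in
/-- A submodule that is stable under the action of `E(1)`, as a subcomodule. -/
def restrict (hS : ∀ θ : SteenrodE F p, ∀ x ∈ S, N.act θ x ∈ S) : Comodule F p where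
  carrier := S
  gr d := (N.gr d).comap S.subtype.toAddMonoidHom
  coact :=
    { toFun := restrictCoact hS
      map_add' := fun x y => map_subtype_injective N S <| by
        simp only [map_add, map_restrictCoact, Submodule.coe_add]
      map_smul' := fun m x => map_subtype_injective N S <| by
        simp only [map_smul, map_restrictCoact, Submodule.coe_smul, RingHom.id_apply] }
  counit_coact x := by
    apply Subtype.val_injective
    have := LeftTensor.eval_map DualE.counit S.subtype (restrictCoact hS x)
    rw [map_restrictCoact, N.counit_coact] at this
    exact this.symm
  coassoc x := by
    set f : S →ₗ[Coeff F p] LeftTensor F p S :=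
      { toFun := restrictCoact hS
        map_add' := _
        map_smul' := _ } with hf
    have hc : LeftTensor.map S.subtype ∘ₗ f = N.coact ∘ₗ S.subtype :=
      LinearMap.ext fun y => map_restrictCoact hS y
    have hinj : Function.Injective (LeftTensor.map (F := F) (p := p)
        (LeftTensor.map (F := F) (p := p) S.subtype)) := by
      rw [injective_iff_map_eq_zero]
      intro z hz
      have h : ∀ θ : DualE F p →ₗ[Coeff F p] Coeff F p, LeftTensor.eval θ z = 0 := fun θ => by
        apply map_subtype_injective N S
        rw [← LeftTensor.eval_map, hz, map_zero, map_zero]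
      rw [LeftTensor.eq_sum z, h, h, h, h]
      simp
    apply hinj
    rw [LeftTensor.map_map, hc, ← LeftTensor.map_map, ← LeftTensor.comul_map]
    change LeftTensor.map _ (LeftTensor.map _ (restrictCoact hS x)) =
      LeftTensor.comul (LeftTensor.map _ (restrictCoact hS x))
    rw [map_restrictCoact, N.coassoc]

end restrict

variable (F p) in
/-- The trivial comodule `𝕄_p`. -/
def unit : Comodule F p where
  carrier := Coeff F p
  gr := Coeff.gr F p
  coact := LinearMap.toSpanSingleton (Coeff F p) (LeftTensor F p (Coeff F p)) (tmul 1 1)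
  counit_coact m := by
    rw [LinearMap.toSpanSingleton_apply, LeftTensor.smul_def, LeftTensor.smul_tmul]
    simp
  coassoc m := by
    rw [LinearMap.toSpanSingleton_apply, map_smul, comul_smul]
    congr 1
    rw [map_tmul, LinearMap.toSpanSingleton_apply, one_smul, comul_apply]
    simp only [rmap_tmul, q₀_one, q₁_one, q₀₁_one, LeftTensor.zero_tmul, LeftTensor.tmul_zero,
      add_zero]

/-- The suspension, with `d` added to all bidegrees. -/
def suspend (d : ℤ × ℤ) (N : Comodule F p) : Comodule F p :=
  { N with gr := fun e => N.gr (e - d) }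

/-- The direct sum of two comodules. -/
def prod (N P : Comodule F p) : Comodule F p where
  carrier := N.carrier × P.carrier
  gr d := (N.gr d).prod (P.gr d)
  coact := LeftTensor.map (LinearMap.inl _ _ _) ∘ₗ N.coact ∘ₗ LinearMap.fst _ _ _ +
    LeftTensor.map (LinearMap.inr _ _ _) ∘ₗ P.coact ∘ₗ LinearMap.snd _ _ _
  counit_coact x := by
    simp only [LinearMap.add_apply, LinearMap.comp_apply, map_add, LeftTensor.eval_map,
      N.counit_coact, P.counit_coact]
    simp
  coassoc x := by
    simp only [LinearMap.add_apply, LinearMap.comp_apply, map_add, LeftTensor.map_map,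
      LeftTensor.comul_map, ← N.coassoc, ← P.coassoc]
    congr 2 <;> congr 1 <;> ext y <;> simp

/-- The direct sum of a finite family of comodules. -/
def directSum {ι : Type} [Fintype ι] [DecidableEq ι] (N : ι → Comodule F p) : Comodule F p where
  carrier := ∀ i, (N i).carrier
  gr d := AddSubgroup.pi Set.univ fun i => (N i).gr d
  coact := ∑ i, LeftTensor.map (LinearMap.single (Coeff F p) (fun i => (N i).carrier) i) ∘ₗ
    (N i).coact ∘ₗ LinearMap.proj i
  counit_coact x := by
    simp only [LinearMap.sum_apply, LinearMap.comp_apply, map_sum, LeftTensor.eval_map,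
      Comodule.counit_coact]
    ext i
    simp
  coassoc x := by
    simp only [LinearMap.sum_apply, LinearMap.comp_apply, map_sum, LeftTensor.map_map,
      LeftTensor.comul_map, ← Comodule.coassoc]
    refine Finset.sum_congr rfl fun i _ => ?_
    congr 2
    ext y
    simp only [LinearMap.sum_apply, LinearMap.comp_apply, LinearMap.proj_apply]
    rw [Finset.sum_eq_single i]
    · simp
    · intro j _ hj
      simp [hj]
    · simp

/-- Isomorphisms of comodules: linear, preserving the bigrading, and compatible with the coaction. -/
structure Iso (N P : Comodule F p) where
  toLinearEquiv : N.carrier ≃ₗ[Coeff F p] P.carrier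
  mem_gr_iff : ∀ d x, toLinearEquiv x ∈ P.gr d ↔ x ∈ N.gr d
  coact_apply : ∀ x, P.coact (toLinearEquiv x) =
    LeftTensor.map toLinearEquiv.toLinearMap (N.coact x)

end Comodule

namespace SteenrodE

/-- The functionals that raise bidegrees by `d`; thus `Q₀` has bidegree `-|τ₀|`. -/
def gr (d : ℤ × ℤ) : AddSubgroup (SteenrodE F p) where
  carrier := {θ | ∀ c, ∀ e ∈ DualE.gr c, θ.toHom e ∈ Coeff.gr F p (c + d)}
  zero_mem' := fun _ _ _ => zero_mem _
  add_mem' h h' := fun c e he => add_mem (h c e he) (h' c e he)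
  neg_mem' h := fun c e he => neg_mem (h c e he)

end SteenrodE

section lightning

variable (F p) (k : ℕ)

/-- The generators `x_1, …, x_k` of a free right `E(1)`-module; `x_{i+1}` has index `i`. -/
def lightningGen (i : Fin k) : Fin k → SteenrodE F p := Pi.single i 1

/-- The relations `x_{i+1} Q₁ = x_i Q₀` for `1 ≤ i ≤ k - 1`, and `x_1 Q₀ Q₁ = 0`. The latter follows
from the former when `k ≥ 2`; it is needed to get the picture with `2 k + 1` cells when `k = 1`. -/
def lightningRel : Submodule (SteenrodE F p)ᵐᵒᵖ (Fin k → SteenrodE F p) :=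
  Submodule.span _
    ({v | ∃ i j : Fin k, j.val = i.val + 1 ∧
        v = op (Q₁ F p) • lightningGen F p k j - op (Q₀ F p) • lightningGen F p k i} ∪
      {v | ∃ i : Fin k, i.val = 0 ∧
        v = op (Q₀ F p * Q₁ F p) • lightningGen F p k i})

/-- The quotient of the free module by the relations. -/
def LightningModule : Type := (Fin k → SteenrodE F p) ⧸ lightningRel F p k

instance : AddCommGroup (LightningModule F p k) :=
  inferInstanceAs (AddCommGroup (_ ⧸ lightningRel F p k))

instance : Module (SteenrodE F p)ᵐᵒᵖ (LightningModule F p k) :=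
  inferInstanceAs (Module (SteenrodE F p)ᵐᵒᵖ (_ ⧸ lightningRel F p k))

instance : Module (Coeff F p) (LightningModule F p k) :=
  Module.compHom _ (scalar (F := F) (p := p))

/-- The bidegree of `x_i`. -/
def lightningDeg (i : ℕ) : ℤ × ℤ := i • ((2 * (p : ℤ) - 2, (p : ℤ) - 1) : ℤ × ℤ) + (1, 0)

/-- The homogeneous elements of bidegree `d`: the classes of `∑ x_i θ_i` with `|θ_i| = d - |x_i|`. -/
def lightningGr (d : ℤ × ℤ) : AddSubgroup (LightningModule F p k) :=
  (AddSubgroup.pi Set.univ fun i : Fin k =>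
    SteenrodE.gr (F := F) (p := p) (d - lightningDeg p (i.val + 1))).map
      (lightningRel F p k).mkQ.toAddMonoidHom

/-- The motivic homological lightning flash module `L_p(k)`, with `L_p(0) = 𝕄_p`. -/
def lightningFlash : ℕ → Comodule F p
  | 0 => Comodule.unit F p
  | k + 1 => Comodule.ofRightModule (V := LightningModule F p (k + 1)) (fun _ _ => rfl)
      (lightningGr F p (k + 1))

end lightning


section BrownGitler

/-- The index `(a, S)` stands for the monomial `∏ ξ_{n+1} ^ a(n) · ∏_{n ∈ S} τ_{n+1}`, where the factors
`τ` are written in increasing order. -/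
abbrev MonoIndex : Type := (ℕ →₀ ℕ) × Finset ℕ

variable (F p)

/-- `A // E(0)^∨ = 𝕄_p[ξ_1, ξ_2, …, τ_1, τ_2, …] / (relations)`, a free `𝕄_p`-module on the monomials
in which every `τ_i` has exponent at most `1`. The relations are `τ_i ^ 2 = 0` for odd `p` and
`τ_i ^ 2 = τ ξ_{i+1} + b τ_{i+1}` for `p = 2`. -/
abbrev HZ : Type := MonoIndex →₀ Coeff F p

/-- The weight of a monomial, where `ξ_i` and `τ_i` have weight `p ^ i`. -/
def monoWeight (μ : MonoIndex) : ℕ :=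
  (μ.1.sum fun n a => a * p ^ (n + 1)) + ∑ n ∈ μ.2, p ^ (n + 1)

/-- The bidegree of a monomial. -/
def monoDeg (μ : MonoIndex) : ℤ × ℤ :=
  (μ.1.sum fun n a => a • xiDeg p (n + 1)) + ∑ n ∈ μ.2, tauDeg p (n + 1)

/-- The homogeneous elements of bidegree `d`. -/
def hzGr (d : ℤ × ℤ) : AddSubgroup (HZ F p) where
  carrier := {x | ∀ μ, x μ ∈ Coeff.gr F p (d - monoDeg p μ)}
  zero_mem' := fun _ => zero_mem _
  add_mem' h h' := fun μ => add_mem (h μ) (h' μ)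
  neg_mem' h := fun μ => neg_mem (h μ)

/-- Multiplication by the monomial `∏ ξ_{n+1} ^ b(n)`. -/
def xiMul (b : ℕ →₀ ℕ) : HZ F p →ₗ[Coeff F p] HZ F p :=
  Finsupp.lmapDomain _ _ fun μ => (μ.1 + b, μ.2)

/-- The product of `τ_{j+1}` and a monomial, reduced to the basis by the relations. The first argument
bounds the number of times that the relation for `τ_i ^ 2` is used; the number of factors `τ` in the
monomial always suffices. -/
def tauMulMono : ℕ → ℕ → MonoIndex → HZ F p
  | 0, j, μ => Finsupp.single (μ.1, insert j μ.2) 1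
  | N + 1, j, μ =>
    if j ∈ μ.2 then
      if p = 2 then
        evenGen F p • Finsupp.single (μ.1 + Finsupp.single (j + 1) 1, μ.2.erase j) 1 +
          bock F p • tauMulMono N (j + 1) (μ.1, μ.2.erase j)
      else 0
    else (-1 : Coeff F p) ^ (μ.2.filter (· < j)).card • Finsupp.single (μ.1, insert j μ.2) 1

/-- Multiplication by `τ_{j+1}` on the left, with the sign `τ_{j+1} m = sign(m) τ_{j+1}`. -/
def tauMul (j : ℕ) : HZ F p →+ HZ F p :=
  Finsupp.liftAddHom fun μ =>
    ((LinearMap.toSpanSingleton (Coeff F p) (HZ F p)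
      (tauMulMono F p μ.2.card j μ)).toAddMonoidHom.comp (sign F p).toAddMonoidHom)

/-- The exponents of the monomial `ξ_j ^ p`, where `ξ_0 = 1`. -/
def xiPrevPow : ℕ → (ℕ →₀ ℕ)
  | 0 => 0
  | j + 1 => Finsupp.single j p

variable {F p}

theorem tauMul_single (j : ℕ) (μ : MonoIndex) (m : Coeff F p) :
    tauMul F p j (Finsupp.single μ m) = sign F p m • tauMulMono F p μ.2.card j μ := by
  simp [tauMul]

theorem tauMul_smul (j : ℕ) (m : Coeff F p) (x : HZ F p) :
    tauMul F p j (m • x) = sign F p m • tauMul F p j x := by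
  induction x using Finsupp.induction_linear with
  | zero => simp
  | add x y hx hy => simp only [smul_add, map_add, hx, hy]
  | single μ n => rw [Finsupp.smul_single, tauMul_single, tauMul_single, smul_smul, smul_eq_mul,
      map_mul]

/-- The sign involution of `E(1)^∨`. -/
def DualE.parity : DualE F p →+ DualE F p where
  toFun e := ⟨sign F p e.c, -sign F p e.c₀, -sign F p e.c₁, sign F p e.c₀₁⟩
  map_zero' := by ext1 <;> simp
  map_add' e f := by ext1 <;> simp [add_comm]

theorem DualE.parity_smul (m : Coeff F p) (e : DualE F p) :
    DualE.parity (m • e) = sign F p m • DualE.parity e := by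
  ext1 <;> simp [DualE.parity]

/-- Multiplication on the left of `E(1)^∨ ⊗ A // E(0)^∨` by the coaction
`α(τ_{j+1}) = 1 ⊗ τ_{j+1} + τ₀ ⊗ ξ_{j+1} + τ₁ ⊗ ξ_j ^ p`. -/
def tauCoact (j : ℕ) : LeftTensor F p (HZ F p) →+ LeftTensor F p (HZ F p) :=
  TensorProduct.liftAddHom
    (AddMonoidHom.mk' (fun e : DualE F p => AddMonoidHom.mk' (fun x : HZ F p =>
        (tmul (DualE.parity e) (tauMul F p j x) +
          tmul (t₀ F p * e) (xiMul F p (Finsupp.single j 1) x) +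
          tmul (t₁ F p * e) (xiMul F p (xiPrevPow p j) x) : LeftTensor F p (HZ F p)))
        (fun x y => by simp only [map_add, LeftTensor.tmul_add]; abel))
      (fun e f => by
        refine AddMonoidHom.ext fun x => ?_
        simp only [AddMonoidHom.mk'_apply, AddMonoidHom.add_apply, map_add, mul_add,
          LeftTensor.add_tmul]
        abel))
    (fun m e x => by
      simp only [AddMonoidHom.mk'_apply, tauMul_smul, map_smul, LeftTensor.tmul_smul,
        ← smul_eq_mul_etaR, DualE.parity_smul, mul_smul_comm])

theorem tauCoact_tmul (j : ℕ) (e : DualE F p) (x : HZ F p) : tauCoact j (tmul e x) =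
    tmul (DualE.parity e) (tauMul F p j x) +
      tmul (t₀ F p * e) (xiMul F p (Finsupp.single j 1) x) +
      tmul (t₁ F p * e) (xiMul F p (xiPrevPow p j) x) := rfl

variable (F p) in
/-- The coaction on a monomial: the product of the coactions of its factors, where `α(ξ_i) = 1 ⊗ ξ_i`. -/
def monoCoact (μ : MonoIndex) : LeftTensor F p (HZ F p) :=
  (μ.2.sort (· ≤ ·)).foldr (fun j z => tauCoact j z) (tmul 1 (Finsupp.single (μ.1, ∅) 1))

variable (F p) in
/-- The coaction on `A // E(0)^∨`, extended linearly from monomials. -/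
def hzCoact : HZ F p →ₗ[Coeff F p] LeftTensor F p (HZ F p) :=
  Finsupp.linearCombination (Coeff F p) (monoCoact F p)

theorem hzCoact_single (μ : MonoIndex) : hzCoact F p (Finsupp.single μ 1) = monoCoact F p μ := by
  simp [hzCoact]

theorem monoCoact_empty (a : ℕ →₀ ℕ) :
    monoCoact F p (a, ∅) = tmul 1 (Finsupp.single (a, ∅) 1) := by
  simp [monoCoact]

theorem monoCoact_insert (a : ℕ →₀ ℕ) (S : Finset ℕ) (j : ℕ) (hj : ∀ i ∈ S, j < i) :
    monoCoact F p (a, insert j S) = tauCoact j (monoCoact F p (a, S)) := by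
  unfold monoCoact
  rw [Finset.sort_insert _ (fun b hb => (hj b hb).le) (fun h => lt_irrefl _ (hj j h))]
  rfl

theorem parity_etaL_mul (m : Coeff F p) : ∀ e : DualE F p,
    DualE.parity (etaL m * e) = etaL (sign F p m) * DualE.parity e ∧
    t₀ F p * (etaL m * e) = etaL (sign F p m) * (t₀ F p * e) ∧
    t₁ F p * (etaL m * e) = etaL (sign F p m) * (t₁ F p * e) := by
  have key : ∀ m : Coeff F p, etaL m = etaR m → etaL (sign F p m) = etaR (sign F p m) →
      ∀ e : DualE F p, DualE.parity (etaL m * e) = etaL (sign F p m) * DualE.parity e ∧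
      t₀ F p * (etaL m * e) = etaL (sign F p m) * (t₀ F p * e) ∧
      t₁ F p * (etaL m * e) = etaL (sign F p m) * (t₁ F p * e) := by
    intro m h1 h2 e
    rw [h1, h2]
    refine ⟨?_, ?_, ?_⟩ <;> ext1 <;> simp [etaR, t₀, t₁, DualE.parity]
    linear_combination e.c₀ * sqCoeff_mul_sign m
  induction m using coeff_induction with
  | hC c => exact key _ (by simp) (by simp)
  | hodd => exact key _ (by simp) (by simp)
  | heven =>
    intro e
    rw [sign_evenGen, etaL_evenGen']
    have h := neg_sqCoeff (F := F) (p := p)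
    refine ⟨?_, ?_, ?_⟩ <;> ext1 <;> simp [t₀, t₁, DualE.parity]
    · ring
    · linear_combination (bock F p * e.c₀) * h
    · linear_combination (-(bock F p * e.c)) * h
    · ring
    · ring
  | hadd x y hx hy =>
    intro e
    simp only [map_add, add_mul, mul_add, (hx e).1, (hx e).2, (hy e).1, (hy e).2, and_self]
  | hmul x y hx hy =>
    intro e
    simp only [map_mul, mul_assoc, (hx _).1, (hx _).2, (hy _).1, (hy _).2, and_self]

theorem tauCoact_smul (j : ℕ) (m : Coeff F p) (z : LeftTensor F p (HZ F p)) :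
    tauCoact j (m • z) = sign F p m • tauCoact j z := by
  refine LeftTensor.hom_ext (f := (tauCoact j).comp
      (DistribSMul.toAddMonoidHom (LeftTensor F p (HZ F p)) m))
    (g := (DistribSMul.toAddMonoidHom (LeftTensor F p (HZ F p)) (sign F p m)).comp (tauCoact j))
    (fun e x => ?_) z
  change tauCoact j (tmul (etaL m * e) x) = sign F p m • tauCoact j (tmul e x)
  have h := parity_etaL_mul m e
  simp only [tauCoact_tmul, h.1, h.2.1, h.2.2, LeftTensor.smul_def, smul_add,
    LeftTensor.smul_tmul]

theorem xiMul_single (b : ℕ →₀ ℕ) (μ : MonoIndex) (m : Coeff F p) :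
    xiMul F p b (Finsupp.single μ m) = Finsupp.single (μ.1 + b, μ.2) m := by
  simp [xiMul]

theorem xiMul_tauMulMono (b : ℕ →₀ ℕ) (N : ℕ) : ∀ (j : ℕ) (μ : MonoIndex),
    xiMul F p b (tauMulMono F p N j μ) = tauMulMono F p N j (μ.1 + b, μ.2) := by
  induction N with
  | zero => intro j μ; simp [tauMulMono, xiMul_single]
  | succ N ih =>
    intro j μ
    unfold tauMulMono
    split_ifs
    · rw [map_add, map_smul, map_smul, ih, xiMul_single]
      simp only [add_right_comm]
    · rw [map_zero]
    · rw [map_smul, xiMul_single]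

theorem tauMul_xiMul (j : ℕ) (b : ℕ →₀ ℕ) (x : HZ F p) :
    tauMul F p j (xiMul F p b x) = xiMul F p b (tauMul F p j x) := by
  induction x using Finsupp.induction_linear with
  | zero => simp
  | add x y hx hy => simp only [map_add, hx, hy]
  | single μ m => rw [xiMul_single, tauMul_single, tauMul_single, map_smul, xiMul_tauMulMono]

theorem xiMul_xiMul (b c : ℕ →₀ ℕ) (x : HZ F p) :
    xiMul F p b (xiMul F p c x) = xiMul F p c (xiMul F p b x) := by
  induction x using Finsupp.induction_linear with
  | zero => simp
  | add x y hx hy => simp only [map_add, hx, hy]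
  | single μ m => simp only [xiMul_single, add_right_comm]

theorem tauCoact_map_xiMul (j : ℕ) (b : ℕ →₀ ℕ) (z : LeftTensor F p (HZ F p)) :
    tauCoact j (LeftTensor.map (xiMul F p b) z) =
      LeftTensor.map (xiMul F p b) (tauCoact j z) := by
  refine LeftTensor.hom_ext (f := (tauCoact j).comp (LeftTensor.map (xiMul F p b)).toAddMonoidHom)
    (g := (LeftTensor.map (xiMul F p b)).toAddMonoidHom.comp (tauCoact j)) (fun e x => ?_) z
  change tauCoact j (tmul e (xiMul F p b x)) =
    LeftTensor.map (xiMul F p b) (tauCoact j (tmul e x))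
  simp only [tauCoact_tmul, map_add, map_tmul, tauMul_xiMul]
  rw [xiMul_xiMul _ b, xiMul_xiMul _ b]

theorem monoCoact_add (b : ℕ →₀ ℕ) (μ : MonoIndex) :
    monoCoact F p (μ.1 + b, μ.2) = LeftTensor.map (xiMul F p b) (monoCoact F p μ) := by
  obtain ⟨a, S⟩ := μ
  induction S using Finset.induction_on_min with
  | empty => simp only [monoCoact_empty, map_tmul, xiMul_single]
  | insert j S hj ih =>
    simp only at ih ⊢
    rw [monoCoact_insert _ _ _ hj, monoCoact_insert _ _ _ hj, ih, tauCoact_map_xiMul]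

theorem hzCoact_xiMul (b : ℕ →₀ ℕ) (x : HZ F p) :
    hzCoact F p (xiMul F p b x) = LeftTensor.map (xiMul F p b) (hzCoact F p x) := by
  induction x using Finsupp.induction_linear with
  | zero => simp
  | add x y hx hy => simp only [map_add, hx, hy]
  | single μ m =>
    rw [xiMul_single, ← mul_one m, ← smul_eq_mul, ← Finsupp.smul_single, ← Finsupp.smul_single,
      map_smul, map_smul, hzCoact_single, hzCoact_single, monoCoact_add, map_smul]

theorem tauMulMono_of_lt (μ : MonoIndex) (j : ℕ) (hj : ∀ i ∈ μ.2, j < i) :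
    tauMulMono F p μ.2.card j μ = Finsupp.single (μ.1, insert j μ.2) 1 := by
  cases h : μ.2.card with
  | zero => rfl
  | succ N =>
    have h1 : j ∉ μ.2 := fun h => lt_irrefl _ (hj j h)
    have h2 : μ.2.filter (· < j) = ∅ :=
      Finset.filter_eq_empty_iff.2 fun i hi => (hj i hi).le.not_gt
    rw [tauMulMono, if_neg h1, h2, Finset.card_empty, pow_zero, one_smul]

theorem hzCoact_tauMul (j : ℕ) (x : HZ F p)
    (hx : x ∈ Finsupp.supported (Coeff F p) (Coeff F p) {μ : MonoIndex | ∀ i ∈ μ.2, j < i}) :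
    hzCoact F p (tauMul F p j x) = tauCoact j (hzCoact F p x) := by
  rw [Finsupp.supported_eq_span_single] at hx
  induction hx using Submodule.span_induction with
  | mem x h =>
    obtain ⟨μ, hμ, rfl⟩ := h
    rw [tauMul_single, map_one, one_smul, tauMulMono_of_lt μ j hμ, hzCoact_single,
      monoCoact_insert _ _ _ hμ, hzCoact_single]
  | zero => simp
  | add x y _ _ hx hy => simp only [map_add, hx, hy]
  | smul m x _ hx => rw [tauMul_smul, map_smul, map_smul, hx, tauCoact_smul]

/-- The tensor with components `w, x, y, z` in the basis `1, τ₀, τ₁, τ₀ τ₁`. -/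
def coactSum (w x y z : HZ F p) : LeftTensor F p (HZ F p) :=
  tmul 1 w + tmul (t₀ F p) x + tmul (t₁ F p) y + tmul (t₀ F p * t₁ F p) z

theorem tauCoact_coactSum (j : ℕ) (w x y z : HZ F p) :
    tauCoact j (coactSum w x y z) = coactSum (tauMul F p j w)
      (-tauMul F p j x + xiMul F p (Finsupp.single j 1) w)
      (-tauMul F p j y + xiMul F p (xiPrevPow p j) w +
        sqCoeff F p • xiMul F p (Finsupp.single j 1) x)
      (tauMul F p j z + xiMul F p (Finsupp.single j 1) y - xiMul F p (xiPrevPow p j) x) := by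
  have s0 : DualE.parity (1 : DualE F p) = 1 := by ext1 <;> simp [DualE.parity]
  have s1 : DualE.parity (t₀ F p) = - t₀ F p := by ext1 <;> simp [DualE.parity, t₀]
  have s2 : DualE.parity (t₁ F p) = - t₁ F p := by ext1 <;> simp [DualE.parity, t₁]
  have s3 : DualE.parity (t₀ F p * t₁ F p) = t₀ F p * t₁ F p := by
    ext1 <;> simp [DualE.parity, t₀, t₁]
  have m0 : t₀ F p * t₀ F p = t₁ F p * etaR (sqCoeff F p) := by
    ext1 <;> simp [etaR, t₀, t₁]
  have m1 : t₀ F p * (t₀ F p * t₁ F p) = 0 := by ext1 <;> simp [t₀, t₁]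
  have m2 : t₁ F p * (t₀ F p * t₁ F p) = 0 := by ext1 <;> simp [t₀, t₁]
  simp only [coactSum, map_add, tauCoact_tmul, s0, s1, s2, s3, m0, m1, m2, t₁_mul_t₀, t₁_mul_t₁,
    mul_one, LeftTensor.zero_tmul, neg_tmul, LeftTensor.tmul_add, tmul_neg, sub_eq_add_neg,
    LeftTensor.tmul_smul]
  abel

variable (F p) in
/-- The span of the monomials of weight at most `N` with factors `τ` from `S`. -/
def below (S : Finset ℕ) (N : ℕ) : Submodule (Coeff F p) (HZ F p) :=
  Finsupp.supported (Coeff F p) (Coeff F p) {ν : MonoIndex | ν.2 ⊆ S ∧ monoWeight p ν ≤ N}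

theorem monoWeight_insert (a : ℕ →₀ ℕ) (S : Finset ℕ) (j : ℕ) (hj : j ∉ S) :
    monoWeight p (a, insert j S) = monoWeight p (a, S) + p ^ (j + 1) := by
  simp only [monoWeight, Finset.sum_insert hj]; ring

theorem monoWeight_add (a b : ℕ →₀ ℕ) (S : Finset ℕ) :
    monoWeight p (a + b, S) = monoWeight p (a, S) + b.sum fun n c => c * p ^ (n + 1) := by
  simp only [monoWeight]
  rw [Finsupp.sum_add_index' (by simp) (by intros; ring)]
  ring

theorem xiMul_mem_below (b : ℕ →₀ ℕ) (S T : Finset ℕ) (hST : S ⊆ T) (N M : ℕ)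
    (h : N + (b.sum fun n c => c * p ^ (n + 1)) ≤ M) (x : HZ F p) (hx : x ∈ below F p S N) :
    xiMul F p b x ∈ below F p T M := by
  unfold below at hx
  rw [Finsupp.supported_eq_span_single] at hx
  induction hx using Submodule.span_induction with
  | mem x h' =>
    obtain ⟨μ, hμ, rfl⟩ := h'
    rw [xiMul_single]
    refine Finsupp.single_mem_supported _ _ ⟨hμ.1.trans hST, ?_⟩
    rw [monoWeight_add]
    exact (Nat.add_le_add_right hμ.2 _).trans h
  | zero => simp
  | add x y _ _ hx hy => rw [map_add]; exact add_mem hx hy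
  | smul m x _ hx => rw [map_smul]; exact Submodule.smul_mem _ _ hx

theorem tauMul_mem_below (j : ℕ) (S : Finset ℕ) (hj : ∀ i ∈ S, j < i) (N : ℕ)
    (x : HZ F p) (hx : x ∈ below F p S N) :
    tauMul F p j x ∈ below F p (insert j S) (N + p ^ (j + 1)) := by
  unfold below at hx
  rw [Finsupp.supported_eq_span_single] at hx
  induction hx using Submodule.span_induction with
  | mem x h' =>
    obtain ⟨μ, hμ, rfl⟩ := h'
    rw [tauMul_single, map_one, one_smul, tauMulMono_of_lt μ j (fun i hi => hj i (hμ.1 hi))]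
    refine Finsupp.single_mem_supported _ _ ⟨Finset.insert_subset_insert j hμ.1, ?_⟩
    rw [monoWeight_insert _ _ _ (fun h => lt_irrefl _ (hj j (hμ.1 h)))]
    exact Nat.add_le_add_right hμ.2 _
  | zero => simp
  | add x y _ _ hx hy => rw [map_add]; exact add_mem hx hy
  | smul m x _ hx => rw [tauMul_smul]; exact Submodule.smul_mem _ _ hx

theorem hzCoact_tauMul_of_below (j : ℕ) (S : Finset ℕ) (hj : ∀ i ∈ S, j < i) (N : ℕ)
    (x : HZ F p) (hx : x ∈ below F p S N) :
    hzCoact F p (tauMul F p j x) = tauCoact j (hzCoact F p x) :=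
  hzCoact_tauMul j x (Finsupp.supported_mono (Set.ofPred_subset_ofPred.2
    fun _ hν i hi => hj i (hν.1 hi)) hx)

theorem coactSum_map (f : HZ F p →ₗ[Coeff F p] HZ F p) (w x y z : HZ F p) :
    LeftTensor.map f (coactSum w x y z) = coactSum (f w) (f x) (f y) (f z) := by
  simp only [coactSum, map_add, map_tmul]

theorem coactSum_add (w x y z w' x' y' z' : HZ F p) :
    coactSum w x y z + coactSum w' x' y' z' =
      coactSum (w + w') (x + x') (y + y') (z + z') := by
  simp only [coactSum, LeftTensor.tmul_add]; abel

theorem coactSum_neg (w x y z : HZ F p) :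
    -coactSum w x y z = coactSum (-w) (-x) (-y) (-z) := by
  simp only [coactSum, tmul_neg]; abel

theorem coactSum_sqCoeff (w x y z : HZ F p) :
    sqCoeff F p • coactSum w x y z = coactSum (sqCoeff F p • w) (sqCoeff F p • x)
      (sqCoeff F p • y) (sqCoeff F p • z) := by
  have e0 : etaR (sqCoeff F p) * t₀ F p = t₀ F p * etaR (sqCoeff F p) := by
    ext1 <;> simp [etaR, t₀]
  have e1 : etaR (sqCoeff F p) * t₁ F p = t₁ F p * etaR (sqCoeff F p) := by
    ext1 <;> simp [etaR, t₁]
  have e2 : etaR (sqCoeff F p) * (t₀ F p * t₁ F p) = t₀ F p * t₁ F p * etaR (sqCoeff F p) := by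
    rw [← mul_assoc, e0, mul_assoc, e1, mul_assoc]
  simp only [coactSum, smul_add, LeftTensor.smul_def, DualELeft.etaL_sqCoeff,
    LeftTensor.smul_tmul, LeftTensor.tmul_smul, e0, e1, e2, mul_one, one_mul]

theorem hzCoact_mono (a : ℕ →₀ ℕ) (S : Finset ℕ) :
    ∃ x y z : HZ F p, x ∈ below F p S (monoWeight p (a, S)) ∧
      y ∈ below F p S (monoWeight p (a, S)) ∧ z ∈ below F p S (monoWeight p (a, S)) ∧
      hzCoact F p (Finsupp.single (a, S) 1) = coactSum (Finsupp.single (a, S) 1) x y z ∧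
      hzCoact F p x = coactSum x 0 z 0 ∧ hzCoact F p y = coactSum y (-z) 0 0 ∧
      hzCoact F p z = coactSum z 0 0 0 := by
  induction S using Finset.induction_on_min with
  | empty =>
    refine ⟨0, 0, 0, zero_mem _, zero_mem _, zero_mem _, ?_, ?_, ?_, ?_⟩
    · rw [hzCoact_single, monoCoact_empty]; simp [coactSum]
    all_goals simp [coactSum]
  | insert j S hj ih =>
    obtain ⟨x, y, z, hx, hy, hz, hw, hx', hy', hz'⟩ := ih
    have hjS : j ∉ S := fun h => lt_irrefl _ (hj j h)
    have hwm : (Finsupp.single (a, S) 1 : HZ F p) ∈ below F p S (monoWeight p (a, S)) :=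
      Finsupp.single_mem_supported _ _ ⟨Finset.Subset.refl _, le_refl _⟩
    have hins : (Finsupp.single (a, insert j S) 1 : HZ F p) =
        tauMul F p j (Finsupp.single (a, S) 1) := by
      rw [tauMul_single, map_one, one_smul, tauMulMono_of_lt _ j hj]
    have hT := fun u hu => hzCoact_tauMul_of_below (F := F) (p := p) j S hj
      (monoWeight p (a, S)) u hu
    have hm : ∀ u ∈ below F p S (monoWeight p (a, S)),
        tauMul F p j u ∈ below F p (insert j S) (monoWeight p (a, insert j S)) := fun u hu => by
      rw [monoWeight_insert _ _ _ hjS]; exact tauMul_mem_below j S hj _ u hu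
    have hxi : ∀ u ∈ below F p S (monoWeight p (a, S)), xiMul F p (Finsupp.single j 1) u ∈
        below F p (insert j S) (monoWeight p (a, insert j S)) := fun u hu => by
      rw [monoWeight_insert _ _ _ hjS]
      exact xiMul_mem_below _ _ _ (Finset.subset_insert _ _) _ _ (by simp) u hu
    have hxp : ∀ u ∈ below F p S (monoWeight p (a, S)), xiMul F p (xiPrevPow p j) u ∈
        below F p (insert j S) (monoWeight p (a, insert j S)) := fun u hu => by
      rw [monoWeight_insert _ _ _ hjS]
      refine xiMul_mem_below _ _ _ (Finset.subset_insert _ _) _ _ ?_ u hu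
      cases j with
      | zero => simp [xiPrevPow]
      | succ j => simp [xiPrevPow, pow_succ']
    have hr : ∀ u : HZ F p, -(sqCoeff F p • u) = sqCoeff F p • u := fun u => by
      rw [← neg_smul, neg_sqCoeff]
    have hc := xiMul_xiMul (F := F) (p := p) (Finsupp.single j 1) (xiPrevPow p j)
    refine ⟨-tauMul F p j x + xiMul F p (Finsupp.single j 1) (Finsupp.single (a, S) 1),
      -tauMul F p j y + xiMul F p (xiPrevPow p j) (Finsupp.single (a, S) 1) +
        sqCoeff F p • xiMul F p (Finsupp.single j 1) x,
      tauMul F p j z + xiMul F p (Finsupp.single j 1) y - xiMul F p (xiPrevPow p j) x,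
      add_mem (neg_mem (hm _ hx)) (hxi _ hwm),
      add_mem (add_mem (neg_mem (hm _ hy)) (hxp _ hwm)) (Submodule.smul_mem _ _ (hxi _ hx)),
      sub_mem (add_mem (hm _ hz) (hxi _ hy)) (hxp _ hx), ?_, ?_, ?_, ?_⟩
    · rw [hins, hT _ hwm, hw, tauCoact_coactSum]
    · rw [map_add, map_neg, hT _ hx, hx', tauCoact_coactSum, hzCoact_xiMul, hw, coactSum_map,
        coactSum_neg, coactSum_add]
      congr 1 <;> simp only [map_zero, smul_zero] <;> abel
    · rw [map_add, map_add, map_neg, hT _ hy, hy', tauCoact_coactSum, hzCoact_xiMul, hw,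
        map_smul, hzCoact_xiMul, hx', coactSum_map, coactSum_map, coactSum_sqCoeff,
        coactSum_neg, coactSum_add, coactSum_add]
      congr 1
      · simp only [map_neg, map_zero, smul_zero]; abel
      · have hu : ∀ u : HZ F p, sqCoeff F p • u + sqCoeff F p • u = 0 := fun u => by
          nth_rewrite 1 [← hr u]; exact neg_add_cancel _
        simp only [map_neg, smul_neg, map_zero, neg_add, neg_neg, hr]
        refine Eq.trans ?_ (hu (xiMul F p (Finsupp.single j 1) z))
        abel
      · simp only [map_neg, map_zero, smul_zero]; abel
    · rw [map_sub, map_add, hT _ hz, hz', tauCoact_coactSum, hzCoact_xiMul, hy',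
        hzCoact_xiMul, hx', coactSum_map, coactSum_map, sub_eq_add_neg, coactSum_neg,
        coactSum_add, coactSum_add]
      congr 1
      · abel
      · simp only [map_zero, map_neg, neg_zero]; abel
      · simp only [map_zero, smul_zero, hc]; abel
      · simp only [map_zero, neg_zero]; abel

theorem coactSum_coassoc (f : HZ F p →ₗ[Coeff F p] LeftTensor F p (HZ F p)) (w x y z : HZ F p)
    (hw : f w = coactSum w x y z) (hx : f x = coactSum x 0 z 0)
    (hy : f y = coactSum y (-z) 0 0) (hz : f z = coactSum z 0 0 0) :
    LeftTensor.map f (coactSum w x y z) = comul (coactSum w x y z) := by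
  have h : LeftTensor.map f (coactSum w x y z) = tmul 1 (f w) + tmul (t₀ F p) (f x) +
      tmul (t₁ F p) (f y) + tmul (t₀ F p * t₁ F p) (f z) := by
    simp only [coactSum, map_add, map_tmul]
  rw [h, hw, hx, hy, hz]
  simp only [coactSum, comul_apply, map_add, rmap_tmul, tmul_add, q₀_one, q₁_one, q₀₁_one,
    q₀_t₀, q₁_t₀, q₀₁_t₀, q₀_t₁, q₁_t₁, q₀₁_t₁, q₀_t₀₁, q₁_t₀₁, q₀₁_t₀₁,
    LeftTensor.tmul_zero, LeftTensor.zero_tmul, tmul_neg, neg_tmul]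
  abel

theorem eval_coactSum (θ : DualE F p →ₗ[Coeff F p] Coeff F p) (w x y z : HZ F p) :
    LeftTensor.eval θ (coactSum w x y z) = θ 1 • w + θ (t₀ F p) • x + θ (t₁ F p) • y +
      θ (t₀ F p * t₁ F p) • z := by
  simp only [coactSum, map_add, eval_tmul]

variable (F p) in
/-- `A // E(0)^∨` as a comodule. -/
def hz : Comodule F p where
  carrier := HZ F p
  gr := hzGr F p
  coact := hzCoact F p
  counit_coact u := by
    induction u using Finsupp.induction_linear with
    | zero => simp
    | add u v hu hv => rw [map_add, map_add, hu, hv]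
    | single μ m =>
      obtain ⟨x, y, z, -, -, -, hw, -⟩ := hzCoact_mono (F := F) μ.1 μ.2
      rw [← mul_one m, ← smul_eq_mul, ← Finsupp.smul_single, map_smul, hw]
      rw [coactSum, LeftTensor.smul_def]
      simp [LeftTensor.smul_tmul, t₀, t₁]
  coassoc u := by
    induction u using Finsupp.induction_linear with
    | zero => simp
    | add u v hu hv => simp only [map_add, hu, hv]
    | single μ m =>
      obtain ⟨x, y, z, -, -, -, hw, hx, hy, hz⟩ := hzCoact_mono (F := F) μ.1 μ.2
      rw [← mul_one m, ← smul_eq_mul, ← Finsupp.smul_single, map_smul, map_smul, comul_smul]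
      congr 1
      rw [hw]
      exact coactSum_coassoc _ _ _ _ _ hw hx hy hz

variable (F p) in
/-- The span of the monomials of weight at most `k`. -/
def weightLE (k : ℕ) : Submodule (Coeff F p) (HZ F p) :=
  Submodule.span (Coeff F p)
    {u | ∃ μ : MonoIndex, monoWeight p μ ≤ k ∧ u = Finsupp.single μ 1}

theorem weightLE_eq (k : ℕ) : weightLE F p k =
    Finsupp.supported (Coeff F p) (Coeff F p) {μ : MonoIndex | monoWeight p μ ≤ k} := by
  rw [Finsupp.supported_eq_span_single, weightLE]
  congr 1
  ext u
  simp only [Set.mem_ofPred_eq, Set.mem_image, eq_comm]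

theorem eval_smul_mem (S : Submodule (Coeff F p) (HZ F p)) (u : HZ F p)
    (hu : ∀ θ : SteenrodE F p, LeftTensor.eval θ.toHom (hzCoact F p u) ∈ S) (m : Coeff F p)
    (θ : SteenrodE F p) : LeftTensor.eval θ.toHom (hzCoact F p (m • u)) ∈ S := by
  rw [map_smul, LeftTensor.smul_def, LeftTensor.eq_sum (hzCoact F p u)]
  simp only [smul_add, LeftTensor.smul_tmul, map_add, eval_tmul]
  exact add_mem (add_mem (add_mem (S.smul_mem _ (hu 1)) (S.smul_mem _ (hu (Q₀ F p))))
    (S.smul_mem _ (hu (Q₁ F p)))) (S.smul_mem _ (hu (Q₀ F p * Q₁ F p)))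

theorem eval_mem_weightLE (k : ℕ) (u : HZ F p) (hu : u ∈ weightLE F p k) :
    ∀ θ : SteenrodE F p, LeftTensor.eval θ.toHom (hzCoact F p u) ∈ weightLE F p k := by
  induction hu using Submodule.span_induction with
  | mem u h =>
    intro θ
    obtain ⟨μ, hμ, rfl⟩ := h
    obtain ⟨x, y, z, hx, hy, hz', hw, -⟩ := hzCoact_mono (F := F) μ.1 μ.2
    have hb : ∀ v ∈ below F p μ.2 (monoWeight p (μ.1, μ.2)), v ∈ weightLE F p k :=
      fun v hv => by
        rw [weightLE_eq]
        exact Finsupp.supported_mono (Set.ofPred_subset_ofPred.2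
          fun ν hν => hν.2.trans hμ) hv
    rw [hw, eval_coactSum]
    exact add_mem (add_mem (add_mem
      (Submodule.smul_mem _ _ (Submodule.subset_span ⟨μ, hμ, rfl⟩))
      (Submodule.smul_mem _ _ (hb _ hx))) (Submodule.smul_mem _ _ (hb _ hy)))
      (Submodule.smul_mem _ _ (hb _ hz'))
  | zero => intro θ; rw [map_zero, map_zero]; exact zero_mem _
  | add u v _ _ hu hv => intro θ; rw [map_add, map_add]; exact add_mem (hu θ) (hv θ)
  | smul m u _ hu => exact eval_smul_mem _ u hu m

variable (F p) in
/-- The Brown–Gitler comodule `B_0(k)`: the subcomodule of `A // E(0)^∨` that is spanned by the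
monomials of weight at most `k`. -/
def brownGitler (k : ℕ) : Comodule F p :=
  (hz F p).restrict (weightLE F p k) fun θ u hu => eval_mem_weightLE k u hu θ

end BrownGitler

end

end Mot

namespace Mot

noncomputable section

variable {F : BaseField} {p : ℕ}

/-! ### Bidegrees of products and of the left unit -/

namespace Coeff

/-! Give `ξ_0 = 1` weight `1` and pad every monomial of weight at most `k` by a power of `ξ_0`. Then
`B_0(k)` is free over `𝕄_p` on the monomials `∏ ξ_n ^ A(n) · ∏_{n ∈ S} τ_{n+1}` of weight exactly
`k` (`monoWeight_dehom`, `exists_hmon_eq`), and the action becomes uniform in `n ≥ 0`: `Q₀` replaces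
a factor `τ_{n+1}` by `ξ_{n+1}`, and `Q₁` replaces it by `ξ_n ^ p`, summed over `n ∈ S` with Koszul
signs. In addition `Q₁` has `r` times an error, made of monomials in which two factors `τ_{i+1},
τ_{j+1}` have become `ξ_{i+1} ξ_{j+1}` (`act_Q₀_hmon`, `act_Q₁_hmon`).

The top index `N` of a monomial is the largest one for which `ξ_{N+1}` or `τ_{N+1}` divides it; the
bottom index `j` is the least one for which `ξ_j ^ p` or `τ_{j+1}` divides it. When `j < N`,
exchanging `τ_{N+1}` with `ξ_{N+1}` or `τ_{j+1}` with `ξ_j ^ p` changes neither index, so these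
monomials fall into quadruples. Each quadruple contains one monomial `z` with both factors `τ`, and
its members serve as leading monomials of `z`, `z Q₀`, `z Q₁`, `z Q₀ Q₁`. Each `z` generates one
summand `E(1)^∨`.

The other monomials have at most one factor `τ` and form a single zigzag. Start from `ξ_0 ^ k` and
replace `ξ_j ^ p` by `ξ_{j+1}` for the least possible `j`. Between the old and the new monomial lies
one with the factor `τ_{j+1}`, which `Q₁` sends to the old and `Q₀` to the new one. This is carrying
in base `p`: each carry lowers the number of factors by `p - 1`, and the final exponents are the
base `p` digits of `k`, so by Legendre's formula there are `ν_p(k!)` carries (`exists_chain_length`,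
`eq_carry_chain`). The zigzag is the lightning flash.

The zigzag and the four images of each `z` span, also with homogeneous coefficients (`hmon_mem`), by
an induction in which the errors of `Q₁` are harmless because they have fewer factors. Independence
needs no triangularity: the family has the same finite index set as the leading monomials, which are
distinct (`lead_injective`), and over a commutative ring a spanning family with as many members as
some independent family is independent (`linearIndependent_bgFam`).

In `L_p(m)` the generators and their images under `Q₀` and `Q₁` clearly span; they are independent
because `L_p(m)` maps to `A // E(0)^∨` and takes them to the zigzag (`linearIndependent_flashFam`).
Both sides of the proposition thus have homogeneous bases on which `Q₀` and `Q₁` act by the same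
formulas. Since the coaction is recorded by `1, Q₀, Q₁, Q₀ Q₁`, matching the bases is an isomorphism
of comodules (`Comodule.HomBasis.nonempty_iso`). -/

theorem one_mem_gr : (1 : Coeff F p) ∈ gr F p 0 :=
  AddSubgroup.subset_closure ⟨0, 0, by simp, by simp⟩

theorem mul_mem_gr {d e : ℤ × ℤ} {m n : Coeff F p} (hm : m ∈ gr F p d) (hn : n ∈ gr F p e) :
    m * n ∈ gr F p (d + e) := by
  induction hm using AddSubgroup.closure_induction with
  | zero => rw [zero_mul]; exact zero_mem _
  | add x y _ _ hx hy => rw [add_mul]; exact add_mem hx hy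
  | neg x _ hx => rw [neg_mul]; exact neg_mem hx
  | mem x hx =>
    obtain ⟨i, j, rfl, rfl⟩ := hx
    induction hn using AddSubgroup.closure_induction with
    | zero => rw [mul_zero]; exact zero_mem _
    | add x y _ _ hx hy => rw [mul_add]; exact add_mem hx hy
    | neg x _ hx => rw [mul_neg]; exact neg_mem hx
    | mem x hx =>
      obtain ⟨i', j', rfl, rfl⟩ := hx
      refine AddSubgroup.subset_closure ⟨i + i', j + j', ?_, ?_⟩
      · simp only [add_smul]; abel
      · ring

theorem mul_mem_gr' {d e c : ℤ × ℤ} {m n : Coeff F p} (hm : m ∈ gr F p d) (hn : n ∈ gr F p e)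
    (h : d + e = c) : m * n ∈ gr F p c := h ▸ mul_mem_gr hm hn

theorem oddGen_mem_gr : oddGen F p ∈ gr F p (oddDeg F p) :=
  AddSubgroup.subset_closure ⟨1, 0, by simp, by simp⟩

theorem evenGen_mem_gr : evenGen F p ∈ gr F p (evenDeg F p) :=
  AddSubgroup.subset_closure ⟨0, 1, by simp, by simp⟩

theorem bock_mem_gr : bock F p ∈ gr F p (oddDeg F p) := by
  unfold bock; split_ifs
  · exact oddGen_mem_gr
  · exact zero_mem _

theorem sign_mem_gr {d : ℤ × ℤ} {m : Coeff F p} (hm : m ∈ gr F p d) : sign F p m ∈ gr F p d := by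
  induction hm using AddSubgroup.closure_induction with
  | zero => rw [map_zero]; exact zero_mem _
  | add x y _ _ hx hy => rw [map_add]; exact add_mem hx hy
  | neg x _ hx => rw [map_neg]; exact neg_mem hx
  | mem x hx =>
    obtain ⟨i, j, rfl, rfl⟩ := hx
    have h : oddGen F p ^ i * evenGen F p ^ j ∈ gr F p (i • oddDeg F p + j • evenDeg F p) :=
      AddSubgroup.subset_closure ⟨i, j, rfl, rfl⟩
    rw [map_mul, map_pow, map_pow, sign_oddGen, sign_evenGen, neg_pow, mul_assoc]
    rcases neg_one_pow_eq_or (Coeff F p) i with h' | h' <;> rw [h']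
    · rwa [one_mul]
    · rw [neg_one_mul]; exact neg_mem h

/-- The relation `τ₀ ^ 2 = r τ₁` is homogeneous. For `p = 2` admissibility makes `q` odd, so `e = 1`
and `r` has the degree `(-1, -1) = 2 |τ₀| - |τ₁|` of `a`; for odd `p` it is zero. Every other use of
admissibility goes back to this one. -/
theorem sqCoeff_mem_gr (hF : F.Admissible p) :
    sqCoeff F p ∈ gr F p (tauDeg p 0 + tauDeg p 0 - tauDeg p 1) := by
  by_cases h : p = 2
  · subst h
    have hd : tauDeg 2 0 + tauDeg 2 0 - tauDeg 2 1 = oddDeg F 2 := by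
      have he : evenWeight F 2 = 1 := by
        cases F with
        | complex => rfl
        | real => rfl
        | finite q =>
          obtain ⟨-, hq⟩ := hF
          have : (q : ZMod 2) = 1 := by
            rw [← Nat.cast_one, ZMod.natCast_eq_natCast_iff]
            exact Nat.odd_iff.1 (Nat.not_even_iff_odd.1 fun h => hq h.two_dvd)
          simp only [evenWeight, this, orderOf_one]
      simp [tauDeg, oddDeg, he]
    rw [hd, sqCoeff, if_pos rfl]
    exact bock_mem_gr
  · rw [sqCoeff, if_neg h]; exact zero_mem _

end Coeff

namespace DualE

theorem mul_mem_gr (hF : F.Admissible p) {d d' : ℤ × ℤ} {e f : DualE F p} (he : e ∈ gr d)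
    (hf : f ∈ gr d') : e * f ∈ gr (d + d') := by
  have hs := Coeff.sqCoeff_mem_gr hF
  obtain ⟨h0, h1, h2, h3⟩ := he
  obtain ⟨k0, k1, k2, k3⟩ := hf
  refine ⟨Coeff.mul_mem_gr h0 k0, ?_, ?_, ?_⟩
  · exact add_mem (Coeff.mul_mem_gr' (Coeff.sign_mem_gr h0) k1 (by abel))
      (Coeff.mul_mem_gr' h1 k0 (by abel))
  · exact add_mem (add_mem (Coeff.mul_mem_gr' (Coeff.sign_mem_gr h0) k2 (by abel))
      (Coeff.mul_mem_gr' h2 k0 (by abel)))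
      (Coeff.mul_mem_gr' hs (Coeff.mul_mem_gr (Coeff.sign_mem_gr h1) k1) (by abel))
  · exact sub_mem (add_mem (add_mem (Coeff.mul_mem_gr' h0 k3 (by abel))
      (Coeff.mul_mem_gr' h3 k0 (by abel)))
      (Coeff.mul_mem_gr' (Coeff.sign_mem_gr h1) k2 (by abel)))
      (Coeff.mul_mem_gr' (Coeff.sign_mem_gr h2) k1 (by abel))

theorem etaR_mem_gr {d : ℤ × ℤ} {m : Coeff F p} (hm : m ∈ Coeff.gr F p d) :
    (etaR m : DualE F p) ∈ gr d :=
  ⟨hm, zero_mem _, zero_mem _, zero_mem _⟩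

theorem one_mem_gr : (1 : DualE F p) ∈ gr 0 :=
  ⟨Coeff.one_mem_gr, zero_mem _, zero_mem _, zero_mem _⟩

theorem t₀_mem_gr : t₀ F p ∈ gr (tauDeg p 0) :=
  ⟨zero_mem _, by rw [sub_self]; exact Coeff.one_mem_gr, zero_mem _, zero_mem _⟩

theorem t₁_mem_gr : t₁ F p ∈ gr (tauDeg p 1) :=
  ⟨zero_mem _, zero_mem _, by rw [sub_self]; exact Coeff.one_mem_gr, zero_mem _⟩

theorem pow_mem_gr (hF : F.Admissible p) {d : ℤ × ℤ} {e : DualE F p} (he : e ∈ gr d) (n : ℕ) :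
    e ^ n ∈ gr (n • d) := by
  induction n with
  | zero => simpa using one_mem_gr
  | succ n ih => rw [pow_succ, succ_nsmul]; exact mul_mem_gr hF ih he

theorem etaL_mem_gr (hF : F.Admissible p) {d : ℤ × ℤ} {m : Coeff F p}
    (hm : m ∈ Coeff.gr F p d) : (etaL m : DualE F p) ∈ gr d := by
  induction hm using AddSubgroup.closure_induction with
  | zero => rw [map_zero]; exact zero_mem _
  | add x y _ _ hx hy => rw [map_add]; exact add_mem hx hy
  | neg x _ hx => rw [map_neg]; exact neg_mem hx
  | mem x hx =>
    obtain ⟨i, j, rfl, rfl⟩ := hx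
    rw [map_mul, map_pow, map_pow]
    refine mul_mem_gr hF (pow_mem_gr hF ?_ i) (pow_mem_gr hF ?_ j)
    · rw [etaL_oddGen]; exact etaR_mem_gr Coeff.oddGen_mem_gr
    · rw [etaL_evenGen']
      refine ⟨Coeff.evenGen_mem_gr, ?_, zero_mem _, zero_mem _⟩
      -- `η_L(y)` has the `τ₀`-coefficient `b`, so homogeneity means `|y| - |τ₀| = |a|`.
      have : evenDeg F p - tauDeg p 0 = oddDeg F p := by simp [evenDeg, tauDeg, oddDeg]
      rw [this]; exact Coeff.bock_mem_gr

end DualE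

/-! ### Homogeneous combinations of a family -/

open DualE SteenrodE LeftTensor

/-- The combinations of the family `v` with coefficients of `v i` in `K i`. -/
def gspan {ι M : Type} [AddCommGroup M] [Module (Coeff F p) M] (v : ι → M)
    (K : ι → AddSubgroup (Coeff F p)) : AddSubgroup M :=
  AddSubgroup.closure {x | ∃ i, ∃ m ∈ K i, x = m • v i}

variable (F p) in
/-- The combinations of the family `v` that are homogeneous of degree `d` when `v i` is given the
degree `deg i`. -/
def hspan {ι M : Type} [AddCommGroup M] [Module (Coeff F p) M] (v : ι → M) (deg : ι → ℤ × ℤ)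
    (d : ℤ × ℤ) : AddSubgroup M :=
  gspan v fun i => Coeff.gr F p (d - deg i)

section Span

variable {ι M : Type} [AddCommGroup M] [Module (Coeff F p) M] {v : ι → M}

theorem smul_mem_gspan {K : ι → AddSubgroup (Coeff F p)} (i : ι) {m : Coeff F p} (hm : m ∈ K i) :
    m • v i ∈ gspan v K := AddSubgroup.subset_closure ⟨i, m, hm, rfl⟩

theorem gspan_le {K : ι → AddSubgroup (Coeff F p)} {H : AddSubgroup M}
    (h : ∀ i, ∀ m ∈ K i, m • v i ∈ H) : gspan v K ≤ H := by
  refine (AddSubgroup.closure_le _).2 ?_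
  rintro _ ⟨i, m, hm, rfl⟩
  exact h i m hm

/-- Spanning statements are proved below for arbitrary coefficient groups `K`: taking every `K i` to
be `⊤` gives ordinary spanning, and taking graded pieces gives spanning in each bidegree. -/
theorem gspan_le_span (K : ι → AddSubgroup (Coeff F p)) :
    gspan v K ≤ (Submodule.span (Coeff F p) (Set.range v)).toAddSubgroup :=
  gspan_le fun i m _ => Submodule.smul_mem _ m (Submodule.subset_span ⟨i, rfl⟩)

variable {deg : ι → ℤ × ℤ}

theorem mem_hspan (i : ι) : v i ∈ hspan F p v deg (deg i) := by
  have := smul_mem_gspan (v := v) (K := fun j => Coeff.gr F p (deg i - deg j)) i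
    (m := 1) (by simpa using Coeff.one_mem_gr)
  rwa [one_smul] at this

theorem mem_hspan' {d : ℤ × ℤ} (i : ι) (h : deg i = d) : v i ∈ hspan F p v deg d := h ▸ mem_hspan i

theorem smul_mem_hspan {d e : ℤ × ℤ} {m : Coeff F p} (hm : m ∈ Coeff.gr F p e) {x : M}
    (hx : x ∈ hspan F p v deg d) : m • x ∈ hspan F p v deg (e + d) := by
  suffices h : hspan F p v deg d ≤
      (hspan F p v deg (e + d)).comap (DistribSMul.toAddMonoidHom M m) from
    AddSubgroup.mem_comap.1 (h hx)
  refine gspan_le fun i n hn => ?_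
  change m • n • v i ∈ hspan F p v deg (e + d)
  rw [← mul_smul]
  exact smul_mem_gspan i (Coeff.mul_mem_gr' hm hn (by abel))

theorem smul_mem_hspan' {d e c : ℤ × ℤ} {m : Coeff F p} (hm : m ∈ Coeff.gr F p e) {x : M}
    (hx : x ∈ hspan F p v deg d) (h : e + d = c) : m • x ∈ hspan F p v deg c := h ▸ smul_mem_hspan hm hx

theorem mem_hspan_basis [Fintype ι] (b : Module.Basis ι (Coeff F p) M) (d : ℤ × ℤ) (x : M) :
    x ∈ hspan F p b deg d ↔ ∀ i, b.repr x i ∈ Coeff.gr F p (d - deg i) := by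
  constructor
  · intro hx i
    suffices h : hspan F p b deg d ≤ (Coeff.gr F p (d - deg i)).comap
      (b.coord i).toAddMonoidHom from AddSubgroup.mem_comap.1 (h hx)
    refine gspan_le fun j m hm => ?_
    change b.coord i (m • b j) ∈ Coeff.gr F p (d - deg i)
    rw [map_smul, Module.Basis.coord_apply, Module.Basis.repr_self, smul_eq_mul]
    classical
    rw [Finsupp.single_apply]
    split_ifs with h
    · rwa [mul_one, ← h]
    · rw [mul_zero]; exact zero_mem _
  · intro h
    rw [← b.sum_repr x]
    exact sum_mem fun i _ => smul_mem_gspan i (h i)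

end Span

/-! ### The action of `E(1)` and homogeneous bases -/

namespace Comodule

/-- `1, τ₀, τ₁, τ₀ τ₁` is a basis of `E(1)^∨` over the right unit with dual basis `1, Q₀, Q₁, Q₀
Q₁`, so the coaction carries the same information as the operators `Q₀` and `Q₁`. -/
theorem coact_eq (N : Comodule F p) (x : N.carrier) : N.coact x =
    tmul 1 x + tmul (t₀ F p) (N.act (Q₀ F p) x) + tmul (t₁ F p) (N.act (Q₁ F p) x) +
      tmul (t₀ F p * t₁ F p) (N.act (Q₀ F p * Q₁ F p) x) := by
  conv_lhs => rw [LeftTensor.eq_sum (N.coact x), N.counit_coact]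
  rfl

/-- The coaction is linear through the left unit while functionals are linear through the right one.
In the twisted cases `E(1)` therefore does not act linearly over `𝕄_p`, and `η_L(m)` has to be
expanded. -/
theorem act_smul (N : Comodule F p) (θ : SteenrodE F p) (m : Coeff F p) (x : N.carrier) :
    N.act θ (m • x) = θ.toHom (etaL m) • x + θ.toHom (etaL m * t₀ F p) • N.act (Q₀ F p) x +
      θ.toHom (etaL m * t₁ F p) • N.act (Q₁ F p) x +
      θ.toHom (etaL m * (t₀ F p * t₁ F p)) • N.act (Q₀ F p * Q₁ F p) x := by
  rw [act_apply, map_smul, coact_eq, LeftTensor.smul_def]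
  simp only [smul_add, LeftTensor.smul_tmul, map_add, eval_tmul, mul_one]

theorem act_add (N : Comodule F p) (θ φ : SteenrodE F p) (x : N.carrier) :
    N.act (θ + φ) x = N.act θ x + N.act φ x := by
  simp only [act_apply]
  refine LeftTensor.hom_ext (f := LeftTensor.eval (θ + φ).toHom)
    (g := LeftTensor.eval θ.toHom + LeftTensor.eval φ.toHom) (fun e v => ?_) (N.coact x)
  simp only [AddMonoidHom.add_apply, eval_tmul, map_add, LinearMap.add_apply, add_smul]

theorem act_scalar (N : Comodule F p) (m : Coeff F p) (x : N.carrier) :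
    N.act (MulOpposite.unop (scalar m)) x = m • x := by
  rw [act_apply, coact_eq]
  simp [t₀, t₁]

theorem act_Q₀_Q₀ (N : Comodule F p) (x : N.carrier) :
    N.act (Q₀ F p) (N.act (Q₀ F p) x) = 0 := by
  rw [← act_mul, Q₀_mul_Q₀, act_apply]
  exact LeftTensor.hom_ext (g := 0) (fun e v => zero_smul _ _) _

theorem act_Q₁_Q₁ (N : Comodule F p) (x : N.carrier) :
    N.act (Q₁ F p) (N.act (Q₁ F p) x) = 0 := by
  rw [← act_mul, Q₁_mul_Q₁, act_apply]
  exact LeftTensor.hom_ext (g := 0) (fun e v => zero_smul _ _) _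

theorem act_Q₁_Q₀ (N : Comodule F p) (x : N.carrier) :
    N.act (Q₁ F p) (N.act (Q₀ F p) x) = N.act (Q₀ F p * Q₁ F p) x := (N.act_mul _ _ x).symm

theorem act_Q₀_Q₁ (N : Comodule F p) (x : N.carrier) :
    N.act (Q₀ F p) (N.act (Q₁ F p) x) = - N.act (Q₀ F p * Q₁ F p) x := by
  rw [← act_mul, Q₁_mul_Q₀, eq_neg_iff_add_eq_zero, ← act_add, neg_add_cancel, act_apply]
  exact LeftTensor.hom_ext (g := 0) (fun e v => zero_smul _ _) _

section Graded

variable {N : Comodule F p} {ι : Type} {v : ι → N.carrier} {deg : ι → ℤ × ℤ}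

/-- A functional `θ` that takes the coefficient of a homogeneous element of degree `c` acts with
degree `-c`. -/
theorem act_mem_hspan_aux (hF : F.Admissible p)
    (h0 : ∀ i, N.act (Q₀ F p) (v i) ∈ hspan F p v deg (deg i - tauDeg p 0))
    (h1 : ∀ i, N.act (Q₁ F p) (v i) ∈ hspan F p v deg (deg i - tauDeg p 1))
    (h2 : ∀ i, N.act (Q₀ F p * Q₁ F p) (v i) ∈
      hspan F p v deg (deg i - (tauDeg p 0 + tauDeg p 1)))
    (θ : SteenrodE F p) (c : ℤ × ℤ)
    (hθ : ∀ e, ∀ f : DualE F p, f ∈ DualE.gr e → θ.toHom f ∈ Coeff.gr F p (e - c))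
    (d : ℤ × ℤ) (x : N.carrier) (hx : x ∈ hspan F p v deg d) :
    N.act θ x ∈ hspan F p v deg (d - c) := by
  suffices h : hspan F p v deg d ≤ (hspan F p v deg (d - c)).comap (N.act θ) from
    AddSubgroup.mem_comap.1 (h hx)
  refine gspan_le fun i m hm => ?_
  have hL : (etaL m : DualE F p) ∈ DualE.gr (d - deg i) := etaL_mem_gr hF hm
  change N.act θ (m • v i) ∈ hspan F p v deg (d - c)
  rw [act_smul]
  refine add_mem (add_mem (add_mem ?_ ?_) ?_) ?_
  · exact smul_mem_hspan' (hθ _ _ hL) (mem_hspan i) (by abel)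
  · exact smul_mem_hspan' (hθ _ _ (mul_mem_gr hF hL t₀_mem_gr)) (h0 i) (by abel)
  · exact smul_mem_hspan' (hθ _ _ (mul_mem_gr hF hL t₁_mem_gr)) (h1 i) (by abel)
  · exact smul_mem_hspan' (hθ _ _ (mul_mem_gr hF hL (mul_mem_gr hF t₀_mem_gr t₁_mem_gr))) (h2 i)
      (by abel)

theorem act_Q₀_mem_hspan (hF : F.Admissible p)
    (h0 : ∀ i, N.act (Q₀ F p) (v i) ∈ hspan F p v deg (deg i - tauDeg p 0))
    (h1 : ∀ i, N.act (Q₁ F p) (v i) ∈ hspan F p v deg (deg i - tauDeg p 1))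
    (h2 : ∀ i, N.act (Q₀ F p * Q₁ F p) (v i) ∈
      hspan F p v deg (deg i - (tauDeg p 0 + tauDeg p 1)))
    (d : ℤ × ℤ) (x : N.carrier) (hx : x ∈ hspan F p v deg d) :
    N.act (Q₀ F p) x ∈ hspan F p v deg (d - tauDeg p 0) :=
  act_mem_hspan_aux hF h0 h1 h2 _ _ (fun _ _ hf => hf.2.1) d x hx

theorem act_Q₁_mem_hspan (hF : F.Admissible p)
    (h0 : ∀ i, N.act (Q₀ F p) (v i) ∈ hspan F p v deg (deg i - tauDeg p 0))
    (h1 : ∀ i, N.act (Q₁ F p) (v i) ∈ hspan F p v deg (deg i - tauDeg p 1))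
    (h2 : ∀ i, N.act (Q₀ F p * Q₁ F p) (v i) ∈
      hspan F p v deg (deg i - (tauDeg p 0 + tauDeg p 1)))
    (d : ℤ × ℤ) (x : N.carrier) (hx : x ∈ hspan F p v deg d) :
    N.act (Q₁ F p) x ∈ hspan F p v deg (d - tauDeg p 1) :=
  act_mem_hspan_aux hF h0 h1 h2 _ _ (fun _ _ hf => hf.2.2.1) d x hx

end Graded

/-- A basis of homogeneous elements of the comodule `N`, with `N` graded accordingly. -/
structure HomBasis (N : Comodule F p) (ι : Type) where
  basis : Module.Basis ι (Coeff F p) N.carrier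
  deg : ι → ℤ × ℤ
  mem_gr : ∀ d x, x ∈ N.gr d ↔ ∀ i, basis.repr x i ∈ Coeff.gr F p (d - deg i)

/-- Two comodules with homogeneous bases on which `Q₀` and `Q₁` act in the same way are
isomorphic. -/
theorem HomBasis.nonempty_iso {N P : Comodule F p} {ι : Type} (B : HomBasis N ι)
    (C : HomBasis P ι) (hdeg : B.deg = C.deg)
    (h0 : ∀ i, P.act (Q₀ F p) (C.basis i) =
      B.basis.equiv C.basis (Equiv.refl ι) (N.act (Q₀ F p) (B.basis i)))
    (h1 : ∀ i, P.act (Q₁ F p) (C.basis i) =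
      B.basis.equiv C.basis (Equiv.refl ι) (N.act (Q₁ F p) (B.basis i)))
    (h2 : ∀ i, P.act (Q₀ F p * Q₁ F p) (C.basis i) =
      B.basis.equiv C.basis (Equiv.refl ι) (N.act (Q₀ F p * Q₁ F p) (B.basis i))) :
    Nonempty (Iso N P) := by
  set T := B.basis.equiv C.basis (Equiv.refl ι) with hT
  have hT' : ∀ i, T (B.basis i) = C.basis i := fun i => by simp [hT]
  have hrepr : ∀ x i, C.basis.repr (T x) i = B.basis.repr x i := fun x i => by
    rw [hT, Module.Basis.equiv]; simp
  refine ⟨⟨T, fun d x => ?_, fun x => ?_⟩⟩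
  · simp only [B.mem_gr, C.mem_gr, hrepr, hdeg]
  -- Although `Q₀` and `Q₁` need not be `𝕄_p`-linear, coactions are linear for the left unit, so the
  -- two sides may be compared on a basis.
  · refine LinearMap.congr_fun (f := P.coact ∘ₗ T.toLinearMap)
      (g := LeftTensor.map T.toLinearMap ∘ₗ N.coact) (B.basis.ext fun i => ?_) x
    change P.coact (T (B.basis i)) = LeftTensor.map T.toLinearMap (N.coact (B.basis i))
    rw [hT', coact_eq, coact_eq, h0, h1, h2]
    simp only [map_add, map_tmul, LinearEquiv.coe_coe, hT']

/-- A linearly independent family that spans the comodule, also in the graded sense, is a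
homogeneous basis. -/
def HomBasis.mk' {N : Comodule F p} {ι : Type} [Fintype ι] (v : ι → N.carrier) (deg : ι → ℤ × ℤ)
    (hv : LinearIndependent (Coeff F p) v) (hs : ⊤ ≤ Submodule.span (Coeff F p) (Set.range v))
    (hg : ∀ d x, x ∈ N.gr d ↔ x ∈ hspan F p v deg d) : HomBasis N ι where
  basis := Module.Basis.mk hv hs
  deg := deg
  mem_gr d x := by
    rw [hg, ← mem_hspan_basis (Module.Basis.mk hv hs), Module.Basis.coe_mk]

theorem HomBasis.mk'_basis {N : Comodule F p} {ι : Type} [Fintype ι] (v : ι → N.carrier)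
    (deg : ι → ℤ × ℤ) (hv : LinearIndependent (Coeff F p) v)
    (hs : ⊤ ≤ Submodule.span (Coeff F p) (Set.range v))
    (hg : ∀ d x, x ∈ N.gr d ↔ x ∈ hspan F p v deg d) (i : ι) :
    (HomBasis.mk' v deg hv hs hg).basis i = v i := Module.Basis.mk_apply hv hs i

section Prod

variable {N P : Comodule F p} {ι κ : Type}

theorem act_prod (θ : SteenrodE F p) (x : (prod N P).carrier) :
    (prod N P).act θ x = (N.act θ x.1, P.act θ x.2) := by
  have h : ∀ a b, LeftTensor.eval θ.toHom
      (LeftTensor.map (LinearMap.inl (Coeff F p) N.carrier P.carrier) (N.coact a) +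
        LeftTensor.map (LinearMap.inr (Coeff F p) N.carrier P.carrier) (P.coact b)) =
      (N.act θ a, P.act θ b) := fun a b => by
    rw [map_add, LeftTensor.eval_map, LeftTensor.eval_map, LinearMap.inl_apply,
      LinearMap.inr_apply, Prod.mk_add_mk, add_zero, zero_add, act_apply, act_apply]
  exact h x.1 x.2

/-- The homogeneous basis of a direct sum of two comodules. -/
def HomBasis.prod (B : HomBasis N ι) (C : HomBasis P κ) :
    HomBasis (Comodule.prod N P) (ι ⊕ κ) where
  basis := Module.Basis.prod B.basis C.basis
  deg := Sum.elim B.deg C.deg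
  mem_gr d x := by
    change x.1 ∈ N.gr d ∧ x.2 ∈ P.gr d ↔ _
    rw [B.mem_gr, C.mem_gr, Sum.forall]
    exact Iff.rfl

theorem HomBasis.prod_basis_inl (B : HomBasis N ι) (C : HomBasis P κ) (i : ι) :
    (B.prod C).basis (Sum.inl i) = (B.basis i, 0) := by
  refine Prod.ext ?_ ?_
  · exact Module.Basis.prod_apply_inl_fst _ _ _
  · exact Module.Basis.prod_apply_inl_snd _ _ _

theorem HomBasis.prod_basis_inr (B : HomBasis N ι) (C : HomBasis P κ) (i : κ) :
    (B.prod C).basis (Sum.inr i) = (0, C.basis i) := by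
  refine Prod.ext ?_ ?_
  · exact Module.Basis.prod_apply_inr_fst _ _ _
  · exact Module.Basis.prod_apply_inr_snd _ _ _

end Prod

section DirectSum

variable {κ : Type} [Fintype κ] [DecidableEq κ] {N : κ → Comodule F p} {ι : Type}

theorem act_directSum (θ : SteenrodE F p) (x : (directSum N).carrier) :
    (directSum N).act θ x = fun j => (N j).act θ (x j) := by
  have h : ∀ y : ∀ i, (N i).carrier, LeftTensor.eval θ.toHom ((∑ i, LeftTensor.map
      (LinearMap.single (Coeff F p) (fun i => (N i).carrier) i) ∘ₗ
      (N i).coact ∘ₗ LinearMap.proj i) y) = fun j => (N j).act θ (y j) := fun y => by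
    simp only [LinearMap.sum_apply, LinearMap.comp_apply, map_sum, LeftTensor.eval_map]
    funext j
    rw [Finset.sum_apply, Finset.sum_eq_single j]
    · rw [LinearMap.single_apply, Pi.single_eq_same]; rfl
    · intro i _ h
      rw [LinearMap.single_apply, Pi.single_eq_of_ne h.symm]
    · simp
  exact h x

/-- The homogeneous basis of a finite direct sum of comodules. -/
def HomBasis.directSum (B : ∀ j, HomBasis (N j) ι) :
    HomBasis (Comodule.directSum N) (Σ _ : κ, ι) where
  basis := Pi.basis fun j => (B j).basis
  deg i := (B i.1).deg i.2
  mem_gr d x := by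
    change (∀ j ∈ Set.univ, x j ∈ (N j).gr d) ↔ _
    simp only [(B _).mem_gr, Sigma.forall, Set.mem_univ, true_imp_iff]
    exact Iff.rfl

theorem HomBasis.directSum_basis (B : ∀ j, HomBasis (N j) ι) (j : κ) (i : ι) :
    (HomBasis.directSum B).basis ⟨j, i⟩ = (Pi.single j ((B j).basis i) : ∀ j, (N j).carrier) :=
  Pi.basis_apply _ _

end DirectSum

/-- The homogeneous basis of a suspension. -/
def HomBasis.suspend {N : Comodule F p} {ι : Type} (B : HomBasis N ι) (c : ℤ × ℤ) :
    HomBasis (N.suspend c) ι where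
  basis := B.basis
  deg i := B.deg i + c
  mem_gr d x := by
    refine (B.mem_gr (d - c) x).trans (forall_congr' fun i => ?_)
    rw [sub_add_eq_sub_sub_swap]
    exact Iff.rfl

end Comodule

/-! ### Homogeneous bases of `E(1)^∨` and of `𝕄_p` -/

namespace DualE

/-- Elements of `E(1)^∨` in terms of the left unit. -/
theorem exists_eq_left_sum (e : DualE F p) : ∃ m m₀ m₁ m₂ : Coeff F p,
    e = etaL m * 1 + etaL m₀ * t₀ F p + etaL m₁ * t₁ F p + etaL m₂ * (t₀ F p * t₁ F p) ∧
    (F.Admissible p → ∀ d, e ∈ gr d → m ∈ Coeff.gr F p d ∧ m₀ ∈ Coeff.gr F p (d - tauDeg p 0) ∧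
      m₁ ∈ Coeff.gr F p (d - tauDeg p 1) ∧
      m₂ ∈ Coeff.gr F p (d - (tauDeg p 0 + tauDeg p 1))) := by
  -- The left unit has `1`-component `m`, so the components on `1, τ₀, τ₁, τ₀ τ₁` can be cleared in
  -- this order. The signs come from moving a coefficient past the odd elements `τ₀` and `τ₁`; `τ₀
  -- τ₁` is even.
  obtain ⟨f, hf⟩ : ∃ f, f = e - etaL e.c * 1 := ⟨_, rfl⟩
  obtain ⟨g, hg⟩ : ∃ g, g = f - etaL (sign F p f.c₀) * t₀ F p := ⟨_, rfl⟩
  obtain ⟨h, hh⟩ : ∃ h, h = g - etaL (sign F p g.c₁) * t₁ F p := ⟨_, rfl⟩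
  refine ⟨e.c, sign F p f.c₀, sign F p g.c₁, h.c₀₁, ?_, fun hF d he => ?_⟩
  · have h1 : h = etaL h.c₀₁ * (t₀ F p * t₁ F p) := by
      ext1
      · rw [hh, hg, hf]; simp [t₀, t₁]
      · rw [hh, hg]; simp [t₀, t₁]
      · rw [hh]; simp [t₀, t₁]
      · simp [t₀, t₁]
    rw [← h1, hh, hg, hf]
    abel
  · have hf' : f ∈ gr d := by
      rw [hf, mul_one]; exact sub_mem he (etaL_mem_gr hF he.1)
    have h0 := Coeff.sign_mem_gr hf'.2.1
    have hg' : g ∈ gr d := by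
      rw [hg]
      refine sub_mem hf' ?_
      have := mul_mem_gr hF (etaL_mem_gr hF h0) t₀_mem_gr
      rwa [sub_add_cancel] at this
    have h1 := Coeff.sign_mem_gr hg'.2.2.1
    have hh' : h ∈ gr d := by
      rw [hh]
      refine sub_mem hg' ?_
      have := mul_mem_gr hF (etaL_mem_gr hF h1) t₁_mem_gr
      rwa [sub_add_cancel] at this
    exact ⟨he.1, h0, h1, hh'.2.2.2⟩

/-- The same triangular elimination: once the earlier coefficients vanish, the next component is the
next coefficient up to the sign involution. -/
theorem left_sum_eq_zero {m m₀ m₁ m₂ : Coeff F p}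
    (h : etaL m * 1 + etaL m₀ * t₀ F p + etaL m₁ * t₁ F p + etaL m₂ * (t₀ F p * t₁ F p) = 0) :
    m = 0 ∧ m₀ = 0 ∧ m₁ = 0 ∧ m₂ = 0 := by
  have hm : m = 0 := by simpa [t₀, t₁] using congrArg DualE.c h
  subst hm
  rw [map_zero, zero_mul, zero_add] at h
  have hm : m₀ = 0 := by
    have := congrArg DualE.c₀ h
    simp [t₀, t₁] at this
    rw [← sign_sign m₀, this, map_zero]
  subst hm
  rw [map_zero, zero_mul, zero_add] at h
  have hm : m₁ = 0 := by
    have := congrArg DualE.c₁ h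
    simp [t₀, t₁] at this
    rw [← sign_sign m₁, this, map_zero]
  subst hm
  rw [map_zero, zero_mul, zero_add] at h
  exact ⟨rfl, rfl, rfl, by simpa [t₀, t₁] using congrArg DualE.c₀₁ h⟩

end DualE

namespace Comodule

variable (F p) in
/-- The elements of `E(1)^∨` that come from `τ₀ τ₁` under `1`, `Q₀`, `Q₁` and `Q₀ Q₁`. -/
def cofreeFam : Bool × Bool → DualELeft F p
  | (false, false) => DualELeft.of (t₀ F p * t₁ F p)
  | (true, false) => DualELeft.of (t₁ F p)
  | (false, true) => -DualELeft.of (t₀ F p)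
  | (true, true) => DualELeft.of 1

variable (p) in
/-- The degree that is lost under `Q₀ ^ s * Q₁ ^ t`. -/
def loss (s : Bool × Bool) : ℤ × ℤ :=
  (if s.1 then tauDeg p 0 else 0) + (if s.2 then tauDeg p 1 else 0)

variable (p) in
/-- The degrees of the members of `cofreeFam`. -/
def cofreeDeg (s : Bool × Bool) : ℤ × ℤ := tauDeg p 0 + tauDeg p 1 - loss p s

theorem left_sum_of (m m₀ m₁ m₂ : Coeff F p) :
    DualELeft.of (etaL m * 1 + etaL m₀ * t₀ F p + etaL m₁ * t₁ F p +
      etaL m₂ * (t₀ F p * t₁ F p)) = m • cofreeFam F p (true, true) +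
      (-m₀) • cofreeFam F p (false, true) + m₁ • cofreeFam F p (true, false) +
      m₂ • cofreeFam F p (false, false) := by
  have e : ∀ n (f : DualE F p), DualELeft.of (etaL n * f) = n • DualELeft.of f :=
    fun _ _ => rfl
  simp only [map_add, e, cofreeFam, smul_neg, neg_smul, neg_neg]

theorem linearIndependent_cofreeFam : LinearIndependent (Coeff F p) (cofreeFam F p) := by
  rw [Fintype.linearIndependent_iff]
  intro g hg
  rw [Fintype.sum_prod_type, Fintype.sum_bool, Fintype.sum_bool, Fintype.sum_bool] at hg
  have h := left_sum_eq_zero (DualELeft.of.injective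
    ((left_sum_of (g (true, true)) (-g (false, true)) (g (true, false))
      (g (false, false))).trans ?_ : _ = DualELeft.of 0))
  swap
  · rw [neg_neg, map_zero, ← hg]; abel
  rw [neg_eq_zero] at h
  rintro ⟨_ | _, _ | _⟩
  exacts [h.2.2.2, h.2.1, h.2.2.1, h.1]

theorem mem_gspan_cofreeFam {K : Bool × Bool → AddSubgroup (Coeff F p)} {m m₀ m₁ m₂ : Coeff F p}
    (h : m ∈ K (true, true)) (h₀ : m₀ ∈ K (false, true)) (h₁ : m₁ ∈ K (true, false))
    (h₂ : m₂ ∈ K (false, false)) :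
    DualELeft.of (etaL m * 1 + etaL m₀ * t₀ F p + etaL m₁ * t₁ F p +
      etaL m₂ * (t₀ F p * t₁ F p)) ∈ gspan (cofreeFam F p) K := by
  rw [left_sum_of]
  exact add_mem (add_mem (add_mem (smul_mem_gspan _ h) (smul_mem_gspan _ (neg_mem h₀)))
    (smul_mem_gspan _ h₁)) (smul_mem_gspan _ h₂)

theorem cofreeFam_mem_gr (hF : F.Admissible p) (s : Bool × Bool) :
    DualELeft.of.symm (cofreeFam F p s) ∈ DualE.gr (F := F) (p := p) (cofreeDeg p s) := by
  have h : ∀ {d e : ℤ × ℤ} {x : DualE F p}, x ∈ DualE.gr d → e = d → x ∈ DualE.gr e :=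
    fun h h' => h' ▸ h
  rcases s with ⟨_ | _, _ | _⟩
  · exact h (DualE.mul_mem_gr hF t₀_mem_gr t₁_mem_gr) (by simp [cofreeDeg, loss])
  · exact h (neg_mem t₀_mem_gr) (by simp [cofreeDeg, loss])
  · exact h t₁_mem_gr (by simp [cofreeDeg, loss])
  · exact h one_mem_gr (by simp [cofreeDeg, loss])

/-- The homogeneous basis of `E(1)^∨`. -/
def cofreeBasis (hF : F.Admissible p) : HomBasis (cofree F p) (Bool × Bool) :=
  HomBasis.mk' (N := cofree F p) (cofreeFam F p) (cofreeDeg p) linearIndependent_cofreeFam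
    (fun x _ => by
      obtain ⟨m, m₀, m₁, m₂, h, -⟩ := exists_eq_left_sum (DualELeft.of.symm x)
      have := mem_gspan_cofreeFam (K := fun _ => ⊤) (AddSubgroup.mem_top m)
        (AddSubgroup.mem_top m₀) (AddSubgroup.mem_top m₁) (AddSubgroup.mem_top m₂)
      rw [← h] at this
      exact gspan_le_span _ this)
    (fun d x => by
      constructor
      · rintro ⟨e, he, rfl⟩
        obtain ⟨m, m₀, m₁, m₂, h, h'⟩ := exists_eq_left_sum e
        obtain ⟨k, k₀, k₁, k₂⟩ := h' hF d he
        have := mem_gspan_cofreeFam (K := fun s => Coeff.gr F p (d - cofreeDeg p s))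
          (m := m) (m₀ := m₀) (m₁ := m₁) (m₂ := m₂) (by simpa [cofreeDeg, loss] using k)
          (by simpa [cofreeDeg, loss] using k₀) (by simpa [cofreeDeg, loss] using k₁)
          (by simpa [cofreeDeg, loss] using k₂)
        rw [← h] at this
        exact this
      · suffices h : hspan F p (cofreeFam F p) (cofreeDeg p) d ≤ (cofree F p).gr d from fun hx =>
          h hx
        refine gspan_le fun s m hm => ?_
        refine ⟨etaL m * DualELeft.of.symm (cofreeFam F p s), ?_, rfl⟩
        have := mul_mem_gr hF (etaL_mem_gr hF hm) (cofreeFam_mem_gr hF s)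
        rwa [sub_add_cancel] at this)

theorem cofreeBasis_basis (hF : F.Admissible p) (s : Bool × Bool) :
    (cofreeBasis hF).basis s = cofreeFam F p s := HomBasis.mk'_basis _ _ _ _ _ _

variable (F p) in
/-- The homogeneous basis of `𝕄_p`. -/
def unitBasis : HomBasis (unit F p) (Fin 0 ⊕ Fin 1) where
  -- `Fin 0 ⊕ Fin 1` is the index set of a flash with no generators and one lower cell, so `L_p(0)`
  -- fits the same pattern as the other flashes.
  basis := (Module.Basis.singleton (Fin 1) (Coeff F p)).reindex (Equiv.emptySum (Fin 0) (Fin 1)).symm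
  deg _ := 0
  mem_gr d x := by
    change x ∈ Coeff.gr F p d ↔ _
    have key : ∀ (y : Coeff F p) (i : Fin 1), ((Module.Basis.singleton (Fin 1)
        (Coeff F p)).reindex (Equiv.emptySum (Fin 0) (Fin 1)).symm).repr y (Sum.inr i) = y :=
      fun y i => by simp
    refine ⟨fun h => ?_, fun h => ?_⟩
    · rintro (i | i)
      · exact i.elim0
      · rw [sub_zero]
        exact (congrArg (· ∈ Coeff.gr F p d) (key x i)).mpr h
    · have := h (Sum.inr 0)
      rw [sub_zero] at this
      exact (congrArg (· ∈ Coeff.gr F p d) (key x 0)).mp this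

theorem unitBasis_basis (i : Fin 1) : (unitBasis F p).basis (Sum.inr i) = (1 : Coeff F p) := by
  change ((Module.Basis.singleton (Fin 1) (Coeff F p)).reindex
    (Equiv.emptySum (Fin 0) (Fin 1)).symm) (Sum.inr i) = 1
  simp

theorem act_unit_Q (x : Coeff F p) (h : x = 1) : (unit F p).act (Q₀ F p) x = 0 ∧
    (unit F p).act (Q₁ F p) x = 0 := by
  subst h
  constructor
  · change LeftTensor.eval _ ((1 : Coeff F p) • tmul (1 : DualE F p) (1 : Coeff F p)) = 0
    rw [one_smul, eval_tmul, toHom_Q₀, one_c₀, zero_smul]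
  · change LeftTensor.eval _ ((1 : Coeff F p) • tmul (1 : DualE F p) (1 : Coeff F p)) = 0
    rw [one_smul, eval_tmul, toHom_Q₁, one_c₁, zero_smul]

end Comodule

/-! ### The operators `Q₀` and `Q₁` on monomials -/

/-- The right action of `E(1)` on `A // E(0)^∨`. -/
def hzAct (θ : SteenrodE F p) : HZ F p →+ HZ F p :=
  (LeftTensor.eval θ.toHom).comp (hzCoact F p).toAddMonoidHom

theorem hzAct_apply (θ : SteenrodE F p) (x : HZ F p) :
    hzAct θ x = LeftTensor.eval θ.toHom (hzCoact F p x) := rfl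

/-- As `τ_{j+1}` is the leftmost factor, the coaction of the monomial is `α(τ_{j+1})` times that of
the rest. The term with `r` in `Q₁` is the product of the `τ₀`-parts of the two factors, by `τ₀ ^ 2
= r τ₁`. -/
theorem act_hz_insert (a : ℕ →₀ ℕ) (S : Finset ℕ) (j : ℕ) (hj : ∀ i ∈ S, j < i) :
    hzAct (Q₀ F p) (Finsupp.single (a, insert j S) 1) =
      -tauMul F p j (hzAct (Q₀ F p) (Finsupp.single (a, S) 1)) +
        xiMul F p (Finsupp.single j 1) (Finsupp.single (a, S) 1) ∧
    hzAct (Q₁ F p) (Finsupp.single (a, insert j S) 1) =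
      -tauMul F p j (hzAct (Q₁ F p) (Finsupp.single (a, S) 1)) +
        xiMul F p (xiPrevPow p j) (Finsupp.single (a, S) 1) +
        sqCoeff F p • xiMul F p (Finsupp.single j 1)
          (hzAct (Q₀ F p) (Finsupp.single (a, S) 1)) := by
  have h1 : hzCoact F p (Finsupp.single (a, S) 1) = coactSum (Finsupp.single (a, S) 1)
      (hzAct (Q₀ F p) (Finsupp.single (a, S) 1))
      (hzAct (Q₁ F p) (Finsupp.single (a, S) 1))
      (hzAct (Q₀ F p * Q₁ F p) (Finsupp.single (a, S) 1)) :=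
    (hz F p).coact_eq _
  have h2 : hzCoact F p (Finsupp.single (a, insert j S) 1) =
      tauCoact j (hzCoact F p (Finsupp.single (a, S) 1)) := by
    rw [hzCoact_single, hzCoact_single, monoCoact_insert _ _ _ hj]
  rw [h1, tauCoact_coactSum] at h2
  constructor
  · refine (congrArg (LeftTensor.eval (Q₀ F p).toHom) h2).trans ?_
    rw [eval_coactSum]
    simp [t₀, t₁]
  · refine (congrArg (LeftTensor.eval (Q₁ F p).toHom) h2).trans ?_
    rw [eval_coactSum]
    simp [t₀, t₁]

theorem tauMul_single_one (j : ℕ) (μ : MonoIndex) (hj : ∀ i ∈ μ.2, j < i) :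
    tauMul F p j (Finsupp.single μ 1) = Finsupp.single (μ.1, insert j μ.2) 1 := by
  rw [tauMul_single, map_one, one_smul, tauMulMono_of_lt μ j hj]

/-- The sign of removing the factor `τ_{j+1}`. -/
def removalSign (S : Finset ℕ) (j : ℕ) : ℤ := (-1) ^ (S.filter (· < j)).card

theorem removalSign_insert_self (S : Finset ℕ) (j : ℕ) (hj : ∀ i ∈ S, j < i) :
    removalSign (insert j S) j = 1 := by
  rw [removalSign, Finset.filter_eq_empty_iff.2, Finset.card_empty, pow_zero]
  intro i hi
  rcases Finset.mem_insert.1 hi with rfl | hi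
  · exact lt_irrefl _
  · exact (hj i hi).le.not_gt

theorem removalSign_insert (S : Finset ℕ) (i j : ℕ) (hj : ∀ i ∈ S, j < i) (hi : i ∈ S) :
    removalSign (insert j S) i = -removalSign S i := by
  rw [removalSign, removalSign, Finset.filter_insert, if_pos (hj i hi),
    Finset.card_insert_of_notMem, pow_succ, mul_neg_one]
  exact fun h => lt_irrefl _ (hj j (Finset.mem_filter.1 h).1)

/-- The recursion of a Koszul differential: a new first factor contributes its own removal and
changes the sign of all the others. -/
theorem sum_removal_insert {M : Type} [AddCommGroup M] (S : Finset ℕ) (j : ℕ)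
    (hj : ∀ i ∈ S, j < i) (f : ℕ → Finset ℕ → M) :
    ∑ i ∈ insert j S, removalSign (insert j S) i • f i ((insert j S).erase i) =
      f j S - ∑ i ∈ S, removalSign S i • f i (insert j (S.erase i)) := by
  have h : j ∉ S := fun h => lt_irrefl _ (hj j h)
  rw [Finset.sum_insert h, removalSign_insert_self S j hj, Finset.erase_insert h, one_smul,
    sub_eq_add_neg, ← Finset.sum_neg_distrib]
  congr 1
  refine Finset.sum_congr rfl fun i hi => ?_
  rw [removalSign_insert S i j hj hi, neg_smul, Finset.erase_insert_of_ne (hj i hi).ne]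

theorem act_Q₀_hz_single (a : ℕ →₀ ℕ) (S : Finset ℕ) :
    hzAct (Q₀ F p) (Finsupp.single (a, S) 1) =
      ∑ j ∈ S, removalSign S j • (Finsupp.single (a + Finsupp.single j 1, S.erase j) 1 : HZ F p) := by
  induction S using Finset.induction_on_min with
  | empty =>
    rw [Finset.sum_empty, hzAct_apply, hzCoact_single, monoCoact_empty]
    simp
  | insert j S hj ih =>
    rw [(act_hz_insert a S j hj).1, ih, sum_removal_insert S j hj
      (fun i T => (Finsupp.single (a + Finsupp.single i 1, T) 1 : HZ F p)), map_sum, xiMul_single,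
      sub_eq_add_neg, add_comm]
    congr 2
    refine Finset.sum_congr rfl fun i _ => ?_
    rw [map_zsmul, tauMul_single_one]
    exact fun l hl => hj l (Finset.mem_of_mem_erase hl)

/-- `Q₁` fails to be a derivation by `r` times the terms in which `Q₀` hits two different factors.
Only the monomials that occur in this error matter later, so its coefficients are not recorded. -/
theorem act_Q₁_hz_single (a : ℕ →₀ ℕ) (S : Finset ℕ) :
    ∃ u ∈ AddSubgroup.closure {x : HZ F p | ∃ i ∈ S, ∃ j ∈ S, i ≠ j ∧
      x = Finsupp.single (a + Finsupp.single i 1 + Finsupp.single j 1, (S.erase i).erase j) 1},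
    hzAct (Q₁ F p) (Finsupp.single (a, S) 1) =
      ∑ j ∈ S, removalSign S j • (Finsupp.single (a + xiPrevPow p j, S.erase j) 1 : HZ F p) +
        sqCoeff F p • u := by
  induction S using Finset.induction_on_min with
  | empty =>
    refine ⟨0, zero_mem _, ?_⟩
    rw [Finset.sum_empty, hzAct_apply, hzCoact_single, monoCoact_empty]
    simp
  | insert j S hj ih =>
    obtain ⟨u, hu, h⟩ := ih
    have hjS : j ∉ S := fun h => lt_irrefl _ (hj j h)
    refine ⟨tauMul F p j u + xiMul F p (Finsupp.single j 1)
      (hzAct (Q₀ F p) (Finsupp.single (a, S) 1)), add_mem ?_ ?_, ?_⟩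
    · refine AddSubgroup.mem_comap.1 ((AddSubgroup.closure_le (AddSubgroup.comap (tauMul F p j) _)).2 ?_ hu)
      rintro _ ⟨i, hi, l, hl, hil, rfl⟩
      refine AddSubgroup.subset_closure ⟨i, Finset.mem_insert_of_mem hi, l,
        Finset.mem_insert_of_mem hl, hil, ?_⟩
      rw [tauMul_single_one, Finset.erase_insert_of_ne (hj i hi).ne,
        Finset.erase_insert_of_ne (hj l hl).ne]
      exact fun l hl => hj l (Finset.mem_of_mem_erase (Finset.mem_of_mem_erase hl))
    · rw [act_Q₀_hz_single, map_sum]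
      refine sum_mem fun i hi => ?_
      rw [map_zsmul, xiMul_single]
      refine zsmul_mem ?_ _
      refine AddSubgroup.subset_closure ⟨i, Finset.mem_insert_of_mem hi, j,
        Finset.mem_insert_self _ _, (hj i hi).ne', ?_⟩
      rw [Finset.erase_insert_of_ne (hj i hi).ne, Finset.erase_insert]
      exact fun h => hjS (Finset.mem_of_mem_erase h)
    · rw [(act_hz_insert a S j hj).2, h, sum_removal_insert S j hj
        (fun i T => (Finsupp.single (a + xiPrevPow p i, T) 1 : HZ F p)), map_add, map_sum,
        xiMul_single, tauMul_smul, sign_sqCoeff, smul_add, neg_add, ← neg_smul, neg_sqCoeff]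
      have e : ∑ i ∈ S, removalSign S i •
          (Finsupp.single (a + xiPrevPow p i, insert j (S.erase i)) 1 : HZ F p) =
          ∑ i ∈ S, tauMul F p j (removalSign S i •
            Finsupp.single (a + xiPrevPow p i, S.erase i) 1) := by
        refine Finset.sum_congr rfl fun i _ => ?_
        rw [map_zsmul, tauMul_single_one]
        exact fun l hl => hj l (Finset.mem_of_mem_erase hl)
      rw [e]
      abel

/-! ### Homogenization by `ξ_0` -/

/-- Forget the exponent of `ξ_0 = 1`. -/
def dehom (A : ℕ →₀ ℕ) : ℕ →₀ ℕ := A.comapDomain Nat.succ Nat.succ_injective.injOn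

theorem dehom_apply (A : ℕ →₀ ℕ) (n : ℕ) : dehom A n = A (n + 1) := rfl

theorem dehom_add (A B : ℕ →₀ ℕ) : dehom (A + B) = dehom A + dehom B := by
  ext n; rfl

theorem dehom_single_succ (n a : ℕ) : dehom (Finsupp.single (n + 1) a) = Finsupp.single n a := by
  ext i; simp [dehom_apply, Finsupp.single_apply]

/-- With `ξ_0` admitted, `τ_1 Q₁ = 1` reads `τ_1 Q₁ = ξ_0 ^ p` and is no longer a special case;
moreover `Q₁` then preserves the weight. -/
theorem dehom_single_prime (n : ℕ) : dehom (Finsupp.single n p) = xiPrevPow p n := by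
  cases n with
  | zero => ext i; simp [dehom_apply, xiPrevPow]
  | succ n => exact dehom_single_succ n p

variable (F p) in
/-- The monomial `∏ ξ_n ^ A(n) · ∏_{n ∈ S} τ_{n+1}`, where `ξ_0 = 1`. -/
def hmon (A : ℕ →₀ ℕ) (S : Finset ℕ) : HZ F p := Finsupp.single (dehom A, S) 1

variable (p) in
/-- The weight of `∏ ξ_n ^ A(n) · ∏_{n ∈ S} τ_{n+1}`, where `ξ_0` has weight `1`. -/
def hweight (A : ℕ →₀ ℕ) (S : Finset ℕ) : ℕ := (A.sum fun n a => a * p ^ n) + ∑ n ∈ S, p ^ (n + 1)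

variable (p) in
/-- The degree of `∏ ξ_n ^ A(n) · ∏_{n ∈ S} τ_{n+1}`, where `ξ_0` has degree `0`. -/
def hdeg (A : ℕ →₀ ℕ) (S : Finset ℕ) : ℤ × ℤ := monoDeg p (dehom A, S)

theorem hweight_add (A B : ℕ →₀ ℕ) (S : Finset ℕ) :
    hweight p (A + B) S = hweight p A S + B.sum fun n a => a * p ^ n := by
  simp only [hweight]
  rw [Finsupp.sum_add_index' (by simp) (by intros; ring)]
  ring

theorem hweight_erase (A : ℕ →₀ ℕ) {S : Finset ℕ} {n : ℕ} (hn : n ∈ S) :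
    hweight p A (S.erase n) + p ^ (n + 1) = hweight p A S := by
  simp only [hweight]
  rw [← Finset.sum_erase_add S _ hn]; ring

/-- The exponent of `ξ_0` is the amount by which the weight falls short of the total. Monomials of
weight at most `k` thus correspond to homogenized ones of weight `k`. -/
theorem monoWeight_dehom (A : ℕ →₀ ℕ) (S : Finset ℕ) :
    monoWeight p (dehom A, S) + A 0 = hweight p A S := by
  have h : ((dehom A).sum fun n a => a * p ^ (n + 1)) + A 0 = A.sum fun n a => a * p ^ n := by
    induction A using Finsupp.induction_linear with
    | zero => simp [dehom]
    | add A B hA hB =>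
      rw [dehom_add, Finsupp.sum_add_index' (by simp) (by intros; ring),
        Finsupp.sum_add_index' (by simp) (by intros; ring), ← hA, ← hB, Finsupp.add_apply]
      ring
    | single n a =>
      cases n with
      | zero =>
        have : dehom (Finsupp.single 0 a) = 0 := by ext i; simp [dehom_apply]
        simp [this]
      | succ n => rw [dehom_single_succ]; simp
  simp only [monoWeight, hweight, ← h]
  ring

theorem monoDeg_add (a b : ℕ →₀ ℕ) (S : Finset ℕ) :
    monoDeg p (a + b, S) = monoDeg p (a, S) + b.sum fun n c => c • xiDeg p (n + 1) := by
  simp only [monoDeg]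
  rw [Finsupp.sum_add_index' (by simp) (by intros; rw [add_smul])]
  abel

theorem monoDeg_erase (a : ℕ →₀ ℕ) {S : Finset ℕ} {n : ℕ} (hn : n ∈ S) :
    monoDeg p (a, S.erase n) = monoDeg p (a, S) - tauDeg p (n + 1) := by
  simp only [monoDeg]
  rw [← Finset.sum_erase_add S _ hn]; abel

theorem xiDeg_eq (n : ℕ) : xiDeg p n = tauDeg p n - tauDeg p 0 := by
  simp [xiDeg, tauDeg]; ring

theorem hdeg_remove₀ (A : ℕ →₀ ℕ) {S : Finset ℕ} {n : ℕ} (hn : n ∈ S) :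
    hdeg p (A + Finsupp.single (n + 1) 1) (S.erase n) = hdeg p A S - tauDeg p 0 := by
  rw [hdeg, dehom_add, dehom_single_succ, monoDeg_add, monoDeg_erase _ hn, hdeg,
    Finsupp.sum_single_index (by simp), one_smul, xiDeg_eq]
  abel

theorem hdeg_remove₁ (A : ℕ →₀ ℕ) {S : Finset ℕ} {n : ℕ} (hn : n ∈ S) :
    hdeg p (A + Finsupp.single n p) (S.erase n) = hdeg p A S - tauDeg p 1 := by
  rw [hdeg, dehom_add, dehom_single_prime, monoDeg_add, monoDeg_erase _ hn, hdeg]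
  cases n with
  | zero => simp [xiPrevPow]
  | succ n =>
    rw [xiPrevPow, Finsupp.sum_single_index (by simp), sub_add]
    congr 1
    ext
    · simp [xiDeg, tauDeg]; ring
    · simp [xiDeg, tauDeg]; ring

theorem act_Q₀_hmon (A : ℕ →₀ ℕ) (S : Finset ℕ) :
    hzAct (Q₀ F p) (hmon F p A S) =
      ∑ j ∈ S, removalSign S j • hmon F p (A + Finsupp.single (j + 1) 1) (S.erase j) := by
  refine (act_Q₀_hz_single _ _).trans (Finset.sum_congr rfl fun j _ => ?_)
  rw [hmon, dehom_add, dehom_single_succ]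

theorem act_Q₁_hmon (A : ℕ →₀ ℕ) (S : Finset ℕ) :
    ∃ u ∈ AddSubgroup.closure {x : HZ F p | ∃ i ∈ S, ∃ j ∈ S, i ≠ j ∧
      x = hmon F p (A + Finsupp.single (i + 1) 1 + Finsupp.single (j + 1) 1)
        ((S.erase i).erase j)},
    hzAct (Q₁ F p) (hmon F p A S) =
      ∑ j ∈ S, removalSign S j • hmon F p (A + Finsupp.single j p) (S.erase j) +
        sqCoeff F p • u := by
  have h := act_Q₁_hz_single (F := F) (p := p) (dehom A) S
  simp only [hmon, dehom_add, dehom_single_succ, dehom_single_prime]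
  exact h

theorem hweight_remove₀ (A : ℕ →₀ ℕ) {S : Finset ℕ} {n : ℕ} (hn : n ∈ S) :
    hweight p (A + Finsupp.single (n + 1) 1) (S.erase n) = hweight p A S := by
  rw [hweight_add, Finsupp.sum_single_index (by simp), one_mul, hweight_erase A hn]

theorem hweight_remove₁ (A : ℕ →₀ ℕ) {S : Finset ℕ} {n : ℕ} (hn : n ∈ S) :
    hweight p (A + Finsupp.single n p) (S.erase n) = hweight p A S := by
  rw [hweight_add, Finsupp.sum_single_index (by simp), ← pow_succ', hweight_erase A hn]

/-- The number of factors of a monomial, with `ξ_0` included. -/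
def hsize (A : ℕ →₀ ℕ) (S : Finset ℕ) : ℕ := A.degree + S.card

/-- Trading `τ_{n+1}` for `ξ_{n+1}` (`c = 1`) keeps the number of factors, and trading it for `ξ_n ^
p` (`c = p`) raises it by `p - 1`. Hence the error terms of `Q₁` have fewer factors than its main
terms. -/
theorem hsize_remove (A : ℕ →₀ ℕ) {S : Finset ℕ} {n : ℕ} (hn : n ∈ S) (i c : ℕ) :
    hsize (A + Finsupp.single i c) (S.erase n) + 1 = hsize A S + c := by
  rw [hsize, hsize, map_add, Finsupp.degree_single, ← Finset.card_erase_add_one hn]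
  ring

/-! ### Top and bottom indices, and the spanning argument -/

/-- All factors `ξ_n` have `n ≤ N + 1`, and all factors `τ_n` have `n ≤ N + 1`. -/
def TopLE (A : ℕ →₀ ℕ) (S : Finset ℕ) (N : ℕ) : Prop :=
  (∀ n, N + 1 < n → A n = 0) ∧ ∀ n ∈ S, n ≤ N

variable (p) in
/-- `j` is the least index for which the monomial is divisible by `ξ_j ^ p` or by `τ_{j+1}`. -/
def IsBot (A : ℕ →₀ ℕ) (S : Finset ℕ) (j : ℕ) : Prop :=
  (p ≤ A j ∨ j ∈ S) ∧ ∀ n < j, A n < p ∧ n ∉ S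

variable (p) in
/-- The monomials that generate the free part. -/
def IsFreeGen (A : ℕ →₀ ℕ) (S : Finset ℕ) : Prop :=
  ∃ N j, TopLE A S N ∧ IsBot p A S j ∧ j < N ∧ N ∈ S ∧ j ∈ S

theorem removalSign_smul_mem {M : Type} [AddCommGroup M] {H : AddSubgroup M} {S : Finset ℕ} {n : ℕ}
    {x : M} (h : removalSign S n • x ∈ H) : x ∈ H := by
  rcases neg_one_pow_eq_or ℤ (S.filter (· < n)).card with h' | h' <;>
    rw [removalSign, h'] at h
  · rwa [one_smul] at h
  · rwa [neg_smul, one_smul, neg_mem_iff] at h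

theorem mem_of_sum_removal_mem {M : Type} [AddCommGroup M] {H : AddSubgroup M} {S : Finset ℕ}
    {n : ℕ} (hn : n ∈ S) {f : ℕ → M} (h : ∑ i ∈ S, removalSign S i • f i ∈ H)
    (hf : ∀ i ∈ S, i ≠ n → f i ∈ H) : f n ∈ H := by
  rw [← Finset.add_sum_erase S _ hn] at h
  refine removalSign_smul_mem ((AddSubgroup.add_mem_cancel_right H ?_).1 h)
  exact sum_mem fun i hi =>
    zsmul_mem (hf i (Finset.mem_of_mem_erase hi) (Finset.ne_of_mem_erase hi)) _

section Spanning

variable {H : ℤ × ℤ → AddSubgroup (HZ F p)} {k : ℕ}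

/-- The formula for `Q₀` is solved for one of its terms, whose coefficient is a sign. -/
theorem hmon_remove₀_mem (h0 : ∀ d, ∀ x ∈ H d, hzAct (Q₀ F p) x ∈ H (d - tauDeg p 0))
    {A : ℕ →₀ ℕ} {S : Finset ℕ} {n : ℕ} (hn : n ∈ S) (hA : hmon F p A S ∈ H (hdeg p A S))
    (h : ∀ i ∈ S, i ≠ n → hmon F p (A + Finsupp.single (i + 1) 1) (S.erase i) ∈
      H (hdeg p (A + Finsupp.single (i + 1) 1) (S.erase i))) :
    hmon F p (A + Finsupp.single (n + 1) 1) (S.erase n) ∈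
      H (hdeg p (A + Finsupp.single (n + 1) 1) (S.erase n)) := by
  have := h0 _ _ hA
  rw [act_Q₀_hmon] at this
  rw [hdeg_remove₀ A hn]
  refine mem_of_sum_removal_mem hn
    (f := fun i => hmon F p (A + Finsupp.single (i + 1) 1) (S.erase i)) this fun i hi hin => ?_
  rw [← hdeg_remove₀ A hi]
  exact h i hi hin

/-- The formula for `Q₁` is solved for one of its main terms; `hu` disposes of the error, whose
coefficient `r` makes up for the difference of the degrees. -/
theorem hmon_remove₁_mem (hF : F.Admissible p)
    (hs : ∀ d e, ∀ m ∈ Coeff.gr F p e, ∀ x ∈ H d, m • x ∈ H (e + d))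
    (h1 : ∀ d, ∀ x ∈ H d, hzAct (Q₁ F p) x ∈ H (d - tauDeg p 1))
    {A : ℕ →₀ ℕ} {S : Finset ℕ} {n : ℕ} (hn : n ∈ S) (hA : hmon F p A S ∈ H (hdeg p A S))
    (h : ∀ i ∈ S, i ≠ n → hmon F p (A + Finsupp.single i p) (S.erase i) ∈
      H (hdeg p (A + Finsupp.single i p) (S.erase i)))
    (hu : ∀ i ∈ S, ∀ j ∈ S.erase i,
      hmon F p (A + Finsupp.single (i + 1) 1 + Finsupp.single (j + 1) 1) ((S.erase i).erase j) ∈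
      H (hdeg p (A + Finsupp.single (i + 1) 1 + Finsupp.single (j + 1) 1)
        ((S.erase i).erase j))) :
    hmon F p (A + Finsupp.single n p) (S.erase n) ∈
      H (hdeg p (A + Finsupp.single n p) (S.erase n)) := by
  obtain ⟨u, hu', he⟩ := act_Q₁_hmon (F := F) (p := p) A S
  have hu'' : u ∈ H (hdeg p A S - tauDeg p 0 - tauDeg p 0) := by
    refine (AddSubgroup.closure_le _).2 ?_ hu'
    rintro _ ⟨i, hi, j, hj, hij, rfl⟩
    have hj' : j ∈ S.erase i := Finset.mem_erase.2 ⟨hij.symm, hj⟩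
    have := hu i hi j hj'
    rwa [hdeg_remove₀ _ hj', hdeg_remove₀ _ hi] at this
  have hr := hs _ _ _ (Coeff.sqCoeff_mem_gr hF) _ hu''
  rw [show tauDeg p 0 + tauDeg p 0 - tauDeg p 1 + (hdeg p A S - tauDeg p 0 - tauDeg p 0) =
    hdeg p A S - tauDeg p 1 by abel] at hr
  have := h1 _ _ hA
  rw [he, AddSubgroup.add_mem_cancel_right _ hr] at this
  rw [hdeg_remove₁ A hn]
  refine mem_of_sum_removal_mem hn
    (f := fun i => hmon F p (A + Finsupp.single i p) (S.erase i)) this fun i hi hin => ?_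
  rw [← hdeg_remove₁ A hi]
  exact h i hi hin

/-- A monomial in which the top index occurs in a factor `ξ` but not in a factor `τ` is obtained
by applying `Q₀`. -/
theorem hmon_mem_of_top (h0 : ∀ d, ∀ x ∈ H d, hzAct (Q₀ F p) x ∈ H (d - tauDeg p 0))
    {s N c : ℕ}
    (ih : ∀ A S, hweight p A S = k → hsize A S = s → TopLE A S N → A (N + 1) ≤ c →
      hmon F p A S ∈ H (hdeg p A S))
    {A : ℕ →₀ ℕ} {S : Finset ℕ} (hw : hweight p A S = k) (hsz : hsize A S = s)
    (ht : TopLE A S N) (hN : N ∉ S) (hA : A (N + 1) = c + 1) :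
    hmon F p A S ∈ H (hdeg p A S) := by
  -- One factor `ξ_{N+1}` is turned back into `τ_{N+1}`; the given monomial is then a term of `Q₀`
  -- on the result.
  obtain ⟨B, rfl⟩ : ∃ B, A = B + Finsupp.single (N + 1) 1 :=
    ⟨A - Finsupp.single (N + 1) 1, (tsub_add_cancel_of_le (by simp [hA])).symm⟩
  obtain ⟨T, hT, rfl⟩ : ∃ T, N ∈ T ∧ S = T.erase N :=
    ⟨insert N S, Finset.mem_insert_self _ _, (Finset.erase_insert hN).symm⟩
  have hB : B (N + 1) = c := by simpa using hA
  have hBt : TopLE B T N := by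
    refine ⟨fun n hn => ?_, fun n hn => ?_⟩
    · have := ht.1 n hn
      simp only [Finsupp.add_apply] at this
      omega
    · rcases eq_or_ne n N with rfl | h
      · exact le_rfl
      · exact ht.2 n (Finset.mem_erase.2 ⟨h, hn⟩)
  have hBw : hweight p B T = k := by rw [← hw, hweight_remove₀ B hT]
  have hBs : hsize B T = s := by have := hsize_remove B hT (N + 1) 1; omega
  -- The other terms gain `ξ_{i+1}` with `i < N`, so `ξ_{N+1}` keeps the exponent `c`, as it has in
  -- the source, and `ih` applies to all of them.
  refine hmon_remove₀_mem h0 hT (ih B T hBw hBs hBt hB.le) fun i hi hiN => ?_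
  have hi' : i < N := lt_of_le_of_ne (hBt.2 i hi) hiN
  refine ih _ _ ?_ ?_ ⟨fun n hn => ?_, fun n hn => hBt.2 n (Finset.mem_of_mem_erase hn)⟩ ?_
  · rw [hweight_remove₀ B hi, hBw]
  · have := hsize_remove B hi (i + 1) 1; omega
  · rw [Finsupp.add_apply, hBt.1 n hn, Finsupp.single_eq_of_ne (by omega), add_zero]
  · rw [Finsupp.add_apply, hB, Finsupp.single_eq_of_ne (by omega), add_zero]

/-- A family of subgroups that is closed under the coefficients and under `Q₀` and `Q₁`, and that
contains the generators of the lightning flash and of the free part, contains all monomials. -/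
theorem hmon_mem (hp : p.Prime) (hF : F.Admissible p)
    (hs : ∀ d e, ∀ m ∈ Coeff.gr F p e, ∀ x ∈ H d, m • x ∈ H (e + d))
    (h0 : ∀ d, ∀ x ∈ H d, hzAct (Q₀ F p) x ∈ H (d - tauDeg p 0))
    (h1 : ∀ d, ∀ x ∈ H d, hzAct (Q₁ F p) x ∈ H (d - tauDeg p 1))
    (hZ : ∀ A S, hweight p A S = k → IsFreeGen p A S → hmon F p A S ∈ H (hdeg p A S))
    (hc : hmon F p (Finsupp.single 0 k) ∅ ∈ H (hdeg p (Finsupp.single 0 k) ∅))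
    (hX : ∀ A N, hweight p A {N} = k → TopLE A {N} N → IsBot p A {N} N →
      hmon F p A {N} ∈ H (hdeg p A {N}))
    (A : ℕ →₀ ℕ) (S : Finset ℕ) (hw : hweight p A S = k) : hmon F p A S ∈ H (hdeg p A S) := by
  -- Three nested inductions: on the number `s` of factors, for the errors of `Q₁`; on the bound for
  -- the top index; and on the exponent of `ξ_{N+1}`.
  obtain ⟨s, hsz⟩ : ∃ s, hsize A S = s := ⟨_, rfl⟩
  induction s using Nat.strong_induction_on generalizing A S with
  | _ s ihs =>
  have key : ∀ N A S, hweight p A S = k → hsize A S = s → (∀ n, N < n → A n = 0) →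
      (∀ n ∈ S, n < N) → hmon F p A S ∈ H (hdeg p A S) := by
    intro N
    induction N with
    | zero =>
      intro A S hw _ hA hS
      have hS' : S = ∅ := Finset.eq_empty_of_forall_notMem fun n hn => Nat.not_lt_zero _ (hS n hn)
      subst hS'
      have hA' : A = Finsupp.single 0 (A 0) := by
        ext n
        cases n with
        | zero => simp
        | succ n => rw [hA _ n.succ_pos]; simp
      have : A 0 = k := by
        rw [← hw, hA']; simp [hweight]
      rw [hA', this]
      exact hc
    | succ N ihN =>
      suffices h : ∀ c A S, hweight p A S = k → hsize A S = s → TopLE A S N → A (N + 1) ≤ c →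
          hmon F p A S ∈ H (hdeg p A S) from fun A S hw hsz hA hS =>
        h _ A S hw hsz ⟨hA, fun n hn => Nat.lt_succ_iff.1 (hS n hn)⟩ le_rfl
      intro c
      induction c using Nat.strong_induction_on with
      | _ c ihc =>
      -- Monomials without `τ_{N+1}`: either `ξ_{N+1}` is absent too and the top index drops, or
      -- `Q₀` reduces to a smaller exponent of `ξ_{N+1}`.
      have hno : ∀ A S, hweight p A S = k → hsize A S = s → TopLE A S N → A (N + 1) ≤ c →
          N ∉ S → hmon F p A S ∈ H (hdeg p A S) := by
        intro A S hw hsz ht hc' hN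
        rcases Nat.eq_zero_or_eq_succ_pred (A (N + 1)) with h | h
        · refine ihN A S hw hsz (fun n hn => ?_) fun n hn => ?_
          · rcases (Nat.succ_le_of_lt hn).eq_or_lt with rfl | h'
            · exact h
            · exact ht.1 n h'
          · exact lt_of_le_of_ne (ht.2 n hn) fun h => hN (h ▸ hn)
        · exact hmon_mem_of_top h0 (ihc _ (by omega)) hw hsz ht hN h
      intro A S hw hsz ht hc'
      by_cases hN : N ∈ S
      swap
      · exact hno A S hw hsz ht hc' hN
      obtain ⟨j, hj⟩ : ∃ j, IsBot p A S j := by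
        classical
        have h : ∃ n, p ≤ A n ∨ n ∈ S := ⟨N, Or.inr hN⟩
        refine ⟨Nat.find h, Nat.find_spec h, fun n hn => ?_⟩
        have := Nat.find_min h hn
        push Not at this
        exact this
      have hjN : j ≤ N := not_lt.1 fun h => (hj.2 N h).2 hN
      -- If bottom and top index agree, no other factor `τ` is left room, and the monomial is a
      -- generator of the flash.
      rcases hjN.eq_or_lt with rfl | hjN
      · have hS : S = {j} := by
          refine Finset.eq_singleton_iff_unique_mem.2 ⟨hN, fun n hn => ?_⟩
          exact le_antisymm (ht.2 n hn) (not_lt.1 fun h => (hj.2 n h).2 hn)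
        subst hS
        exact hX A j hw ht hj
      by_cases hjS : j ∈ S
      · exact hZ A S hw ⟨N, j, ht, hj, hjN, hN, hjS⟩
      have hAj : p ≤ A j := hj.1.resolve_right hjS
      -- Now `ξ_j ^ p` divides the monomial but `τ_{j+1}` does not. Turning `ξ_j ^ p` back into
      -- `τ_{j+1}` gives a free generator, and the monomial is a main term of `Q₁` on it.
      obtain ⟨B, rfl⟩ : ∃ B, A = B + Finsupp.single j p :=
        ⟨A - Finsupp.single j p, (tsub_add_cancel_of_le (by simpa using hAj)).symm⟩
      obtain ⟨T, hT, rfl⟩ : ∃ T, j ∈ T ∧ S = T.erase j :=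
        ⟨insert j S, Finset.mem_insert_self _ _, (Finset.erase_insert hjS).symm⟩
      have hBw : hweight p B T = k := by rw [← hw, hweight_remove₁ B hT]
      have hBs := hsize_remove B hT j p
      have hp1 := hp.one_lt
      have hNT : N ∈ T := Finset.mem_of_mem_erase hN
      have hBt : TopLE B T N := by
        refine ⟨fun n hn => ?_, fun n hn => ?_⟩
        · have := ht.1 n hn
          simp only [Finsupp.add_apply] at this
          omega
        · rcases eq_or_ne n j with rfl | h
          · exact hjN.le
          · exact ht.2 n (Finset.mem_erase.2 ⟨h, hn⟩)
      have hBb : ∀ n < j, B n < p ∧ n ∉ T := by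
        intro n hn
        have := hj.2 n hn
        rw [Finsupp.add_apply, Finsupp.single_eq_of_ne (by omega), add_zero] at this
        exact ⟨this.1, fun h => this.2 (Finset.mem_erase.2 ⟨hn.ne, h⟩)⟩
      refine hmon_remove₁_mem hF hs h1 hT
        (hZ B T hBw ⟨N, j, hBt, ⟨Or.inr hT, hBb⟩, hjN, hNT, hT⟩) (fun i hi hij => ?_)
        fun i hi l hl => ?_
      · have hji : j < i := lt_of_le_of_ne (not_lt.1 fun h => (hBb i h).2 hi) hij.symm
        have hiN := hBt.2 i hi
        have ht' : TopLE (B + Finsupp.single i p) (T.erase i) N := by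
          refine ⟨fun n hn => ?_, fun n hn => hBt.2 n (Finset.mem_of_mem_erase hn)⟩
          rw [Finsupp.add_apply, hBt.1 n hn, Finsupp.single_eq_of_ne (by omega), add_zero]
        have hw' : hweight p (B + Finsupp.single i p) (T.erase i) = k := by
          rw [hweight_remove₁ B hi, hBw]
        -- Another main term either loses `τ_{N+1}`, with the same number of factors and the same
        -- exponent of `ξ_{N+1}`, so that `hno` applies, or keeps both `τ_{N+1}` and `τ_{j+1}` and
        -- is again a free generator.
        rcases eq_or_ne i N with rfl | hiN'
        · refine hno _ _ hw' ?_ ht' ?_ (Finset.notMem_erase _ _)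
          · have := hsize_remove B hi i p; omega
          · rw [Finsupp.add_apply, Finsupp.single_eq_of_ne (by omega)] at hc' ⊢
            exact hc'
        · refine hZ _ _ hw' ⟨N, j, ht', ⟨Or.inr (Finset.mem_erase.2 ⟨hij.symm, hT⟩), fun n hn => ?_⟩,
            hjN, Finset.mem_erase.2 ⟨hiN'.symm, hNT⟩, Finset.mem_erase.2 ⟨hij.symm, hT⟩⟩
          rw [Finsupp.add_apply, Finsupp.single_eq_of_ne (by omega), add_zero]
          exact ⟨(hBb n hn).1, fun h => (hBb n hn).2 (Finset.mem_of_mem_erase h)⟩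
      -- An error term has as many factors as the source of `Q₁`, which is `p - 1` fewer than `s`.
      · have e1 := hsize_remove B hi (i + 1) 1
        have e2 := hsize_remove (B + Finsupp.single (i + 1) 1) hl (l + 1) 1
        refine ihs _ ?_ _ _ ?_ rfl
        · omega
        · rw [hweight_remove₀ _ hl, hweight_remove₀ _ hi, hBw]
  obtain ⟨N, hN⟩ : ∃ N, (∀ n, N < n → A n = 0) ∧ ∀ n ∈ S, n < N := by
    refine ⟨(A.support ∪ S).sup id + 1, fun n hn => ?_, fun n hn => ?_⟩
    · by_contra h
      have := Finset.le_sup (f := id) (Finset.mem_union_left S (Finsupp.mem_support_iff.2 h))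
      simp only [id] at this
      omega
    · have := Finset.le_sup (f := id) (Finset.mem_union_right A.support hn)
      simp only [id] at this
      omega
  exact key N A S hw hsz hN.1 hN.2

end Spanning

/-! ### Carries in base `p` and `ν_p(k!)` -/

/-- Exponents below `p` are the base `p` digits of the number that they represent. The induction
splits off the lowest digit and shifts the others. -/
theorem sum_digits_eq_degree (hp : 1 < p) (N : ℕ) : ∀ B : ℕ → ℕ, (∀ n, B n < p) →
    (Nat.digits p (∑ n ∈ Finset.range N, B n * p ^ n)).sum = ∑ n ∈ Finset.range N, B n := by
  induction N with
  | zero => intro B _; simp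
  | succ N ih =>
    intro B hB
    have e : ∑ n ∈ Finset.range (N + 1), B n * p ^ n =
        B 0 + p * ∑ n ∈ Finset.range N, B (n + 1) * p ^ n := by
      rw [Finset.sum_range_succ', Finset.mul_sum, add_comm, pow_zero, mul_one]
      congr 1
      exact Finset.sum_congr rfl fun n _ => by ring
    rw [e, Finset.sum_range_succ', ← ih (fun n => B (n + 1)) fun n => hB _, add_comm _ (B 0)]
    set y := ∑ n ∈ Finset.range N, B (n + 1) * p ^ n
    -- The list of digits of `0` is empty, so the case where both parts vanish is separate.
    by_cases h : B 0 ≠ 0 ∨ y ≠ 0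
    · rw [Nat.digits_add p hp _ _ (hB 0) h, List.sum_cons]
    · push Not at h
      simp [h.1, h.2]

theorem sum_digits_hweight (hp : 1 < p) (B : ℕ →₀ ℕ) (hB : ∀ n, B n < p) :
    (Nat.digits p (hweight p B ∅)).sum = B.degree := by
  have hsub : B.support ⊆ Finset.range (B.support.sup id + 1) := fun n hn =>
    Finset.mem_range.2 (Nat.lt_succ_of_le (Finset.le_sup (f := id) hn))
  rw [hweight, Finset.sum_empty, add_zero, Finsupp.sum_of_support_subset _ hsub _ (by simp),
    sum_digits_eq_degree hp _ B hB, Finsupp.degree_apply]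
  exact (Finset.sum_subset hsub (by simp)).symm

theorem degree_le_hweight (hp : 0 < p) (B : ℕ →₀ ℕ) (S : Finset ℕ) :
    B.degree ≤ hweight p B S := by
  refine le_trans ?_ (Nat.le_add_right _ _)
  rw [Finsupp.degree_apply, Finsupp.sum]
  exact Finset.sum_le_sum fun n _ => Nat.le_mul_of_pos_right _ (pow_pos hp n)

/-- `B'` arises from `B` by a carry at `j` that leaves `A`. -/
theorem exists_carry (B : ℕ →₀ ℕ) (hB : ∃ n, p ≤ B n) : ∃ (A : ℕ →₀ ℕ) (j : ℕ),
    B = A + Finsupp.single j p ∧ ∀ n < j, B n < p := by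
  classical
  refine ⟨B - Finsupp.single (Nat.find hB) p, Nat.find hB,
    (tsub_add_cancel_of_le (by simpa using Nat.find_spec hB)).symm, fun n hn => ?_⟩
  exact not_le.1 (Nat.find_min hB hn)

open Classical in
variable (p) in
/-- What remains after removing `ξ_j ^ p` for the least possible `j`, and this `j`. -/
def carry (B : ℕ →₀ ℕ) : (ℕ →₀ ℕ) × ℕ :=
  if h : ∃ n, p ≤ B n then
    ⟨(exists_carry B h).choose, (exists_carry B h).choose_spec.choose⟩ else (B, 0)

theorem carry_spec {B : ℕ →₀ ℕ} (h : ∃ n, p ≤ B n) :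
    B = (carry p B).1 + Finsupp.single (carry p B).2 p ∧ ∀ n < (carry p B).2, B n < p := by
  rw [carry, dif_pos h]
  exact (exists_carry B h).choose_spec.choose_spec

/-- Adding `p` at `j` does not affect the exponents below `j`, so `j` is the least index where a
carry is possible. A carry can therefore be read off from its remainder `A`. -/
theorem carry_eq {A : ℕ →₀ ℕ} {j : ℕ} (h : ∀ n < j, A n < p) :
    carry p (A + Finsupp.single j p) = (A, j) := by
  have hj : p ≤ (A + Finsupp.single j p) j := by simp
  obtain ⟨h1, h2⟩ := carry_spec ⟨j, hj⟩
  have hle : (carry p (A + Finsupp.single j p)).2 ≤ j := not_lt.1 fun h => (h2 j h).not_ge hj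
  have e : (carry p (A + Finsupp.single j p)).2 = j := by
    refine hle.eq_of_not_lt fun hlt => ?_
    have h3 := DFunLike.congr_fun h1 (carry p (A + Finsupp.single j p)).2
    rw [Finsupp.add_apply, Finsupp.add_apply, Finsupp.single_eq_same,
      Finsupp.single_eq_of_ne hlt.ne] at h3
    have := h _ hlt
    omega
  rw [e] at h1
  exact Prod.ext (add_right_cancel h1).symm e

variable (p) in
/-- The sequence of monomials `∏ ξ_n ^ B(n)` that starts at `ξ_0 ^ k` and replaces `ξ_j ^ p` by
`ξ_{j+1}` for the least possible `j`. -/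
def chain (k : ℕ) : ℕ → ℕ →₀ ℕ
  | 0 => Finsupp.single 0 k
  | i + 1 => (carry p (chain k i)).1 + Finsupp.single ((carry p (chain k i)).2 + 1) 1

/-- A carry trades `ξ_j ^ p` for `ξ_{j+1}`, of the same weight, and so lowers the number of factors
by `p - 1`. The count is written without subtraction. -/
theorem chain_add (k i : ℕ) (h : ∀ l < i, ∃ n, p ≤ chain p k l n) :
    hweight p (chain p k i) ∅ = k ∧ (chain p k i).degree + i * p = k + i := by
  induction i with
  | zero => simp [chain, hweight]
  | succ i ih =>
    obtain ⟨h1, h2⟩ := ih fun l hl => h l (hl.trans i.lt_succ_self)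
    have hc := (carry_spec (h i i.lt_succ_self)).1
    rw [hc] at h1 h2
    rw [chain]
    rw [hweight_add, Finsupp.sum_single_index (by simp)] at h1 ⊢
    rw [map_add, Finsupp.degree_single] at h2 ⊢
    refine ⟨?_, ?_⟩
    · rw [one_mul, pow_succ', h1]
    · rw [add_mul, one_mul]; omega

/-- The number of carries is `ν_p(k!)`. -/
theorem exists_chain_length [hp : Fact p.Prime] (k : ℕ) :
    (∀ i < padicValNat p k.factorial, ∃ n, p ≤ chain p k i n) ∧
      ∀ n, chain p k (padicValNat p k.factorial) n < p := by
  classical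
  have hp1 := hp.out.one_lt
  -- After `k + 1` carries the count of factors would give `(k + 1) p ≤ 2 k + 1`, which is
  -- impossible for `p ≥ 2`.
  have hex : ∃ i, ∀ n, chain p k i n < p := by
    by_contra! h
    have := (chain_add k (k + 1) fun l _ => h l).2
    nlinarith
  obtain ⟨m, hm, hm'⟩ : ∃ m, (∀ n, chain p k m n < p) ∧ ∀ i < m, ∃ n, p ≤ chain p k i n :=
    ⟨Nat.find hex, Nat.find_spec hex, fun i hi => by simpa using Nat.find_min hex hi⟩
  obtain ⟨h1, h2⟩ := chain_add k m hm'
  have h3 := sum_digits_hweight hp1 _ hm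
  -- Legendre's formula: `(p - 1) ν_p(k!)` is `k` minus the digit sum, which here is the number of
  -- factors of the terminal monomial, and `chain_add` says the same of `(p - 1) m`.
  have h4 := sub_one_mul_padicValNat_factorial (p := p) k
  rw [h1] at h3
  rw [h3] at h4
  have : m = padicValNat p k.factorial := by
    obtain ⟨q, rfl⟩ : ∃ q, p = q + 1 := ⟨p - 1, by omega⟩
    have hq : 0 < q := by omega
    rw [Nat.add_sub_cancel] at h4
    refine Nat.eq_of_mul_eq_mul_left hq (h4.trans ?_ |>.symm)
    rw [mul_add, mul_one] at h2
    rw [mul_comm]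
    omega
  rw [← this]
  exact ⟨hm', hm⟩

/-- Such a monomial has a unique past: its highest factor `ξ_{t+1}` can only come from a carry at
`t`. Undoing this carry raises the number of factors, which the weight `k` bounds, and ends at `ξ_0
^ k`. -/
theorem eq_chain (hp : 1 < p) {k m : ℕ} (hm : ∀ n, chain p k m n < p) {B : ℕ →₀ ℕ} {N : ℕ}
    (hw : hweight p B ∅ = k) (h1 : ∀ n < N, B n < p) (h2 : ∀ n, N + 1 < n → B n = 0) :
    ∃ i ≤ m, B = chain p k i := by
  obtain ⟨s, hs⟩ : ∃ s, k - B.degree = s := ⟨_, rfl⟩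
  induction s using Nat.strong_induction_on generalizing B N with
  | _ s ih =>
  by_cases h0 : ∃ n, B (n + 1) ≠ 0
  -- `t + 1` is the index of the highest factor. It may be smaller than `N + 1`, so `N` has to be
  -- replaced by `t` in the induction.
  · obtain ⟨t, ht, htN, ht'⟩ : ∃ t, B (t + 1) ≠ 0 ∧ t ≤ N ∧ ∀ n, t + 1 < n → B n = 0 := by
      clear ih hs hw h1
      induction N with
      | zero =>
        obtain ⟨n, hn⟩ := h0
        have : n = 0 := by
          by_contra h
          exact hn (h2 _ (by omega))
        subst this
        exact ⟨0, hn, le_rfl, h2⟩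
      | succ N ihN =>
        by_cases h : B (N + 1 + 1) = 0
        · obtain ⟨t, h3, h4, h5⟩ := ihN fun n hn => by
            rcases (Nat.succ_le_of_lt hn).eq_or_lt with rfl | h'
            · exact h
            · exact h2 n h'
          exact ⟨t, h3, h4.trans (Nat.le_succ N), h5⟩
        · exact ⟨N + 1, h, le_rfl, h2⟩
    obtain ⟨A, rfl⟩ : ∃ A, B = A + Finsupp.single (t + 1) 1 :=
      ⟨B - Finsupp.single (t + 1) 1, (tsub_add_cancel_of_le (by
        simpa using Nat.one_le_iff_ne_zero.2 ht)).symm⟩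
    have hAlt : ∀ n < t, A n < p := fun n hn =>
      lt_of_le_of_lt (by simp) (h1 n (hn.trans_le htN))
    have hw' : hweight p (A + Finsupp.single t p) ∅ = k := by
      rw [← hw, hweight_add, hweight_add, Finsupp.sum_single_index (by simp),
        Finsupp.sum_single_index (by simp), one_mul, pow_succ']
    have hd := degree_le_hweight (zero_lt_one.trans hp) (A + Finsupp.single t p) ∅
    rw [hw', map_add, Finsupp.degree_single] at hd
    rw [map_add, Finsupp.degree_single] at hs
    obtain ⟨i, hi, he⟩ := ih (k - (A + Finsupp.single t p).degree)
      (by rw [map_add, Finsupp.degree_single]; omega) (B := A + Finsupp.single t p) (N := t) hw'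
      (fun n hn => by
        rw [Finsupp.add_apply, Finsupp.single_eq_of_ne hn.ne, add_zero]; exact hAlt n hn)
      (fun n hn => by
        have := ht' n hn
        rw [Finsupp.add_apply] at this ⊢
        rw [Finsupp.single_eq_of_ne (by omega)]
        omega) rfl
    -- The earlier monomial still contains `ξ_t ^ p`, so it is not terminal.
    have him : i ≠ m := by
      rintro rfl
      have := hm t
      rw [← he] at this
      simp at this
    refine ⟨i + 1, by omega, ?_⟩
    rw [chain, ← he, carry_eq hAlt]
  · push Not at h0
    refine ⟨0, Nat.zero_le _, ?_⟩
    have hB : B = Finsupp.single 0 (B 0) := by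
      ext n
      cases n with
      | zero => simp
      | succ n => rw [h0]; simp
    have : B 0 = k := by rw [← hw, hB]; simp [hweight]
    rw [chain, ← this]
    exact hB

/-- The monomials that map to the given ones under `Q₁`. -/
theorem eq_carry_chain (hp : 1 < p) {k m : ℕ} (hm : ∀ n, chain p k m n < p) {A : ℕ →₀ ℕ} {N : ℕ}
    (hw : hweight p A {N} = k) (ht : TopLE A {N} N) (hb : IsBot p A {N} N) :
    ∃ i < m, carry p (chain p k i) = (A, N) := by
  -- The image under `Q₁` is a monomial in the `ξ_n` to which `eq_chain` applies; its carry gives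
  -- back `(A, N)`.
  have hw' : hweight p (A + Finsupp.single N p) ∅ = k := by
    have := hweight_remove₁ (p := p) A (Finset.mem_singleton_self N)
    rwa [Finset.erase_singleton, hw] at this
  obtain ⟨i, hi, he⟩ := eq_chain hp hm (N := N) hw'
    (fun n hn => by
      rw [Finsupp.add_apply, Finsupp.single_eq_of_ne hn.ne, add_zero]; exact (hb.2 n hn).1)
    (fun n hn => by
      rw [Finsupp.add_apply, ht.1 n hn, Finsupp.single_eq_of_ne (by omega), add_zero])
  have him : i ≠ m := by
    rintro rfl
    have := hm N
    rw [← he] at this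
    simp at this
  refine ⟨i, by omega, ?_⟩
  rw [← he, carry_eq fun n hn => (hb.2 n hn).1]

/-! ### The standard action on a flash plus free summands -/

/-- The index set for the bases of a lightning flash with `m` generators plus a free part of
rank `n`. The indices `inl (inl i)`, `inl (inr i)` are for the generators of the flash and for
their images under `Q₀` and `Q₁`. -/
abbrev FlashIndex (m n : ℕ) : Type := (Fin m ⊕ Fin (m + 1)) ⊕ (Σ _ : Fin n, Bool × Bool)

variable (p) in
/-- The degrees of the elements of the lightning flash. -/
def flashDeg {m : ℕ} : Fin m ⊕ Fin (m + 1) → ℤ × ℤ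
  | Sum.inl i => lightningDeg p (i.val + 1)
  | Sum.inr i => i.val • ((2 * (p : ℤ) - 2, (p : ℤ) - 1) : ℤ × ℤ)

variable (p) in
/-- The degrees of the basis elements, for free generators of degrees `e`. -/
def stdDeg {m n : ℕ} (e : Fin n → ℤ × ℤ) : FlashIndex m n → ℤ × ℤ
  | Sum.inl i => flashDeg p i
  | Sum.inr ⟨l, s⟩ => e l - Comodule.loss p s

/-- The action of `Q₀` on the basis. -/
def stdQ₀ {M : Type} [AddCommGroup M] {m n : ℕ} (b : FlashIndex m n → M) : FlashIndex m n → M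
  | Sum.inl (Sum.inl i) => b (Sum.inl (Sum.inr i.succ))
  | Sum.inl (Sum.inr _) => 0
  | Sum.inr ⟨l, (false, false)⟩ => b (Sum.inr ⟨l, (true, false)⟩)
  | Sum.inr ⟨l, (false, true)⟩ => -b (Sum.inr ⟨l, (true, true)⟩)
  | Sum.inr ⟨_, (true, _)⟩ => 0

/-- The action of `Q₁` on the basis. -/
def stdQ₁ {M : Type} [AddCommGroup M] {m n : ℕ} (b : FlashIndex m n → M) : FlashIndex m n → M
  | Sum.inl (Sum.inl i) => b (Sum.inl (Sum.inr i.castSucc))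
  | Sum.inl (Sum.inr _) => 0
  | Sum.inr ⟨l, (s, false)⟩ => b (Sum.inr ⟨l, (s, true)⟩)
  | Sum.inr ⟨_, (_, true)⟩ => 0

/-- The action of `Q₀ Q₁` on the basis. -/
def stdQ₀₁ {M : Type} [AddCommGroup M] {m n : ℕ} (b : FlashIndex m n → M) : FlashIndex m n → M
  | Sum.inr ⟨l, (false, false)⟩ => b (Sum.inr ⟨l, (true, true)⟩)
  | _ => 0

section Map

variable {M M' G : Type} [AddCommGroup M] [AddCommGroup M'] [FunLike G M M']
  [AddMonoidHomClass G M M'] {m n : ℕ} (T : G) {b : FlashIndex m n → M} {b' : FlashIndex m n → M'}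
  (h : ∀ i, T (b i) = b' i)

include h

theorem map_stdQ₀ (i : FlashIndex m n) : T (stdQ₀ b i) = stdQ₀ b' i := by
  rcases i with (i | i) | ⟨l, _ | _, _ | _⟩ <;> simp [stdQ₀, h]

theorem map_stdQ₁ (i : FlashIndex m n) : T (stdQ₁ b i) = stdQ₁ b' i := by
  rcases i with (i | i) | ⟨l, _ | _, _ | _⟩ <;> simp [stdQ₁, h]

theorem map_stdQ₀₁ (i : FlashIndex m n) : T (stdQ₀₁ b i) = stdQ₀₁ b' i := by
  rcases i with (i | i) | ⟨l, _ | _, _ | _⟩ <;> simp [stdQ₀₁, h]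

end Map

theorem tauDeg_sub : tauDeg p 1 - tauDeg p 0 = (2 * (p : ℤ) - 2, (p : ℤ) - 1) := by
  ext <;> simp [tauDeg]; ring

theorem flashDeg_succ {m : ℕ} (i : Fin m) :
    flashDeg p (Sum.inr i.succ : Fin m ⊕ Fin (m + 1)) =
      flashDeg p (Sum.inl i : Fin m ⊕ Fin (m + 1)) - tauDeg p 0 := by
  simp [flashDeg, lightningDeg, tauDeg]

theorem flashDeg_castSucc {m : ℕ} (i : Fin m) :
    flashDeg p (Sum.inr i.castSucc : Fin m ⊕ Fin (m + 1)) =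
      flashDeg p (Sum.inl i : Fin m ⊕ Fin (m + 1)) - tauDeg p 1 := by
  simp only [flashDeg, lightningDeg, ← tauDeg_sub, Fin.val_castSucc, add_smul, one_smul]
  simp [tauDeg]
  abel

namespace Comodule

variable {N : Comodule F p} {m n : ℕ} {b : FlashIndex m n → N.carrier}
  (h0 : ∀ i, N.act (Q₀ F p) (b i) = stdQ₀ b i) (h1 : ∀ i, N.act (Q₁ F p) (b i) = stdQ₁ b i)

include h0 h1

theorem act_stdQ₀₁ (i : FlashIndex m n) : N.act (Q₀ F p * Q₁ F p) (b i) = stdQ₀₁ b i := by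
  rw [← act_Q₁_Q₀, h0]
  rcases i with (i | i) | ⟨l, _ | _, _ | _⟩ <;> simp [stdQ₀, stdQ₁, stdQ₀₁, h1]

/-- This is what `act_Q₀_mem_hspan` and `act_Q₁_mem_hspan` require: the homogeneous combinations of
a family of standard form are stable under the operators, with the expected shift of degrees. -/
theorem act_std_mem_hspan (e : Fin n → ℤ × ℤ) (i : FlashIndex m n) :
    N.act (Q₀ F p) (b i) ∈ hspan F p b (stdDeg p e) (stdDeg p e i - tauDeg p 0) ∧
    N.act (Q₁ F p) (b i) ∈ hspan F p b (stdDeg p e) (stdDeg p e i - tauDeg p 1) ∧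
    N.act (Q₀ F p * Q₁ F p) (b i) ∈
      hspan F p b (stdDeg p e) (stdDeg p e i - (tauDeg p 0 + tauDeg p 1)) := by
  rw [act_stdQ₀₁ h0 h1, h0, h1]
  refine ⟨?_, ?_, ?_⟩
  · rcases i with (i | i) | ⟨l, _ | _, _ | _⟩
    · exact mem_hspan' _ (flashDeg_succ i)
    · exact zero_mem _
    · exact mem_hspan' _ (by simp [stdDeg, Comodule.loss])
    · exact neg_mem (mem_hspan' _ (by simp [stdDeg, Comodule.loss]; abel))
    all_goals exact zero_mem _
  · rcases i with (i | i) | ⟨l, _ | _, _ | _⟩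
    · exact mem_hspan' _ (flashDeg_castSucc i)
    · exact zero_mem _
    · exact mem_hspan' _ (by simp [stdDeg, Comodule.loss])
    · exact zero_mem _
    · exact mem_hspan' _ (by simp [stdDeg, Comodule.loss]; abel)
    · exact zero_mem _
  · rcases i with (i | i) | ⟨l, _ | _, _ | _⟩
    · exact zero_mem _
    · exact zero_mem _
    · exact mem_hspan' _ (by simp [stdDeg, Comodule.loss])
    all_goals exact zero_mem _

end Comodule

/-- Comodules with homogeneous bases of the standard form are isomorphic. -/
theorem Comodule.HomBasis.nonempty_iso_std {N P : Comodule F p} {m n : ℕ}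
    (B : HomBasis N (FlashIndex m n)) (C : HomBasis P (FlashIndex m n)) (hdeg : B.deg = C.deg)
    (hB0 : ∀ i, N.act (Q₀ F p) (B.basis i) = stdQ₀ B.basis i)
    (hB1 : ∀ i, N.act (Q₁ F p) (B.basis i) = stdQ₁ B.basis i)
    (hC0 : ∀ i, P.act (Q₀ F p) (C.basis i) = stdQ₀ C.basis i)
    (hC1 : ∀ i, P.act (Q₁ F p) (C.basis i) = stdQ₁ C.basis i) :
    Nonempty (Iso N P) := by
  have h : ∀ i, B.basis.equiv C.basis (Equiv.refl _) (B.basis i) = C.basis i := fun i => by simp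
  refine B.nonempty_iso C hdeg (fun i => ?_) (fun i => ?_) fun i => ?_
  · rw [hB0, hC0, map_stdQ₀ _ h]
  · rw [hB1, hC1, map_stdQ₁ _ h]
  · rw [act_stdQ₀₁ hB0 hB1, act_stdQ₀₁ hC0 hC1, map_stdQ₀₁ _ h]

/-! ### Leading monomials: the zigzag and the quadruples -/

/-- The position `t` of the next carry cannot lie below the previous bound `M`, where exponents are
less than `p`. The carry is at the least possible index and creates only `ξ_{t+1}`, so `t` is a
bound for the next monomial. -/
theorem chain_shape (k i : ℕ) (h : ∀ l < i, ∃ n, p ≤ chain p k l n) :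
    ∃ M, (∀ n < M, chain p k i n < p) ∧ ∀ n, M + 1 < n → chain p k i n = 0 := by
  induction i with
  | zero => exact ⟨0, by simp, fun n hn => Finsupp.single_eq_of_ne (by omega)⟩
  | succ i ih =>
    obtain ⟨M, h1, h2⟩ := ih fun l hl => h l (hl.trans i.lt_succ_self)
    obtain ⟨h3, h4⟩ := carry_spec (h i i.lt_succ_self)
    set t := (carry p (chain p k i)).2
    set A := (carry p (chain p k i)).1
    have hv : ∀ n, chain p k i n = A n + Finsupp.single t p n := fun n => by
      conv_lhs => rw [h3]
      rfl
    have ht := hv t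
    rw [Finsupp.single_eq_same] at ht
    have hMt : M ≤ t := not_lt.1 fun hlt => by
      have := h1 t hlt
      omega
    refine ⟨t, fun n hn => ?_, fun n hn => ?_⟩
    · have h5 := h4 n hn
      rw [hv, Finsupp.single_eq_of_ne hn.ne, add_zero] at h5
      change A n + Finsupp.single (t + 1) 1 n < p
      rwa [Finsupp.single_eq_of_ne (by omega), add_zero]
    · have h5 := h2 n (by omega)
      rw [hv] at h5
      change A n + Finsupp.single (t + 1) 1 n = 0
      rw [Finsupp.single_eq_of_ne (by omega)]
      omega

/-- The converse of `eq_carry_chain`: the monomial halfway through a carry has equal top and bottom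
index. -/
theorem carry_chain {k i : ℕ} (h : ∀ l ≤ i, ∃ n, p ≤ chain p k l n) :
    hweight p (carry p (chain p k i)).1 {(carry p (chain p k i)).2} = k ∧
    TopLE (carry p (chain p k i)).1 {(carry p (chain p k i)).2} (carry p (chain p k i)).2 ∧
    IsBot p (carry p (chain p k i)).1 {(carry p (chain p k i)).2} (carry p (chain p k i)).2 := by
  obtain ⟨M, h1, h2⟩ := chain_shape k i (fun l hl => h l hl.le)
  have hw := (chain_add k i fun l hl => h l hl.le).1
  obtain ⟨h3, h4⟩ := carry_spec (h i le_rfl)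
  set t := (carry p (chain p k i)).2
  set A := (carry p (chain p k i)).1
  have hv : ∀ n, chain p k i n = A n + Finsupp.single t p n := fun n => by
    conv_lhs => rw [h3]
    rfl
  have ht := hv t
  rw [Finsupp.single_eq_same] at ht
  have hMt : M ≤ t := not_lt.1 fun hlt => by
    have := h1 t hlt
    omega
  refine ⟨?_, ⟨fun n hn => ?_, by simp⟩, Or.inr (Finset.mem_singleton_self t), fun n hn => ?_⟩
  · have := hweight_remove₁ (p := p) A (Finset.mem_singleton_self t)
    rw [Finset.erase_singleton, ← h3, hw] at this
    exact this.symm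
  · have h5 := h2 n (by omega)
    rw [hv] at h5
    omega
  · have h5 := h4 n hn
    rw [hv] at h5
    exact ⟨by omega, by simpa using hn.ne⟩

variable (p) in
/-- The top index of the monomial is `N` and `j < N` is its bottom index. -/
def HasTopBot (A : ℕ →₀ ℕ) (S : Finset ℕ) (N j : ℕ) : Prop :=
  TopLE A S N ∧ (0 < A (N + 1) ∨ N ∈ S) ∧ IsBot p A S j ∧ j < N

theorem TopLE.le_of {A : ℕ →₀ ℕ} {S : Finset ℕ} {N N' : ℕ} (h : TopLE A S N)
    (h' : 0 < A (N' + 1) ∨ N' ∈ S) : N' ≤ N := by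
  rcases h' with h' | h'
  · by_contra hlt
    rw [h.1 _ (by omega)] at h'
    exact lt_irrefl _ h'
  · exact h.2 _ h'

theorem IsBot.unique {A : ℕ →₀ ℕ} {S : Finset ℕ} {j j' : ℕ} (h : IsBot p A S j)
    (h' : IsBot p A S j') : j = j' := by
  have key : ∀ {i i'}, IsBot p A S i → IsBot p A S i' → i ≤ i' := fun h h' =>
    not_lt.1 fun hlt => h'.1.elim (fun h'' => (h.2 _ hlt).1.not_ge h'') (h.2 _ hlt).2
  exact le_antisymm (key h h') (key h' h)

theorem HasTopBot.unique {A : ℕ →₀ ℕ} {S : Finset ℕ} {N j N' j' : ℕ} (h : HasTopBot p A S N j)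
    (h' : HasTopBot p A S N' j') : N = N' ∧ j = j' :=
  ⟨le_antisymm (h'.1.le_of h.2.1) (h.1.le_of h'.2.1), h.2.2.1.unique h'.2.2.1⟩

theorem not_hasTopBot_carry {k i : ℕ} (h : ∀ l ≤ i, ∃ n, p ≤ chain p k l n)
    (N j : ℕ) :
    ¬ HasTopBot p (carry p (chain p k i)).1 {(carry p (chain p k i)).2} N j := by
  obtain ⟨-, h1, h2⟩ := carry_chain h
  rintro ⟨-, h3, h4, h5⟩
  have := h1.le_of h3
  have := h2.unique h4
  omega

/-- By `chain_shape` the top index is at most `M`, while a bottom index is at least `M`, since all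
exponents below `M` are less than `p`. -/
theorem not_hasTopBot_chain {k i : ℕ} (h : ∀ l < i, ∃ n, p ≤ chain p k l n)
    (N j : ℕ) : ¬ HasTopBot p (chain p k i) ∅ N j := by
  obtain ⟨M, h1, h2⟩ := chain_shape k i h
  rintro ⟨-, h3, h4, h5⟩
  have h6 := h3.resolve_right (Finset.notMem_empty _)
  have h7 := h4.1.resolve_right (Finset.notMem_empty _)
  have h8 : N ≤ M := not_lt.1 fun hlt => h6.ne' (h2 _ (by omega))
  have h9 := h1 j (by omega)
  omega

variable (p) in
/-- Exchange `τ_{N+1}` for `ξ_{N+1}` and `τ_{j+1}` for `ξ_j ^ p`. -/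
def toggle (A : ℕ →₀ ℕ) (S : Finset ℕ) (N j : ℕ) : Bool × Bool → (ℕ →₀ ℕ) × Finset ℕ
  | (false, false) => (A, S)
  | (true, false) => (A + Finsupp.single (N + 1) 1, S.erase N)
  | (false, true) => (A + Finsupp.single j p, S.erase j)
  | (true, true) => (A + Finsupp.single (N + 1) 1 + Finsupp.single j p, (S.erase N).erase j)

section Toggle

variable {A : ℕ →₀ ℕ} {S : Finset ℕ} {N j : ℕ} (hN : N ∈ S) (hj : j ∈ S) (hjN : j < N)
include hN hj hjN

theorem hweight_toggle (s : Bool × Bool) :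
    hweight p (toggle p A S N j s).1 (toggle p A S N j s).2 = hweight p A S := by
  have hj' : j ∈ S.erase N := Finset.mem_erase.2 ⟨hjN.ne, hj⟩
  rcases s with ⟨_ | _, _ | _⟩
  · rfl
  · exact hweight_remove₁ A hj
  · exact hweight_remove₀ A hN
  · exact (hweight_remove₁ _ hj').trans (hweight_remove₀ A hN)

/-- `ξ_{N+1}` marks the top index as well as `τ_{N+1}` does, and `ξ_j ^ p` marks the bottom index as
well as `τ_{j+1}` does. Because `j < N`, nothing changes below `j` or above `N + 1`. -/
theorem hasTopBot_toggle (ht : TopLE A S N) (hb : IsBot p A S j) (s : Bool × Bool) :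
    HasTopBot p (toggle p A S N j s).1 (toggle p A S N j s).2 N j := by
  have h1 : ∀ n i c, N + 1 < n → i ≤ N + 1 → Finsupp.single i c n = 0 := fun n i c h h' =>
    Finsupp.single_eq_of_ne (by omega)
  have h2 : ∀ n i c, n < j → j ≤ i → Finsupp.single i c n = 0 := fun n i c h h' =>
    Finsupp.single_eq_of_ne (by omega)
  have h3 : ∀ n, N + 1 < n → Finsupp.single j p n = 0 := fun n hn => h1 n j p hn (by omega)
  have h4 : ∀ n, N + 1 < n → Finsupp.single (N + 1) 1 n = 0 := fun n hn => h1 n _ 1 hn le_rfl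
  have h5 : ∀ n, n < j → Finsupp.single (N + 1) 1 n = 0 := fun n hn => h2 n _ 1 hn (by omega)
  have h6 : ∀ n, n < j → Finsupp.single j p n = 0 := fun n hn => h2 n _ p hn le_rfl
  rcases s with ⟨_ | _, _ | _⟩
  · exact ⟨ht, Or.inr hN, hb, hjN⟩
  · refine ⟨⟨fun n hn => ?_, fun n hn => ht.2 n (Finset.mem_of_mem_erase hn)⟩,
      Or.inr (Finset.mem_erase.2 ⟨hjN.ne', hN⟩), ⟨Or.inl (by simp [toggle]), fun n hn => ⟨?_,
        fun h => (hb.2 n hn).2 (Finset.mem_of_mem_erase h)⟩⟩, hjN⟩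
    · simp [toggle, ht.1 n hn, h3 n hn]
    · simpa [toggle, h6 n hn] using (hb.2 n hn).1
  · refine ⟨⟨fun n hn => ?_, fun n hn => ht.2 n (Finset.mem_of_mem_erase hn)⟩,
      Or.inl (by simp [toggle]), ⟨Or.inr (Finset.mem_erase.2 ⟨hjN.ne, hj⟩), fun n hn => ⟨?_,
        fun h => (hb.2 n hn).2 (Finset.mem_of_mem_erase h)⟩⟩, hjN⟩
    · simp [toggle, ht.1 n hn, h4 n hn]
    · simpa [toggle, h5 n hn] using (hb.2 n hn).1
  · refine ⟨⟨fun n hn => ?_, fun n hn =>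
        ht.2 n (Finset.mem_of_mem_erase (Finset.mem_of_mem_erase hn))⟩,
      Or.inl (by simp [toggle]), ⟨Or.inl (by simp [toggle]), fun n hn => ⟨?_,
        fun h => (hb.2 n hn).2 (Finset.mem_of_mem_erase (Finset.mem_of_mem_erase h))⟩⟩, hjN⟩
    · simp [toggle, ht.1 n hn, h3 n hn, h4 n hn]
    · simpa [toggle, h5 n hn, h6 n hn] using (hb.2 n hn).1

theorem mem_toggle (s : Bool × Bool) : (N ∈ (toggle p A S N j s).2 ↔ s.1 = false) ∧
    (j ∈ (toggle p A S N j s).2 ↔ s.2 = false) := by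
  rcases s with ⟨_ | _, _ | _⟩ <;> simp [toggle, hN, hj, hjN.ne, hjN.ne']

/-- For known `N` and `j`, the presence of `τ_{N+1}` and `τ_{j+1}` tells which exchanges were made,
and they can be undone. -/
theorem toggle_injective {A' : ℕ →₀ ℕ} {S' : Finset ℕ} (hN' : N ∈ S') (hj' : j ∈ S')
    {s s' : Bool × Bool} (h : toggle p A S N j s = toggle p A' S' N j s') :
    A = A' ∧ S = S' ∧ s = s' := by
  have h1 := mem_toggle (p := p) (A := A) hN hj hjN s
  have h2 := mem_toggle (p := p) (A := A') hN' hj' hjN s'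
  rw [h] at h1
  have e1 : s.1 = s'.1 := by
    have := h1.1.symm.trans h2.1
    revert this; cases s.1 <;> cases s'.1 <;> simp
  have e2 : s.2 = s'.2 := by
    have := h1.2.symm.trans h2.2
    revert this; cases s.2 <;> cases s'.2 <;> simp
  have e : s = s' := Prod.ext e1 e2
  subst e
  have hS : ∀ {T T' : Finset ℕ} {n : ℕ}, n ∈ T → n ∈ T' → T.erase n = T'.erase n → T = T' :=
    fun h h' he => by rw [← Finset.insert_erase h, he, Finset.insert_erase h']
  refine ⟨?_, ?_, rfl⟩
  · have := congrArg Prod.fst h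
    rcases s with ⟨_ | _, _ | _⟩ <;> simpa [toggle] using this
  · have := congrArg Prod.snd h
    rcases s with ⟨_ | _, _ | _⟩
    · exact this
    · exact hS hj hj' this
    · exact hS hN hN' this
    · exact hS hN hN' (hS (Finset.mem_erase.2 ⟨hjN.ne, hj⟩) (Finset.mem_erase.2 ⟨hjN.ne, hj'⟩) this)

end Toggle

variable (p) in
/-- An enumeration `z` of the generators of the free part in weight `k`, with their top and
bottom indices, where the lightning flash has `m` generators. -/
structure GenEnum (k m n : ℕ) where
  z : Fin n → (ℕ →₀ ℕ) × Finset ℕ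
  top : Fin n → ℕ
  bot : Fin n → ℕ
  nonterminal : ∀ i < m, ∃ l, p ≤ chain p k i l
  terminal : ∀ l, chain p k m l < p
  injective : Function.Injective z
  hweight_z : ∀ l, hweight p (z l).1 (z l).2 = k
  topLE : ∀ l, TopLE (z l).1 (z l).2 (top l)
  isBot : ∀ l, IsBot p (z l).1 (z l).2 (bot l)
  bot_lt_top : ∀ l, bot l < top l
  top_mem : ∀ l, top l ∈ (z l).2
  bot_mem : ∀ l, bot l ∈ (z l).2
  exists_eq : ∀ A S, hweight p A S = k → IsFreeGen p A S → ∃ l, z l = (A, S)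

/-- Here `ξ_0` must have positive weight. The weight `k` bounds every exponent, and `n < p ^ n`
bounds every index. -/
theorem finite_hweight_eq (hp : 1 < p) (k : ℕ) :
    {μ : (ℕ →₀ ℕ) × Finset ℕ | hweight p μ.1 μ.2 = k}.Finite := by
  refine Set.Finite.subset (Finset.finite_toSet ((Finset.finsupp (Finset.range (k + 1))
    fun _ => Finset.range (k + 1)) ×ˢ (Finset.range (k + 1)).powerset)) ?_
  rintro ⟨A, S⟩ h
  change hweight p A S = k at h
  rw [Finset.mem_coe, Finset.mem_product, Finset.mem_powerset, Finset.mem_finsupp_iff]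
  have hA : ∀ n, A n * p ^ n ≤ k := by
    intro n
    rcases Nat.eq_zero_or_pos (A n) with h0 | h0
    · simp [h0]
    · rw [← h]
      refine le_trans ?_ (Nat.le_add_right _ _)
      exact Finset.single_le_sum (f := fun n => A n * p ^ n) (fun _ _ => Nat.zero_le _)
        (Finsupp.mem_support_iff.2 h0.ne')
  refine ⟨⟨fun n (hn : n ∈ A.support) => ?_, fun n _ => show A n ∈ _ from ?_⟩, fun n hn => ?_⟩
  · have h1 := Nat.lt_pow_self hp (n := n)
    have h2 : p ^ n ≤ A n * p ^ n :=
      Nat.le_mul_of_pos_left _ (Nat.pos_of_ne_zero (Finsupp.mem_support_iff.1 hn))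
    exact Finset.mem_range.2 (by have := hA n; omega)
  · have h2 := Nat.le_mul_of_pos_right (A n) (pow_pos (zero_lt_one.trans hp) n)
    exact Finset.mem_range.2 (by have := hA n; omega)
  · have h1 := Nat.lt_pow_self hp (n := n + 1)
    have h2 : p ^ (n + 1) ≤ k := by
      rw [← h]
      refine le_trans ?_ (Nat.le_add_left _ _)
      exact Finset.single_le_sum (f := fun n => p ^ (n + 1)) (fun _ _ => Nat.zero_le _) hn
    exact Finset.mem_range.2 (by omega)

theorem exists_genEnum [hp : Fact p.Prime] (k : ℕ) :
    ∃ n, Nonempty (GenEnum p k (padicValNat p k.factorial) n) := by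
  have hfin : {μ : (ℕ →₀ ℕ) × Finset ℕ | hweight p μ.1 μ.2 = k ∧ IsFreeGen p μ.1 μ.2}.Finite :=
    (finite_hweight_eq hp.out.one_lt k).subset fun μ hμ => hμ.1
  have e := hfin.toFinset.equivFin.symm
  have he : ∀ l, hweight p (e l).1.1 (e l).1.2 = k ∧ IsFreeGen p (e l).1.1 (e l).1.2 := fun l =>
    hfin.mem_toFinset.1 (e l).2
  choose N j h1 h2 h3 h4 h5 using fun l => (he l).2
  obtain ⟨c1, c2⟩ := exists_chain_length (p := p) k
  exact ⟨_, ⟨{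
    z := fun l => (e l).1
    top := N
    bot := j
    nonterminal := c1
    terminal := c2
    injective := fun l l' h => e.injective (Subtype.ext h)
    hweight_z := fun l => (he l).1
    topLE := h1
    isBot := h2
    bot_lt_top := h3
    top_mem := h4
    bot_mem := h5
    exists_eq := fun A S hw hg => by
      obtain ⟨l, hl⟩ := e.surjective ⟨(A, S), hfin.mem_toFinset.2 ⟨hw, hg⟩⟩
      exact ⟨l, congrArg Subtype.val hl⟩ }⟩⟩

namespace GenEnum

variable {k m n : ℕ} (E : GenEnum p k m n)

/-- The leading monomials of the basis of the Brown–Gitler comodule. -/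
def lead : FlashIndex m n → (ℕ →₀ ℕ) × Finset ℕ
  | Sum.inl (Sum.inl i) => ((carry p (chain p k i)).1, {(carry p (chain p k i)).2})
  | Sum.inl (Sum.inr i) => (chain p k i, ∅)
  | Sum.inr ⟨l, s⟩ => toggle p (E.z l).1 (E.z l).2 (E.top l) (E.bot l) s

include E in
theorem nonterminal_le (i : Fin m) : ∀ l ≤ i.val, ∃ n, p ≤ chain p k l n := fun l hl =>
  E.nonterminal l (hl.trans_lt i.2)

include E in
theorem nonterminal_lt (i : Fin (m + 1)) : ∀ l < i.val, ∃ n, p ≤ chain p k l n := fun l hl =>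
  E.nonterminal l (hl.trans_le (Nat.le_of_lt_succ i.2))

theorem hweight_lead (i : FlashIndex m n) :
    hweight p (E.lead i).1 (E.lead i).2 = k := by
  rcases i with (i | i) | ⟨l, s⟩
  · exact (carry_chain (E.nonterminal_le i)).1
  · exact (chain_add k i (E.nonterminal_lt i)).1
  · exact (hweight_toggle (E.top_mem l) (E.bot_mem l) (E.bot_lt_top l) s).trans (E.hweight_z l)

include E in
-- The number of factors drops by `p - 1 > 0` at each carry, so it determines the position.
theorem chain_injective (hp : 1 < p) (i j : Fin (m + 1)) (h : chain p k i = chain p k j) :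
    i = j := by
  have h1 := (chain_add k i (E.nonterminal_lt i)).2
  have h2 := (chain_add k j (E.nonterminal_lt j)).2
  rw [h] at h1
  obtain ⟨q, rfl⟩ : ∃ q, p = q + 2 := ⟨p - 2, by omega⟩
  have h3 : (i : ℕ) * (q + 1) = j * (q + 1) := by
    have : ∀ x : ℕ, x * (q + 2) = x * (q + 1) + x := fun x => by ring
    rw [this] at h1 h2
    omega
  exact Fin.ext (Nat.eq_of_mul_eq_mul_right q.succ_pos h3)

/-- Members of a quadruple have bottom index below top index, and the monomials of the zigzag do
not. A monomial determines both indices, hence its generator and its place in the quadruple; within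
the zigzag, the number of factors separates. -/
theorem lead_injective (hp : 1 < p) : Function.Injective E.lead := by
  have htb : ∀ l s, HasTopBot p (E.lead (Sum.inr ⟨l, s⟩)).1 (E.lead (Sum.inr ⟨l, s⟩)).2
      (E.top l) (E.bot l) := fun l s =>
    hasTopBot_toggle (E.top_mem l) (E.bot_mem l) (E.bot_lt_top l) (E.topLE l) (E.isBot l) s
  have hfl : ∀ i l s, E.lead (Sum.inl i) ≠ E.lead (Sum.inr ⟨l, s⟩) := by
    intro i l s h
    have := htb l s
    rw [← h] at this
    rcases i with i | i
    · exact not_hasTopBot_carry (E.nonterminal_le i) _ _ this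
    · exact not_hasTopBot_chain (E.nonterminal_lt i) _ _ this
  rintro ((i | i) | ⟨l, s⟩) ((i' | i') | ⟨l', s'⟩) h
  · have e : chain p k i = chain p k i' := by
      rw [(carry_spec (E.nonterminal_le i i le_rfl)).1,
        (carry_spec (E.nonterminal_le i' i' le_rfl)).1]
      have h1 : (carry p (chain p k i)).1 = (carry p (chain p k i')).1 := (Prod.mk.inj h).1
      have h2 : (carry p (chain p k i)).2 = (carry p (chain p k i')).2 :=
        Finset.singleton_injective (Prod.mk.inj h).2
      rw [h1, h2]
    have := E.chain_injective hp i.castSucc i'.castSucc e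
    rw [Fin.castSucc_injective m this]
  · exact absurd (congrArg Prod.snd h) (Finset.singleton_ne_empty _)
  · exact absurd h (hfl _ _ _)
  · exact absurd (congrArg Prod.snd h).symm (Finset.singleton_ne_empty _)
  · rw [E.chain_injective hp i i' (congrArg Prod.fst h)]
  · exact absurd h (hfl _ _ _)
  · exact absurd h.symm (hfl _ _ _)
  · exact absurd h.symm (hfl _ _ _)
  · have h1 := htb l s
    rw [h] at h1
    obtain ⟨e1, e2⟩ := h1.unique (htb l' s')
    have h2 : toggle p (E.z l).1 (E.z l).2 (E.top l) (E.bot l) s =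
      toggle p (E.z l').1 (E.z l').2 (E.top l') (E.bot l') s' := h
    rw [← e1, ← e2] at h2
    obtain ⟨h3, h4, h5⟩ := toggle_injective (E.top_mem l) (E.bot_mem l) (E.bot_lt_top l)
      (e1 ▸ E.top_mem l') (e2 ▸ E.bot_mem l') h2
    rw [E.injective (Prod.ext h3 h4), h5]

end GenEnum

/-! ### The homogeneous basis of the Brown–Gitler comodule -/

theorem hzGr_smul_mem {d e : ℤ × ℤ} {m : Coeff F p} (hm : m ∈ Coeff.gr F p e) {x : HZ F p}
    (hx : x ∈ hzGr F p d) : m • x ∈ hzGr F p (e + d) := fun μ =>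
  Coeff.mul_mem_gr' hm (hx μ) (by abel)

variable (F p) in
/-- The monomial basis. -/
def mono (μ : MonoIndex) : HZ F p := Finsupp.single μ 1

theorem mono_mem_hzGr (μ : MonoIndex) : mono F p μ ∈ hzGr F p (monoDeg p μ) := by
  intro ν
  rw [mono, Finsupp.single_apply]
  split_ifs with h
  · rw [h, sub_self]; exact Coeff.one_mem_gr
  · exact zero_mem _

theorem hspan_mono_le (d : ℤ × ℤ) : hspan F p (mono F p) (monoDeg p) d ≤ hzGr F p d :=
  gspan_le fun μ m hm => by
    have := hzGr_smul_mem hm (mono_mem_hzGr (F := F) μ)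
    rwa [sub_add_cancel] at this

theorem hmon_mem_hspan_mono (A : ℕ →₀ ℕ) (S : Finset ℕ) :
    hmon F p A S ∈ hspan F p (mono F p) (monoDeg p) (hdeg p A S) :=
  mem_hspan (v := mono F p) (deg := monoDeg p) (dehom A, S)

theorem hzAct_Q₀_hmon_mem (A : ℕ →₀ ℕ) (S : Finset ℕ) :
    hzAct (Q₀ F p) (hmon F p A S) ∈
      hspan F p (mono F p) (monoDeg p) (hdeg p A S - tauDeg p 0) := by
  rw [act_Q₀_hmon]
  refine sum_mem fun i hi => zsmul_mem ?_ _
  rw [← hdeg_remove₀ A hi]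
  exact hmon_mem_hspan_mono _ _

theorem hzAct_Q₁_hmon_mem (hF : F.Admissible p) (A : ℕ →₀ ℕ) (S : Finset ℕ) :
    hzAct (Q₁ F p) (hmon F p A S) ∈
      hspan F p (mono F p) (monoDeg p) (hdeg p A S - tauDeg p 1) := by
  obtain ⟨u, hu, he⟩ := act_Q₁_hmon (F := F) (p := p) A S
  rw [he]
  refine add_mem (sum_mem fun i hi => zsmul_mem ?_ _) ?_
  · rw [← hdeg_remove₁ A hi]
    exact hmon_mem_hspan_mono _ _
  · refine smul_mem_hspan' (d := hdeg p A S - tauDeg p 0 - tauDeg p 0)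
      (Coeff.sqCoeff_mem_gr hF) ((AddSubgroup.closure_le _).2 ?_ hu) (by abel)
    rintro _ ⟨i, hi, j, hj, hij, rfl⟩
    have hj' : j ∈ S.erase i := Finset.mem_erase.2 ⟨hij.symm, hj⟩
    rw [SetLike.mem_coe, ← hdeg_remove₀ _ hi, ← hdeg_remove₀ _ hj']
    exact hmon_mem_hspan_mono _ _

theorem hzAct_Q₀_Q₁_hmon_mem (hF : F.Admissible p) (A : ℕ →₀ ℕ) (S : Finset ℕ) :
    hzAct (Q₁ F p) (hzAct (Q₀ F p) (hmon F p A S)) ∈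
      hspan F p (mono F p) (monoDeg p) (hdeg p A S - (tauDeg p 0 + tauDeg p 1)) := by
  rw [act_Q₀_hmon, map_sum]
  refine sum_mem fun i hi => ?_
  rw [map_zsmul, ← sub_sub, ← hdeg_remove₀ A hi]
  exact zsmul_mem (hzAct_Q₁_hmon_mem hF _ _) _

/-- Every monomial of weight at most `k` comes from a homogeneous one of weight `k`. -/
theorem exists_hmon_eq {k : ℕ} {μ : MonoIndex} (hμ : monoWeight p μ ≤ k) :
    ∃ A, hweight p A μ.2 = k ∧ dehom A = μ.1 := by
  have h1 : dehom (μ.1.mapDomain Nat.succ + Finsupp.single 0 (k - monoWeight p μ)) = μ.1 := by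
    ext n
    rw [dehom_apply, Finsupp.add_apply, Finsupp.single_eq_of_ne (by omega), add_zero]
    exact Finsupp.mapDomain_apply Nat.succ_injective _ _
  refine ⟨μ.1.mapDomain Nat.succ + Finsupp.single 0 (k - monoWeight p μ), ?_, h1⟩
  rw [← monoWeight_dehom, h1, Finsupp.add_apply, Finsupp.single_eq_same,
    Finsupp.mapDomain_of_notMem_range _ _ (by simp)]
  change monoWeight p μ + _ = k
  omega

theorem Comodule.act_restrict {N : Comodule F p} {S : Submodule (Coeff F p) N.carrier}
    (hS : ∀ θ : SteenrodE F p, ∀ x ∈ S, N.act θ x ∈ S) (θ : SteenrodE F p) (x : S) :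
    ((N.restrict S hS).act θ x : S).1 = N.act θ x.1 := by
  have h := LeftTensor.eval_map θ.toHom S.subtype (restrictCoact hS x)
  rw [map_restrictCoact] at h
  exact h.symm

namespace GenEnum

variable {k m n : ℕ} (E : GenEnum p k m n)

variable (F) in
/-- The basis of the Brown–Gitler comodule: monomials for the lightning flash, and the images of
the free generators. -/
def fam : FlashIndex m n → HZ F p
  | Sum.inl i => hmon F p (E.lead (Sum.inl i)).1 (E.lead (Sum.inl i)).2
  | Sum.inr ⟨l, (false, false)⟩ => hmon F p (E.z l).1 (E.z l).2
  | Sum.inr ⟨l, (true, false)⟩ => hzAct (Q₀ F p) (hmon F p (E.z l).1 (E.z l).2)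
  | Sum.inr ⟨l, (false, true)⟩ => hzAct (Q₁ F p) (hmon F p (E.z l).1 (E.z l).2)
  | Sum.inr ⟨l, (true, true)⟩ =>
    hzAct (Q₁ F p) (hzAct (Q₀ F p) (hmon F p (E.z l).1 (E.z l).2))

/-- The degrees of the free generators. -/
def genDeg (l : Fin n) : ℤ × ℤ := hdeg p (E.z l).1 (E.z l).2

theorem hzAct_Q₀_hmon_empty (A : ℕ →₀ ℕ) : hzAct (Q₀ F p) (hmon F p A ∅) = 0 := by
  rw [act_Q₀_hmon, Finset.sum_empty]

theorem hzAct_Q₁_hmon_empty (A : ℕ →₀ ℕ) : hzAct (Q₁ F p) (hmon F p A ∅) = 0 := by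
  obtain ⟨u, hu, he⟩ := act_Q₁_hmon (F := F) (p := p) A ∅
  have : u = 0 := by simpa using hu
  rw [he, Finset.sum_empty, this, smul_zero, zero_add]

theorem removalSign_singleton (j : ℕ) : removalSign {j} j = 1 :=
  removalSign_insert_self ∅ j (by simp)

theorem hzAct_Q₀_hmon_singleton (A : ℕ →₀ ℕ) (j : ℕ) :
    hzAct (Q₀ F p) (hmon F p A {j}) = hmon F p (A + Finsupp.single (j + 1) 1) ∅ := by
  rw [act_Q₀_hmon, Finset.sum_singleton, Finset.erase_singleton,
    removalSign_singleton, one_smul]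

theorem hzAct_Q₁_hmon_singleton (A : ℕ →₀ ℕ) (j : ℕ) :
    hzAct (Q₁ F p) (hmon F p A {j}) = hmon F p (A + Finsupp.single j p) ∅ := by
  obtain ⟨u, hu, he⟩ := act_Q₁_hmon (F := F) (p := p) A {j}
  have : u = 0 := by simpa using hu
  rw [he, this, smul_zero, add_zero, Finset.sum_singleton, Finset.erase_singleton,
    removalSign_singleton, one_smul]

theorem hzAct_Q₀_fam (i : FlashIndex m n) : hzAct (Q₀ F p) (E.fam F i) = stdQ₀ (E.fam F) i := by
  rcases i with (i | i) | ⟨l, _ | _, _ | _⟩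
  · exact hzAct_Q₀_hmon_singleton _ _
  · exact hzAct_Q₀_hmon_empty _
  · rfl
  · exact ((hz F p).act_Q₀_Q₁ _).trans (congrArg _ ((hz F p).act_Q₁_Q₀ _).symm)
  · exact (hz F p).act_Q₀_Q₀ _
  · refine ((hz F p).act_Q₀_Q₁ _).trans (neg_eq_zero.2 ?_)
    refine ((hz F p).act_Q₁_Q₀ _).symm.trans ?_
    exact (congrArg ((hz F p).act (Q₁ F p)) ((hz F p).act_Q₀_Q₀ _)).trans (map_zero _)

theorem hzAct_Q₁_fam (i : FlashIndex m n) : hzAct (Q₁ F p) (E.fam F i) = stdQ₁ (E.fam F) i := by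
  rcases i with (i | i) | ⟨l, _ | _, _ | _⟩
  · refine (hzAct_Q₁_hmon_singleton _ _).trans ?_
    exact congrArg (fun B => hmon F p B ∅) (carry_spec (E.nonterminal_le i i le_rfl)).1.symm
  · exact hzAct_Q₁_hmon_empty _
  · rfl
  · exact (hz F p).act_Q₁_Q₁ _
  · rfl
  · exact (hz F p).act_Q₁_Q₁ _

/-- Each step goes back along `Q₁` and forward along `Q₀`, so the degree grows by `|τ₁| - |τ₀|`. -/
theorem hdeg_chain (i : ℕ) (h : ∀ l < i, ∃ n, p ≤ chain p k l n) :
    hdeg p (chain p k i) ∅ = i • ((2 * (p : ℤ) - 2, (p : ℤ) - 1) : ℤ × ℤ) := by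
  induction i with
  | zero =>
    have : dehom (Finsupp.single 0 k) = 0 := by ext i; simp [dehom_apply]
    rw [chain, hdeg, this, zero_smul]
    simp [monoDeg]
  | succ i ih =>
    have h1 := hdeg_remove₀ (p := p) (carry p (chain p k i)).1
      (Finset.mem_singleton_self (carry p (chain p k i)).2)
    have h2 := hdeg_remove₁ (p := p) (carry p (chain p k i)).1
      (Finset.mem_singleton_self (carry p (chain p k i)).2)
    rw [Finset.erase_singleton] at h1 h2
    rw [← (carry_spec (h i i.lt_succ_self)).1, ih fun l hl => h l (hl.trans i.lt_succ_self)] at h2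
    rw [chain, h1, add_smul, h2, one_smul, ← tauDeg_sub]
    abel

theorem hdeg_lead_inl (i : Fin m ⊕ Fin (m + 1)) :
    hdeg p (E.lead (Sum.inl i)).1 (E.lead (Sum.inl i)).2 = flashDeg p i := by
  rcases i with i | i
  · have h1 := hdeg_remove₀ (p := p) (carry p (chain p k i)).1
      (Finset.mem_singleton_self (carry p (chain p k i)).2)
    rw [Finset.erase_singleton] at h1
    have h2 := hdeg_chain (p := p) (k := k) (i + 1)
      fun l hl => E.nonterminal_le i l (Nat.le_of_lt_succ hl)
    rw [chain, h1] at h2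
    have h3 := flashDeg_succ (p := p) i
    refine sub_left_injective (b := tauDeg p 0) ?_
    exact h2.trans h3
  · exact hdeg_chain i (E.nonterminal_lt i)

theorem fam_mem_hspan_mono (hF : F.Admissible p) (i : FlashIndex m n) :
    E.fam F i ∈ hspan F p (mono F p) (monoDeg p) (stdDeg p E.genDeg i) := by
  rcases i with i | ⟨l, _ | _, _ | _⟩
  · change _ ∈ hspan F p (mono F p) (monoDeg p) (flashDeg p i)
    rw [← E.hdeg_lead_inl]
    exact hmon_mem_hspan_mono _ _
  all_goals simp only [fam, stdDeg, genDeg, Comodule.loss]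
  · simpa using hmon_mem_hspan_mono _ _
  · simpa using hzAct_Q₁_hmon_mem hF _ _
  · simpa using hzAct_Q₀_hmon_mem _ _
  · simpa using hzAct_Q₀_Q₁_hmon_mem hF _ _

theorem hmon_mem_weightLE {A : ℕ →₀ ℕ} {S : Finset ℕ} (h : hweight p A S = k) :
    hmon F p A S ∈ weightLE F p k :=
  Submodule.subset_span ⟨_, by rw [← h, ← monoWeight_dehom]; exact Nat.le_add_right _ _, rfl⟩

theorem fam_mem_weightLE (i : FlashIndex m n) : E.fam F i ∈ weightLE F p k := by
  have hq := fun u hu θ => eval_mem_weightLE (F := F) (p := p) k u hu θ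
  rcases i with i | ⟨l, _ | _, _ | _⟩
  · exact hmon_mem_weightLE (E.hweight_lead _)
  · exact hmon_mem_weightLE (E.hweight_z l)
  · exact hq _ (hmon_mem_weightLE (E.hweight_z l)) (Q₁ F p)
  · exact hq _ (hmon_mem_weightLE (E.hweight_z l)) (Q₀ F p)
  · exact hq _ (hq _ (hmon_mem_weightLE (E.hweight_z l)) (Q₀ F p)) (Q₁ F p)

/-- All monomials are homogeneous combinations of the family. -/
theorem hmon_mem_hspan_fam (hp : p.Prime) (hF : F.Admissible p) (A : ℕ →₀ ℕ) (S : Finset ℕ)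
    (hw : hweight p A S = k) :
    hmon F p A S ∈ hspan F p (E.fam F) (stdDeg p E.genDeg) (hdeg p A S) := by
  have hc := Comodule.act_std_mem_hspan (N := hz F p) (b := E.fam F) E.hzAct_Q₀_fam E.hzAct_Q₁_fam
    E.genDeg
  refine hmon_mem (H := fun d => hspan F p (E.fam F) (stdDeg p E.genDeg) d) (k := k) hp hF
    (fun d e m hm x hx => smul_mem_hspan hm hx)
    (Comodule.act_Q₀_mem_hspan (N := hz F p) (v := E.fam F) hF (fun i => (hc i).1)
      (fun i => (hc i).2.1) fun i => (hc i).2.2)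
    (Comodule.act_Q₁_mem_hspan (N := hz F p) (v := E.fam F) hF (fun i => (hc i).1)
      (fun i => (hc i).2.1) fun i => (hc i).2.2) ?_ ?_ ?_ A S hw
  · intro A S hw hg
    obtain ⟨l, hl⟩ := E.exists_eq A S hw hg
    have := mem_hspan' (F := F) (p := p) (v := E.fam F) (deg := stdDeg p E.genDeg)
      (d := hdeg p A S) (Sum.inr ⟨l, (false, false)⟩)
      (by simp [stdDeg, genDeg, Comodule.loss, hl])
    simpa only [fam, hl] using this
  · have := mem_hspan' (F := F) (p := p) (v := E.fam F) (deg := stdDeg p E.genDeg)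
      (Sum.inl (Sum.inr 0)) (E.hdeg_lead_inl (Sum.inr 0)).symm
    exact this
  · intro A N hw ht hb
    obtain ⟨i, hi, he⟩ := eq_carry_chain hp.one_lt E.terminal hw ht hb
    have := mem_hspan' (F := F) (p := p) (v := E.fam F) (deg := stdDeg p E.genDeg)
      (Sum.inl (Sum.inl ⟨i, hi⟩)) (E.hdeg_lead_inl (Sum.inl ⟨i, hi⟩)).symm
    simpa only [fam, lead, he] using this

theorem weightLE_le_span (hp : p.Prime) (hF : F.Admissible p) :
    weightLE F p k ≤ Submodule.span (Coeff F p) (Set.range (E.fam F)) := by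
  refine Submodule.span_le.2 ?_
  rintro _ ⟨μ, hμ, rfl⟩
  obtain ⟨A, hw, hA⟩ := exists_hmon_eq hμ
  have := gspan_le_span _ (E.hmon_mem_hspan_fam hp hF A μ.2 hw)
  rw [hmon, hA] at this
  exact this

/-- The graded form of spanning: the coefficients of `x` in the monomials are homogeneous of
complementary degree, and each monomial is a homogeneous combination of the family. -/
theorem mem_hspan_fam (hp : p.Prime) (hF : F.Admissible p) {d : ℤ × ℤ} {x : HZ F p}
    (hx : x ∈ hzGr F p d) (hk : x ∈ weightLE F p k) :
    x ∈ hspan F p (E.fam F) (stdDeg p E.genDeg) d := by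
  rw [weightLE_eq, Finsupp.mem_supported] at hk
  rw [← x.sum_single, Finsupp.sum]
  refine sum_mem fun μ hμ => ?_
  obtain ⟨A, hw, hA⟩ := exists_hmon_eq (hk hμ)
  have := smul_mem_hspan' (c := d) (hx μ) (E.hmon_mem_hspan_fam hp hF A μ.2 hw)
    (by rw [hdeg, hA]; exact sub_add_cancel _ _)
  rwa [hmon, hA, Finsupp.smul_single, smul_eq_mul, mul_one] at this

variable (F) in
/-- The family as a family in the Brown–Gitler comodule. -/
def bgFam (i : FlashIndex m n) : weightLE F p k := ⟨E.fam F i, E.fam_mem_weightLE i⟩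

theorem top_le_span_bgFam (hp : p.Prime) (hF : F.Admissible p) :
    ⊤ ≤ Submodule.span (Coeff F p) (Set.range (E.bgFam F)) := by
  rintro x -
  have h : Submodule.map (weightLE F p k).subtype
      (Submodule.span (Coeff F p) (Set.range (E.bgFam F))) =
      Submodule.span (Coeff F p) (Set.range (E.fam F)) := by
    rw [Submodule.map_span, ← Set.range_comp]
    rfl
  have hx := E.weightLE_le_span hp hF x.2
  rw [← h] at hx
  obtain ⟨y, hy, hyx⟩ := hx
  rwa [← Subtype.ext (a1 := y) (a2 := x) hyx]

variable (F) in
/-- The leading monomials are linearly independent. -/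
def leadFam (i : FlashIndex m n) : weightLE F p k :=
  ⟨hmon F p (E.lead i).1 (E.lead i).2, hmon_mem_weightLE (E.hweight_lead i)⟩

theorem linearIndependent_leadFam (hp : 1 < p) :
    LinearIndependent (Coeff F p) (E.leadFam F) := by
  refine LinearIndependent.of_comp (weightLE F p k).subtype ?_
  refine (Finsupp.linearIndependent_single_one (Coeff F p) MonoIndex).comp
    (fun i : FlashIndex m n => (dehom (E.lead i).1, (E.lead i).2)) fun i j h => ?_
  refine E.lead_injective hp ?_
  obtain ⟨h1, h2⟩ := Prod.mk.inj h
  have hi := monoWeight_dehom (p := p) (E.lead i).1 (E.lead i).2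
  have hj := monoWeight_dehom (p := p) (E.lead j).1 (E.lead j).2
  rw [E.hweight_lead] at hi hj
  -- The exponent of `ξ_0`, which `dehom` forgets, is recovered from the common weight `k`.
  refine Prod.ext (Finsupp.ext fun l => ?_) h2
  cases l with
  | zero => rw [h1, h2] at hi; omega
  | succ l => exact DFunLike.congr_fun h1 l

/-- Orzech's theorem: the free module on `FlashIndex m n` maps onto `B_0(k)` by the family and into
it by the leading monomials, and this forces the surjection to be injective. No expansion of the
family in leading monomials is needed. -/
theorem linearIndependent_bgFam (hp : p.Prime) (hF : F.Admissible p) :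
    LinearIndependent (Coeff F p) (E.bgFam F) := by
  have hs : Function.Surjective (Finsupp.linearCombination (Coeff F p) (E.bgFam F)) := by
    rw [← LinearMap.range_eq_top, Finsupp.range_linearCombination]
    exact top_le_iff.1 (E.top_le_span_bgFam hp hF)
  have := Module.Finite.of_surjective _ hs
  exact OrzechProperty.injective_of_surjective_of_injective _ _
    (E.linearIndependent_leadFam hp.one_lt) hs

/-- The homogeneous basis of the Brown–Gitler comodule. -/
def bgBasis (hp : p.Prime) (hF : F.Admissible p) :
    Comodule.HomBasis (brownGitler F p k) (FlashIndex m n) :=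
  Comodule.HomBasis.mk' (N := brownGitler F p k) (E.bgFam F) (stdDeg p E.genDeg)
    (E.linearIndependent_bgFam hp hF) (E.top_le_span_bgFam hp hF) (fun d x => by
      have h1 : hspan F p (E.fam F) (stdDeg p E.genDeg) d ≤
          (hspan F p (E.bgFam F) (stdDeg p E.genDeg) d).map
            (weightLE F p k).subtype.toAddMonoidHom :=
        gspan_le fun i m hm => ⟨m • E.bgFam F i, smul_mem_gspan i hm, rfl⟩
      have h2 : hspan F p (E.bgFam F) (stdDeg p E.genDeg) d ≤
          (hzGr F p d).comap (weightLE F p k).subtype.toAddMonoidHom :=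
        gspan_le fun i m hm => hspan_mono_le d
          (smul_mem_hspan' hm (E.fam_mem_hspan_mono hF i) (sub_add_cancel _ _))
      refine ⟨fun hx => ?_, fun hx => h2 hx⟩
      obtain ⟨y, hy, hyx⟩ := h1 (E.mem_hspan_fam hp hF (show (x : weightLE F p k).1 ∈ _ from hx)
        (x : weightLE F p k).2)
      rwa [← Subtype.ext (a1 := y) (a2 := x) hyx])

theorem bgBasis_basis (hp : p.Prime) (hF : F.Admissible p) (i : FlashIndex m n) :
    (E.bgBasis hp hF).basis i = E.bgFam F i := Comodule.HomBasis.mk'_basis _ _ _ _ _ _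

variable (F p k) in
/-- The inclusion of the Brown–Gitler comodule. -/
def subtypeHom : (brownGitler F p k).carrier →+ HZ F p :=
  (weightLE F p k).subtype.toAddMonoidHom

theorem act_brownGitler (θ : SteenrodE F p) (x : weightLE F p k) :
    ((brownGitler F p k).act θ x : weightLE F p k).1 = hzAct θ x.1 :=
  Comodule.act_restrict (N := hz F p) (S := weightLE F p k)
    (fun θ u hu => eval_mem_weightLE k u hu θ) θ x

theorem act_bgBasis (hp : p.Prime) (hF : F.Admissible p) (i : FlashIndex m n) :
    (brownGitler F p k).act (Q₀ F p) ((E.bgBasis hp hF).basis i) =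
      stdQ₀ (E.bgBasis hp hF).basis i ∧
    (brownGitler F p k).act (Q₁ F p) ((E.bgBasis hp hF).basis i) =
      stdQ₁ (E.bgBasis hp hF).basis i := by
  have h : ∀ i, subtypeHom F p k ((E.bgBasis hp hF).basis i) =
    E.fam F i := fun i => by rw [bgBasis_basis]; rfl
  constructor
  · refine Subtype.ext ?_
    refine (act_brownGitler _ _).trans ?_
    rw [bgBasis_basis]
    refine (E.hzAct_Q₀_fam i).trans (map_stdQ₀ (subtypeHom F p k) h i).symm
  · refine Subtype.ext ?_
    refine (act_brownGitler _ _).trans ?_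
    rw [bgBasis_basis]
    refine (E.hzAct_Q₁_fam i).trans (map_stdQ₁ (subtypeHom F p k) h i).symm

end GenEnum

/-! ### The lightning flash module -/

open MulOpposite

/-- A comodule as a right module over `E(1)`. -/
@[reducible] def Comodule.rightModule (N : Comodule F p) : Module (SteenrodE F p)ᵐᵒᵖ N.carrier where
  smul θ x := N.act θ.unop x
  one_smul x := N.act_one x
  mul_smul θ φ x := N.act_mul φ.unop θ.unop x
  smul_zero θ := map_zero (N.act θ.unop)
  smul_add θ := map_add (N.act θ.unop)
  add_smul θ φ x := N.act_add θ.unop φ.unop x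
  zero_smul x := LeftTensor.hom_ext (f := LeftTensor.eval (0 : SteenrodE F p).toHom) (g := 0)
    (fun _ _ => zero_smul _ _) (N.coact x)

section lightning

variable {m : ℕ}

variable (F p m) in
/-- The projection to the module with generators `x_i`. -/
def lightningMk : (Fin m → SteenrodE F p) →ₗ[(SteenrodE F p)ᵐᵒᵖ] LightningModule F p m :=
  (lightningRel F p m).mkQ

variable (F p) in
/-- The generators of the lightning flash. -/
def lightningX (i : Fin m) : LightningModule F p m := lightningMk F p m (lightningGen F p m i)

theorem lightningMk_single (i : Fin m) (θ : SteenrodE F p) :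
    lightningMk F p m (Pi.single i θ) = op θ • lightningX F p i := by
  rw [lightningX, ← map_smul, lightningGen, ← Pi.single_smul', op_smul_eq_mul, one_mul]

theorem lightningMk_apply (θ : Fin m → SteenrodE F p) :
    lightningMk F p m θ = ∑ i, op (θ i) • lightningX F p i := by
  simp only [← lightningMk_single, ← map_sum, Finset.univ_sum_single]

theorem op_smul_eq (θ : SteenrodE F p) (x : LightningModule F p m) : op θ • x =
    θ.toHom 1 • x + θ.toHom (t₀ F p) • op (Q₀ F p) • x +
      θ.toHom (t₁ F p) • op (Q₁ F p) • x +
      θ.toHom (t₀ F p * t₁ F p) • op (Q₀ F p * Q₁ F p) • x := by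
  simpa using op_smul_scalar (V := LightningModule F p m) (fun _ _ => rfl) 1 θ x

theorem Q₁_smul_lightningX {i j : Fin m} (h : j.val = i.val + 1) :
    op (Q₁ F p) • lightningX F p j = op (Q₀ F p) • lightningX F p i := by
  rw [← sub_eq_zero]
  exact (Submodule.Quotient.mk_eq_zero (lightningRel F p m)).2
    (Submodule.subset_span (Or.inl ⟨i, j, h, rfl⟩))

/-- For the first generator this is a relation; for the later ones `x_j Q₀ Q₁ = - x_j Q₁ Q₀ = -
x_{j-1} Q₀ Q₀ = 0`. -/
theorem Q₀_mul_Q₁_smul_lightningX (j : Fin m) :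
    op (Q₀ F p * Q₁ F p) • lightningX F p j = 0 := by
  rcases Nat.eq_zero_or_eq_succ_pred j.val with h | h
  · exact (Submodule.Quotient.mk_eq_zero (lightningRel F p m)).2
      (Submodule.subset_span (Or.inr ⟨j, h, rfl⟩))
  · have hi := Q₁_smul_lightningX (F := F) (p := p)
      (i := ⟨j.val.pred, (Nat.pred_le _).trans_lt j.2⟩) h
    rw [← neg_neg (Q₀ F p * Q₁ F p), ← Q₁_mul_Q₀, op_neg, op_mul, neg_smul, mul_smul, hi,
      ← mul_smul, ← op_mul, Q₀_mul_Q₀, op_zero, zero_smul, neg_zero]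

variable (F p) in
/-- The generators of the lightning flash and their images under `Q₀` and `Q₁`. -/
def flashFam : Fin (m + 1) ⊕ Fin (m + 2) → LightningModule F p (m + 1)
  | Sum.inl i => lightningX F p i
  | Sum.inr i => Fin.cases (op (Q₁ F p) • lightningX F p 0)
    (fun i => op (Q₀ F p) • lightningX F p i) i

theorem flashFam_castSucc (i : Fin (m + 1)) :
    flashFam F p (Sum.inr i.castSucc) = op (Q₁ F p) • lightningX F p i := by
  refine Fin.cases rfl (fun j => ?_) i
  exact (Q₁_smul_lightningX (i := j.castSucc) (j := j.succ) rfl).symm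

/-- Every lower cell is the image of a generator under a homogeneous functional: the first one under
`Q₁`, the others under `Q₀`. This brings the two shapes into the form in which `lightningGr` is
defined. -/
theorem flashFam_inr (i : Fin (m + 2)) : ∃ (j : Fin (m + 1)) (θ : SteenrodE F p),
    flashFam F p (Sum.inr i) = op θ • lightningX F p j ∧
      ∀ d, ∀ e ∈ DualE.gr (F := F) (p := p) d, θ.toHom e ∈ Coeff.gr F p (d +
        (flashDeg p (Sum.inr i : Fin (m + 1) ⊕ Fin (m + 2)) - lightningDeg p (j.val + 1))) := by
  refine Fin.cases ⟨0, Q₁ F p, rfl, fun d e he => ?_⟩ (fun j => ⟨j, Q₀ F p, rfl, fun d e he => ?_⟩) i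
  · have h := flashDeg_castSucc (p := p) (0 : Fin (m + 1))
    rw [Fin.castSucc_zero] at h
    rw [h, flashDeg, sub_sub_cancel_left, ← sub_eq_add_neg]
    exact he.2.2.1
  · rw [flashDeg_succ, flashDeg, sub_sub_cancel_left, ← sub_eq_add_neg]
    exact he.2.1

/-- The values of `θ i` on `1, τ₀, τ₁` are the coefficients of the class; the value on `τ₀ τ₁` drops
out because `Q₀ Q₁` kills every generator. -/
theorem lightningMk_mem_gspan {K : Fin (m + 1) ⊕ Fin (m + 2) → AddSubgroup (Coeff F p)}
    {θ : Fin (m + 1) → SteenrodE F p} (h : ∀ i, (θ i).toHom 1 ∈ K (Sum.inl i))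
    (h0 : ∀ i, (θ i).toHom (t₀ F p) ∈ K (Sum.inr i.succ))
    (h1 : ∀ i, (θ i).toHom (t₁ F p) ∈ K (Sum.inr i.castSucc)) :
    lightningMk F p (m + 1) θ ∈ gspan (flashFam F p) K := by
  rw [lightningMk_apply]
  refine sum_mem fun i _ => ?_
  rw [op_smul_eq, Q₀_mul_Q₁_smul_lightningX, smul_zero, add_zero, ← flashFam_castSucc]
  exact add_mem (add_mem (smul_mem_gspan (v := flashFam F p) _ (h i))
    (smul_mem_gspan (v := flashFam F p) _ (h0 i))) (smul_mem_gspan (v := flashFam F p) _ (h1 i))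

theorem lightningMk_surjective : Function.Surjective (lightningMk F p m) :=
  Submodule.mkQ_surjective _

theorem top_le_span_flashFam :
    ⊤ ≤ Submodule.span (Coeff F p) (Set.range (flashFam F p (m := m))) := by
  rintro x -
  obtain ⟨θ, rfl⟩ := lightningMk_surjective x
  exact gspan_le_span (fun _ => ⊤) (lightningMk_mem_gspan (fun _ => AddSubgroup.mem_top _)
    (fun _ => AddSubgroup.mem_top _) fun _ => AddSubgroup.mem_top _)

theorem op_smul_lightningX_mem_gr {d : ℤ × ℤ} {i : Fin m} {θ : SteenrodE F p}
    (h : θ ∈ SteenrodE.gr (F := F) (p := p) (d - lightningDeg p (i.val + 1))) :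
    op θ • lightningX F p i ∈ lightningGr F p m d := by
  refine ⟨Pi.single i θ, fun j _ => ?_, lightningMk_single i θ⟩
  rcases eq_or_ne j i with rfl | hj
  · rwa [Pi.single_eq_same]
  · rw [Pi.single_eq_of_ne hj]; exact zero_mem (SteenrodE.gr _)

theorem smul_flashFam_mem_gr {d : ℤ × ℤ} (i : Fin (m + 1) ⊕ Fin (m + 2)) {c : Coeff F p}
    (hc : c ∈ Coeff.gr F p (d - flashDeg p i)) :
    c • flashFam F p i ∈ lightningGr F p (m + 1) d := by
  obtain ⟨j, θ, h, hθ⟩ : ∃ (j : Fin (m + 1)) (θ : SteenrodE F p),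
      flashFam F p i = op θ • lightningX F p j ∧
      ∀ d, ∀ e ∈ DualE.gr (F := F) (p := p) d, θ.toHom e ∈ Coeff.gr F p (d +
        (flashDeg p i - lightningDeg p (j.val + 1))) := by
    rcases i with i | i
    · refine ⟨i, 1, (one_smul _ _).symm, fun d e he => ?_⟩
      rw [flashDeg, sub_self, add_zero]
      exact he.1
    · exact flashFam_inr i
  rw [h]
  change scalar c • op θ • lightningX F p j ∈ _
  rw [← mul_smul, ← op_unop (scalar c), ← op_mul]
  refine op_smul_lightningX_mem_gr fun b e he => ?_
  -- On this side a scalar acts after `θ`, so it multiplies values and no left unit intervenes.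
  have e1 : (θ * unop (scalar c)).toHom e = c * θ.toHom e := by
    have h1 : (θ * 1).toHom e = (θ.rightAct e).c := rfl
    rw [mul_one] at h1
    rw [toHom_mul, toHom_scalar, h1]
  rw [e1]
  exact Coeff.mul_mem_gr' hc (hθ b e he) (by abel)

theorem mem_lightningGr_iff {d : ℤ × ℤ} {x : LightningModule F p (m + 1)} :
    x ∈ lightningGr F p (m + 1) d ↔ x ∈ hspan F p (flashFam F p) (flashDeg p) d := by
  constructor
  · rintro ⟨θ, hθ, rfl⟩
    have h : ∀ i, ∀ c, ∀ e ∈ DualE.gr c, (θ i).toHom e ∈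
      Coeff.gr F p (c + (d - lightningDeg p (i.val + 1))) := fun i => hθ i trivial
    refine lightningMk_mem_gspan (fun i => ?_) (fun i => ?_) fun i => ?_
    · have := h i _ _ DualE.one_mem_gr
      rwa [zero_add] at this
    · rw [flashDeg_succ, sub_sub_eq_add_sub, add_comm, add_sub_assoc]
      exact h i _ _ t₀_mem_gr
    · rw [flashDeg_castSucc, sub_sub_eq_add_sub, add_comm, add_sub_assoc]
      exact h i _ _ t₁_mem_gr
  · intro hx
    suffices h : hspan F p (flashFam F p) (flashDeg p) d ≤ lightningGr F p (m + 1) d from h hx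
    exact gspan_le fun i c hc => smul_flashFam_mem_gr i hc

variable {N : Comodule F p} {X : Fin m → N.carrier}
  (hX : ∀ i j : Fin m, j.val = i.val + 1 → N.act (Q₁ F p) (X j) = N.act (Q₀ F p) (X i))
  (hX0 : ∀ i : Fin m, i.val = 0 → N.act (Q₀ F p * Q₁ F p) (X i) = 0)

variable (N X) in
/-- The map from the free module with given values on generators. -/
def freeLift : letI := N.rightModule
    (Fin m → SteenrodE F p) →ₗ[(SteenrodE F p)ᵐᵒᵖ] N.carrier :=
  letI := N.rightModule
  { toFun := fun θ => ∑ i, op (θ i) • X i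
    map_add' := fun θ φ => by
      simp only [Pi.add_apply, op_add, add_smul, Finset.sum_add_distrib]
    map_smul' := fun θ φ => by
      simp only [Pi.smul_apply, Finset.smul_sum, RingHom.id_apply, ← mul_smul]
      rfl }

theorem freeLift_smul_gen (θ : SteenrodE F p) (i : Fin m) :
    freeLift N X (op θ • lightningGen F p m i) = N.act θ (X i) := by
  let := N.rightModule
  refine (map_smul (freeLift N X) _ _).trans (congrArg (N.act θ) ?_)
  refine (Finset.sum_eq_single i (fun j _ hj => ?_)
    fun h => absurd (Finset.mem_univ i) h).trans ?_
  · rw [lightningGen, Pi.single_eq_of_ne hj, op_zero, zero_smul]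
  · rw [lightningGen, Pi.single_eq_same, op_one, one_smul]

include hX hX0 in
-- The universal property of the flash: elements of any comodule that satisfy the defining relations
-- receive a map from it.
theorem lightningRel_le_ker : letI := N.rightModule
    lightningRel F p m ≤ LinearMap.ker (freeLift N X) := by
  let := N.rightModule
  refine Submodule.span_le.2 ?_
  rintro _ (⟨i, j, h, rfl⟩ | ⟨i, h, rfl⟩)
  · rw [SetLike.mem_coe, LinearMap.mem_ker, map_sub, freeLift_smul_gen, freeLift_smul_gen,
      hX i j h, sub_self]
  · rw [SetLike.mem_coe, LinearMap.mem_ker, freeLift_smul_gen, hX0 i h]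

/-- The map from the lightning flash with given values on generators. -/
def lightningLift : LightningModule F p m →ₗ[Coeff F p] N.carrier :=
  letI := N.rightModule
  { toFun := (lightningRel F p m).liftQ (freeLift N X) (lightningRel_le_ker hX hX0)
    map_add' := map_add _
    map_smul' := fun c x => (map_smul ((lightningRel F p m).liftQ (freeLift N X)
      (lightningRel_le_ker hX hX0)) (scalar c) x).trans (N.act_scalar c _) }

theorem lightningLift_smul (θ : SteenrodE F p) (i : Fin m) :
    lightningLift hX hX0 (op θ • lightningX F p i) = N.act θ (X i) :=
  freeLift_smul_gen θ i

end lightning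

theorem act_ofRightModule {V : Type} [AddCommGroup V] [Module (Coeff F p) V]
    [Module (SteenrodE F p)ᵐᵒᵖ V] (hV : ∀ (m : Coeff F p) (x : V), m • x = scalar m • x)
    (gr : ℤ × ℤ → AddSubgroup V) (x : V) :
    (Comodule.ofRightModule hV gr).act (Q₀ F p) x = op (Q₀ F p) • x ∧
      (Comodule.ofRightModule hV gr).act (Q₁ F p) x = op (Q₁ F p) • x := by
  have h : ∀ θ : SteenrodE F p, LeftTensor.eval θ.toHom (coactOfRight x) = θ.toHom 1 • x +
      θ.toHom (t₀ F p) • op (Q₀ F p) • x + θ.toHom (t₁ F p) • op (Q₁ F p) • x +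
      θ.toHom (t₀ F p * t₁ F p) • op (Q₀ F p * Q₁ F p) • x := fun θ => by
    simp only [coactOfRight, map_add, eval_tmul]
  exact ⟨(h _).trans (by simp [t₀, t₁]), (h _).trans (by simp [t₀, t₁])⟩

theorem Q₁_smul_Q₀_smul_lightningX {m : ℕ} (j : Fin m) :
    op (Q₁ F p) • op (Q₀ F p) • lightningX F p j = 0 := by
  rw [← mul_smul, ← op_mul, Q₀_mul_Q₁_smul_lightningX]

theorem Q₀_smul_Q₁_smul_lightningX {m : ℕ} (j : Fin m) :
    op (Q₀ F p) • op (Q₁ F p) • lightningX F p j = 0 := by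
  rw [← mul_smul, ← op_mul, Q₁_mul_Q₀, op_neg, neg_smul, Q₀_mul_Q₁_smul_lightningX, neg_zero]

theorem smul_flashFam_inr {m : ℕ} (i : Fin (m + 2)) :
    op (Q₀ F p) • flashFam F p (Sum.inr i) = 0 ∧ op (Q₁ F p) • flashFam F p (Sum.inr i) = 0 := by
  refine Fin.cases ⟨Q₀_smul_Q₁_smul_lightningX 0, ?_⟩
    (fun j => ⟨?_, Q₁_smul_Q₀_smul_lightningX j⟩) i
  · change op (Q₁ F p) • op (Q₁ F p) • lightningX F p 0 = 0
    rw [← mul_smul, ← op_mul, Q₁_mul_Q₁, op_zero, zero_smul]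
  · change op (Q₀ F p) • op (Q₀ F p) • lightningX F p j = 0
    rw [← mul_smul, ← op_mul, Q₀_mul_Q₀, op_zero, zero_smul]

/-- A homogeneous basis of a lightning flash of the standard form. -/
structure IsFlashBasis {N : Comodule F p} {m : ℕ}
    (B : Comodule.HomBasis N (Fin m ⊕ Fin (m + 1))) : Prop where
  deg_eq : B.deg = flashDeg p
  act_inl : ∀ i, N.act (Q₀ F p) (B.basis (Sum.inl i)) = B.basis (Sum.inr i.succ) ∧
    N.act (Q₁ F p) (B.basis (Sum.inl i)) = B.basis (Sum.inr i.castSucc)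
  act_inr : ∀ i, N.act (Q₀ F p) (B.basis (Sum.inr i)) = 0 ∧
    N.act (Q₁ F p) (B.basis (Sum.inr i)) = 0

namespace GenEnum

variable {k m n : ℕ}

theorem linearIndependent_fam (E : GenEnum p k m n) (hp : p.Prime) (hF : F.Admissible p) :
    LinearIndependent (Coeff F p) (E.fam F) :=
  (E.linearIndependent_bgFam hp hF).map_injOn (weightLE F p k).subtype
    Subtype.val_injective.injOn

/-- The presentation alone does not show that its relations cause no further collapse. The zigzag in
weight `k` satisfies the relations, so the flash maps to `A // E(0)^∨` with the family going to
independent monomials. -/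
theorem linearIndependent_flashFam (E : GenEnum p k (m + 1) n) (hp : p.Prime)
    (hF : F.Admissible p) : LinearIndependent (Coeff F p) (flashFam F p (m := m)) := by
  have h0 := fun i => E.hzAct_Q₀_fam (F := F) (Sum.inl i)
  have h1 := fun i => E.hzAct_Q₁_fam (F := F) (Sum.inl i)
  let X : Fin (m + 1) → (hz F p).carrier := fun i => E.fam F (Sum.inl (Sum.inl i))
  have hX : ∀ i j : Fin (m + 1), j.val = i.val + 1 →
      (hz F p).act (Q₁ F p) (X j) = (hz F p).act (Q₀ F p) (X i) := fun i j h => by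
    refine (h1 (Sum.inl j)).trans (Eq.trans ?_ (h0 (Sum.inl i)).symm)
    -- Consecutive generators share a lower cell: the position before carry `j` is the position
    -- after carry `i = j - 1`.
    exact congrArg (fun l => E.fam F (Sum.inl (Sum.inr l))) (Fin.ext h)
  have hX0 : ∀ i : Fin (m + 1), (hz F p).act (Q₀ F p * Q₁ F p) (X i) = 0 := fun i => by
    refine ((hz F p).act_Q₁_Q₀ (X i)).symm.trans ?_
    exact (congrArg _ (h0 (Sum.inl i))).trans (h1 (Sum.inr i.succ))
  refine LinearIndependent.of_comp (lightningLift hX fun i _ => hX0 i) ?_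
  have hT : ⇑(lightningLift hX fun i _ => hX0 i) ∘ flashFam F p = fun i => E.fam F (Sum.inl i) := by
    funext i
    rcases i with i | i
    · change lightningLift hX (fun i _ => hX0 i) (lightningX F p i) = _
      rw [← one_smul (SteenrodE F p)ᵐᵒᵖ (lightningX F p i), ← op_one]
      exact ((lightningLift_smul hX (fun i _ => hX0 i) 1 i).trans ((hz F p).act_one _))
    · refine Fin.cases ?_ (fun j => ?_) i
      · exact (lightningLift_smul hX (fun i _ => hX0 i) (Q₁ F p) 0).trans (h1 (Sum.inl 0))
      · exact (lightningLift_smul hX (fun i _ => hX0 i) (Q₀ F p) j).trans (h0 (Sum.inl j))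
  rw [hT]
  exact (E.linearIndependent_fam hp hF).comp _ Sum.inl_injective

theorem exists_isFlashBasis (E : GenEnum p k m n) (hp : p.Prime) (hF : F.Admissible p) :
    ∃ B : Comodule.HomBasis (lightningFlash F p m) (Fin m ⊕ Fin (m + 1)), IsFlashBasis B := by
  cases m with
  | zero =>
    refine ⟨Comodule.unitBasis F p, ?_, fun i => i.elim0, fun i => ?_⟩
    · funext i
      rcases i with i | i
      · exact i.elim0
      · obtain rfl : i = 0 := Fin.ext (by omega)
        exact (zero_smul ℕ _).symm
    · exact Comodule.act_unit_Q _ (Comodule.unitBasis_basis i)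
  | succ m =>
    have hv := E.linearIndependent_flashFam (F := F) hp hF
    have hb := Comodule.HomBasis.mk'_basis (N := lightningFlash F p (m + 1)) (flashFam F p)
      (flashDeg p) hv top_le_span_flashFam fun d x => mem_lightningGr_iff
    have ha := act_ofRightModule (F := F) (p := p) (V := LightningModule F p (m + 1))
      (fun _ _ => rfl) (lightningGr F p (m + 1))
    refine ⟨Comodule.HomBasis.mk' (N := lightningFlash F p (m + 1)) (flashFam F p)
      (flashDeg p) hv top_le_span_flashFam fun d x => mem_lightningGr_iff, rfl,
      fun i => ?_, fun i => ?_⟩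
    · rw [hb, hb, hb, flashFam_castSucc]
      exact ha _
    · rw [hb]
      exact ⟨(ha _).1.trans (smul_flashFam_inr i).1, (ha _).2.trans (smul_flashFam_inr i).2⟩

end GenEnum

/-! ### The basis of the direct sum, and the conclusion -/

namespace Comodule

theorem act_cofreeFam (s : Bool × Bool) :
    (cofree F p).act (Q₀ F p) (cofreeFam F p s) =
      (match s with
      | (false, false) => cofreeFam F p (true, false)
      | (false, true) => -cofreeFam F p (true, true)
      | (true, _) => 0) ∧
    (cofree F p).act (Q₁ F p) (cofreeFam F p s) =
      (match s with
      | (s, false) => cofreeFam F p (s, true)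
      | (_, true) => 0) := by
  rcases s with ⟨_ | _, _ | _⟩
  · refine ⟨?_, ?_⟩
    · exact congrArg DualELeft.of ((rightAct_Q₀ _).trans q₀_t₀₁)
    · exact congrArg DualELeft.of ((rightAct_Q₁ _).trans q₁_t₀₁)
  · refine ⟨?_, ?_⟩
    · exact (map_neg ((cofree F p).act (Q₀ F p)) _).trans
        (congrArg (fun x => -DualELeft.of x) ((rightAct_Q₀ _).trans q₀_t₀))
    · exact (map_neg ((cofree F p).act (Q₁ F p)) _).trans (neg_eq_zero.2
        (congrArg DualELeft.of ((rightAct_Q₁ _).trans q₁_t₀)))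
  · refine ⟨?_, ?_⟩
    · exact congrArg DualELeft.of ((rightAct_Q₀ _).trans q₀_t₁)
    · exact congrArg DualELeft.of ((rightAct_Q₁ _).trans q₁_t₁)
  · refine ⟨?_, ?_⟩
    · exact congrArg DualELeft.of ((rightAct_Q₀ _).trans q₀_one)
    · exact congrArg DualELeft.of ((rightAct_Q₁ _).trans q₁_one)

variable {N : Comodule F p} {m n : ℕ}

/-- The homogeneous basis of the sum of a lightning flash and of free comodules with generators of
degrees `e`. -/
def sumBasis (hF : F.Admissible p) (B : HomBasis N (Fin m ⊕ Fin (m + 1))) (e : Fin n → ℤ × ℤ) :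
    HomBasis (prod N (directSum fun l => suspend (e l - (tauDeg p 0 + tauDeg p 1)) (cofree F p)))
      (FlashIndex m n) :=
  -- Under the right action `E(1)^∨` is generated by `τ₀ τ₁`, so a generator of degree `e l`
  -- requires the suspension by `e l - (|τ₀| + |τ₁|)`.
  B.prod (HomBasis.directSum fun l => (cofreeBasis hF).suspend (e l - (tauDeg p 0 + tauDeg p 1)))

theorem sumBasis_deg (hF : F.Admissible p) {B : HomBasis N (Fin m ⊕ Fin (m + 1))}
    (hB : IsFlashBasis B) (e : Fin n → ℤ × ℤ) : (sumBasis hF B e).deg = stdDeg p e := by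
  funext i
  rcases i with i | ⟨l, s⟩
  · exact congrFun hB.deg_eq i
  · change cofreeDeg p s + _ = e l - loss p s
    rw [cofreeDeg]
    abel

variable (F p) in
/-- The inclusion of a summand. -/
def inrSingle (N : Comodule F p) (d : Fin n → ℤ × ℤ) (l : Fin n) :
    DualELeft F p →+ (prod N (directSum fun l => suspend (d l) (cofree F p))).carrier :=
  (AddMonoidHom.inr N.carrier (Fin n → DualELeft F p)).comp
    (AddMonoidHom.single (fun _ : Fin n => DualELeft F p) l)

theorem act_inrSingle (d : Fin n → ℤ × ℤ) (l : Fin n) (θ : SteenrodE F p) (x : DualELeft F p) :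
    (prod N (directSum fun l => suspend (d l) (cofree F p))).act θ (inrSingle F p N d l x) =
      inrSingle F p N d l ((cofree F p).act θ x) := by
  refine (act_prod θ _).trans (Prod.ext (map_zero (N.act θ)) ?_)
  refine (act_directSum θ _).trans ?_
  exact (Pi.single_op (fun _ => (cofree F p).act θ) (fun _ => map_zero _) l x).symm

theorem sumBasis_inr (hF : F.Admissible p) (B : HomBasis N (Fin m ⊕ Fin (m + 1)))
    (e : Fin n → ℤ × ℤ) (l : Fin n) (s : Bool × Bool) :
    (sumBasis hF B e).basis (Sum.inr ⟨l, s⟩) = inrSingle F p N _ l (cofreeFam F p s) := by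
  refine (HomBasis.prod_basis_inr _ _ _).trans ?_
  rw [HomBasis.directSum_basis]
  exact congrArg (inrSingle F p N _ l) (cofreeBasis_basis hF s)

theorem act_inl {P : Comodule F p} (θ : SteenrodE F p) (x : N.carrier) :
    (prod N P).act θ ((x, 0) : N.carrier × P.carrier) = ((N.act θ x, 0) : N.carrier × P.carrier) :=
  (act_prod θ _).trans (Prod.ext rfl (map_zero (P.act θ)))

theorem act_sumBasis (hF : F.Admissible p) {B : HomBasis N (Fin m ⊕ Fin (m + 1))}
    (hB : IsFlashBasis B) (e : Fin n → ℤ × ℤ) (i : FlashIndex m n) :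
    (prod N (directSum fun l => suspend (e l - (tauDeg p 0 + tauDeg p 1)) (cofree F p))).act
      (Q₀ F p) ((sumBasis hF B e).basis i) = stdQ₀ (sumBasis hF B e).basis i ∧
    (prod N (directSum fun l => suspend (e l - (tauDeg p 0 + tauDeg p 1)) (cofree F p))).act
      (Q₁ F p) ((sumBasis hF B e).basis i) = stdQ₁ (sumBasis hF B e).basis i := by
  have hl : ∀ i, (sumBasis hF B e).basis (Sum.inl i) = ((B.basis i, 0) : N.carrier × _) :=
    fun i => HomBasis.prod_basis_inl _ _ i
  rcases i with (i | i) | ⟨l, s⟩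
  · rw [hl, stdQ₀, stdQ₁, hl, hl, ← (hB.act_inl i).1, ← (hB.act_inl i).2]
    exact ⟨act_inl _ _, act_inl _ _⟩
  · rw [hl]
    exact ⟨(act_inl _ _).trans (congrArg (·, 0) (hB.act_inr i).1),
      (act_inl _ _).trans (congrArg (·, 0) (hB.act_inr i).2)⟩
  · rw [sumBasis_inr, act_inrSingle, act_inrSingle, (act_cofreeFam s).1, (act_cofreeFam s).2]
    have h0 := map_zero (inrSingle F p N (fun l => e l - (tauDeg p 0 + tauDeg p 1)) l)
    rcases s with ⟨_ | _, _ | _⟩ <;> simp only [stdQ₀, stdQ₁, sumBasis_inr, map_neg, true_and]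
    exacts [h0, ⟨h0, trivial⟩, ⟨h0, h0⟩]

end Comodule

end

end Mot

theorem mainTheorem8 (F : BaseField) (p : ℕ) [Fact p.Prime] (hF : F.Admissible p) (k : ℕ) :
    ∃ (n : ℕ) (d : Fin n → ℤ × ℤ), Nonempty (Mot.Comodule.Iso (Mot.brownGitler F p k)
      (Mot.Comodule.prod (Mot.lightningFlash F p (padicValNat p k.factorial))
        (Mot.Comodule.directSum fun j => Mot.Comodule.suspend (d j) (Mot.cofree F p)))) := by
  have hp : p.Prime := Fact.out
  obtain ⟨n, ⟨E⟩⟩ := Mot.exists_genEnum (p := p) k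
  obtain ⟨B, hB⟩ := E.exists_isFlashBasis hp hF
  -- One free summand for each free generator of weight `k`; the suspensions are dictated by
  -- `sumBasis`.
  exact ⟨n, _, (E.bgBasis hp hF).nonempty_iso_std (Mot.Comodule.sumBasis hF B E.genDeg)
    (Mot.Comodule.sumBasis_deg hF hB _).symm
    (fun i => (E.act_bgBasis hp hF i).1) (fun i => (E.act_bgBasis hp hF i).2)
    (fun i => (Mot.Comodule.act_sumBasis hF hB _ i).1)
    fun i => (Mot.Comodule.act_sumBasis hF hB _ i).2⟩
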